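/- Setting. Let $m,n\ge 1$, let $a_1,\dots,a_m\in\mathbb C$ be distinct, let $S=(\mathbb C\cup\{\infty\})\setminus\{a_1,\dots,a_m\}$ and let $\rho:\widetilde S\to S$ be its universal covering, with deck group $\Delta$. Let $\sigma_1,\dots,\sigma_m$ be generators of $\Delta$ such that $\sigma_k$ corresponds to going once around $a_k$ in positive direction and $\sigma_1\circ\cdots\circ\sigma_m=\mathrm{id}$. Put $\widetilde S^*=\widetilde S\setminus\rho^{-1}(\infty)$. The monodromy of a system $Y'=A(z)Y$, resp. of a scalar linear equation of order $n$, is the simultaneous similarity class of $[\chi(\sigma_1),\dots,\chi(\sigma_m)]$, where $Y(\tilde z)=Y(\sigma(\tilde z))\chi(\sigma)$ for an invertible matrix solution $Y$ on $\widetilde S^*$, resp. $(y_1,\dots,y_n)(\tilde z)=(y_1,\dots,y_n)(\sigma(\tilde z))\,\chi(\sigma)$ for linearly independent solutions $y_1,\dots,y_n$. Let $[M_1,\dots,M_m]$, $[E_1,\dots,E_m]$ be admissible data of complex $n\times n$ matrices: $M_1\cdots M_m=I$; $M_k$ is similar to $\exp(-2\pi i E_k)$ for each $k$; and no two eigenvalues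 of the same $E_k$ differ by a nonzero integer. Let $\varkappa_1\ge\dots\ge\varkappa_n$ be integers with $\varkappa_k-\varkappa_{k+1}=m-2$ for $1\le k<n$. Let $\varepsilon_k^{(1)},\dots,\varepsilon_k^{(n)}$ be the eigenvalues of $E_k$, counted with algebraic multiplicity. A system $Y'=A(z)Y$ is of standard form with these data, singularities $a_1,\dots,a_m$ and indices $\varkappa_1,\dots,\varkappa_n$ if $A$ is analytic on $\mathbb C\setminus\{a_1,\dots,a_m\}$; $\infty$ is at most an apparent singularity (the solutions do not branch there); its monodromy is the class of $[M_1,\dots,M_m]$; near each $a_k$ the solutions have the form $Z_k(z)(z-a_k)^{E_k}C$ with $Z_k$ analytic and invertible near and at $a_k$ and $C$ a constant invertible matrix; and near $\infty$ the solutions have the form $\mathrm{diag}(z^{\varkappa_1},\dots,z^{\varkappa_n})Z_\infty(z)C$ with $Z_\infty$ analytic and invertible near and at $\infty$ and $C$ a constant invertible matrix. Theorem. The following two statements are equivalent. (i) There is a system $Y'=A(z)Y$ of standard form with data $[M_1,\dots,M_m]$, $[E_1,\dots,E_m]$, singularities $a_1,\dots,a_m$ and indices $\varkappa_1,\dots,\varkappa_n$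 such that, with $p(z)=(z-a_1)\cdots(z-a_m)$, the entries of the matrix $p(z)A(z)$ are $\varkappa_i z^{m-1}+p_{ii}(z)$ at the places $(i,i)$, $p_{ij}(z)$ at the places $(i,j)$ with $i<j$, constants $\alpha_j$ at the places $(j+1,j)$, and $0$ elsewhere, where $p_{ij}$ is a polynomial of degree at most $(m-2)(1+j-i)$ (the zero polynomial if this number is negative) and $\alpha_1\cdots\alpha_{n-1}\ne0$. (ii) There is a scalar equation $y^{(n)}+q_1(z)y^{(n-1)}+\dots+q_n(z)y=0$ with monodromy given by $[M_1,\dots,M_m]$ and with coefficients analytic on $\mathbb C\setminus\{a_1,\dots,a_m\}$, which has no singularity at $\infty$ (the equation for $\hat y(\xi)=y(1/\xi)$ has analytic coefficients at $\xi=0$), and which at each $a_k$ is Fuchsian ($q_j(z)=r_{jk}(z)/(z-a_k)^j$ with $r_{jk}$ analytic at $a_k$), with local exponents, i.e. roots with multiplicity of the indicial equation $\rho(\rho-1)\cdots(\rho-n+1)+\sum_{j=1}^n r_{jk}(a_k)\,\rho(\rho-1)\cdots(\rho-n+1+j)=0$, equal to $\varepsilon_k^{(1)},\dots,\varepsilon_k^{(n)}$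 for $k=1,\dots,m-1$ and to $\varepsilon_m^{(1)}-\varkappa_n,\dots,\varepsilon_m^{(n)}-\varkappa_n$ for $k=m$. -/

import Mathlib

open Complex Metric

noncomputable section

namespace StdForm

/-! ### The punctured sphere, its universal covering and the deck transformations -/

/-- The sphere `ℂ ∪ {∞}` without the finite points `a 0, …, a (m-1)`. -/
abbrev PSphere {m : ℕ} (a : Fin m → ℂ) : Type :=
  {s : OnePoint ℂ // ∀ k, s ≠ ((a k : ℂ) : OnePoint ℂ)}

/-- The finite part of the punctured sphere. -/
abbrev PPlane {m : ℕ} (a : Fin m → ℂ) : Type := {z : ℂ // ∀ k, z ≠ a k}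

/-- The inclusion of the punctured plane in the punctured sphere. -/
def PPlane.toSphere {m : ℕ} {a : Fin m → ℂ} (z : PPlane a) : PSphere a :=
  ⟨((z.1 : ℂ) : OnePoint ℂ), fun k h => z.2 k (OnePoint.coe_injective h)⟩

/-- The part lying over the finite points of the universal covering surface of the punctured
sphere. The universal covering is the standard one: its points are the homotopy classes, with
fixed ends, of the paths in the punctured sphere that start at the base point `x₀`; such a class
lies over its end point. -/
def Cover {m : ℕ} (a : Fin m → ℂ) (x₀ : PSphere a) : Type :=
  Σ z : PPlane a, Path.Homotopic.Quotient x₀ z.toSphere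

/-- The point of the plane that lies under a point of the covering. -/
def Cover.proj {m : ℕ} {a : Fin m → ℂ} {x₀ : PSphere a} (x : Cover a x₀) : ℂ := x.1.1

/-- The deck transformation given by the class `ℓ` of a loop at `x₀`: `[γ] ↦ [ℓ · γ]`. -/
def deck {m : ℕ} {a : Fin m → ℂ} {x₀ : PSphere a} (ℓ : Path.Homotopic.Quotient x₀ x₀)
    (x : Cover a x₀) : Cover a x₀ :=
  ⟨x.1, ℓ.trans x.2⟩

/-- On the sheet through `x` over the disc of radius `r` around the projection of `x`, the
function `f` is given by the function `F` of the variable `w` in this disc. The points of the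
sheet are obtained from `x` by appending paths that run inside the disc. -/
def IsSheetOf {α : Type*} {m : ℕ} {a : Fin m → ℂ} {x₀ : PSphere a}
    (f : Cover a x₀ → α) (x : Cover a x₀) (r : ℝ) (F : ℂ → α) : Prop :=
  ∀ (w : PPlane a) (c : Path x.1.toSphere w.toSphere),
    (∀ t, ∃ u ∈ ball x.proj r, (c t).1 = ((u : ℂ) : OnePoint ℂ)) →
      f ⟨w, x.2.trans (Path.Homotopic.Quotient.mk c)⟩ = F w.1

/-- The loop class `ℓ` goes once around the point `a k` in positive direction (and around no other
of the points): it is represented by a path `c`, followed by a small positively oriented circle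
around `a k`, followed by the reversed path `c`. -/
def GoesOnceAround {m : ℕ} (a : Fin m → ℂ) (x₀ : PSphere a) (k : Fin m)
    (ℓ : Path.Homotopic.Quotient x₀ x₀) : Prop :=
  ∃ r : ℝ, 0 < r ∧ (∀ j, j ≠ k → r < ‖a j - a k‖) ∧
    ∃ (b : PSphere a) (c : Path x₀ b) (d : Path b b),
      (∀ t : unitInterval,
        (d t).1 = ((a k + r * exp (2 * Real.pi * I * ((t : ℝ) : ℂ)) : ℂ) : OnePoint ℂ)) ∧
      ℓ = ((Path.Homotopic.Quotient.mk c).trans (Path.Homotopic.Quotient.mk d)).trans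
        (Path.Homotopic.Quotient.mk c).symm

/-- The deck transformations of `ℓ 0, …, ℓ (m-1)` form a standard system of generators
`σ₁, …, σₘ`: they generate the group, `σₖ` corresponds to going once around `aₖ` in positive
direction, and `σ₁ ∘ σ₂ ∘ ⋯ ∘ σₘ = id`. -/
structure IsStandardGenerators {m : ℕ} (a : Fin m → ℂ) (x₀ : PSphere a)
    (ℓ : Fin m → Path.Homotopic.Quotient x₀ x₀) : Prop where
  around : ∀ k, GoesOnceAround a x₀ k (ℓ k)
  prod_eq : (List.ofFn ℓ).foldr Path.Homotopic.Quotient.trans (Path.Homotopic.Quotient.refl x₀)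
    = Path.Homotopic.Quotient.refl x₀
  generate : Subgroup.closure
    (Set.range fun k => (FundamentalGroup.fromPath (ℓ k) : FundamentalGroup _ x₀)) = ⊤

/-! ### Admissible data -/

/-- The difference of any two eigenvalues is not a nonzero integer. -/
def NonResonant {n : ℕ} (E : Matrix (Fin n) (Fin n) ℂ) : Prop :=
  ∀ s ∈ spectrum ℂ E, ∀ t ∈ spectrum ℂ E, ∀ d : ℤ, s - t = (d : ℂ) → d = 0

/-- Admissible data; similarity of matrices is conjugacy in the monoid of matrices by a unit. -/
structure Admissible {m n : ℕ} (M E : Fin m → Matrix (Fin n) (Fin n) ℂ) : Prop where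
  prod_eq_one : (List.ofFn M).prod = 1
  similar : ∀ k, IsConj (M k) (NormedSpace.exp ((-(2 * Real.pi * I) : ℂ) • E k))
  nonResonant : ∀ k, NonResonant (E k)

/-! ### Systems `Y' = A(z) Y` and their monodromy -/

/-- `Y` solves `Y' = A(z) Y` at the point `z`. -/
def SolvesSystemAt {n : ℕ} (A : ℂ → Matrix (Fin n) (Fin n) ℂ)
    (Y : ℂ → Matrix (Fin n) (Fin n) ℂ) (z : ℂ) : Prop :=
  ∀ i j, HasDerivAt (fun w => Y w i j) ((A z * Y z) i j) z

/-- `Y` is an (invertible) matrix solution of `Y' = A(z) Y` on the universal covering of the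
punctured sphere, over its finite points. -/
def IsSystemSolution {m n : ℕ} (a : Fin m → ℂ) (x₀ : PSphere a)
    (A : ℂ → Matrix (Fin n) (Fin n) ℂ) (Y : Cover a x₀ → Matrix (Fin n) (Fin n) ℂ) : Prop :=
  ∀ x : Cover a x₀, (Y x).det ≠ 0 ∧
    ∃ r > 0, ∃ F : ℂ → Matrix (Fin n) (Fin n) ℂ,
      (∀ w ∈ ball x.proj r, SolvesSystemAt A F w) ∧ IsSheetOf Y x r F

/-- The monodromy of the system is the simultaneous similarity class of `[M₁, …, Mₘ]`. -/
def SystemMonodromy {m n : ℕ} (a : Fin m → ℂ) (x₀ : PSphere a)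
    (ℓ : Fin m → Path.Homotopic.Quotient x₀ x₀)
    (A : ℂ → Matrix (Fin n) (Fin n) ℂ) (M : Fin m → Matrix (Fin n) (Fin n) ℂ) : Prop :=
  ∃ Y : Cover a x₀ → Matrix (Fin n) (Fin n) ℂ, IsSystemSolution a x₀ A Y ∧
    ∃ χ : Fin m → Matrix (Fin n) (Fin n) ℂ,
      (∀ k x, Y x = Y (deck (ℓ k) x) * χ k) ∧
      ∃ C : GL (Fin n) ℂ, ∀ k, M k = (↑C⁻¹ : Matrix (Fin n) (Fin n) ℂ) * χ k * C

/-- On some punctured disc around `a k`, the solutions have the form `Z(z) (z - aₖ)^E C` with `Z`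
analytic and invertible on the full disc. The universal covering of the punctured disc
`0 < |z - aₖ| < ε` is the half plane `Re ζ < log ε` with `z = aₖ + exp ζ`, so that
`log (z - aₖ) = ζ`. -/
def LocalForm {m n : ℕ} (a : Fin m → ℂ) (A : ℂ → Matrix (Fin n) (Fin n) ℂ) (k : Fin m)
    (E : Matrix (Fin n) (Fin n) ℂ) : Prop :=
  ∃ ε > 0, (∀ j, j ≠ k → ε ≤ ‖a j - a k‖) ∧
    ∀ Y : ℂ → Matrix (Fin n) (Fin n) ℂ,
      (∀ ζ : ℂ, ζ.re < Real.log ε → (Y ζ).det ≠ 0 ∧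
        SolvesSystemAt (fun ξ => exp ξ • A (a k + exp ξ)) Y ζ) →
      ∃ (Z : ℂ → Matrix (Fin n) (Fin n) ℂ) (C : GL (Fin n) ℂ),
        (∀ z ∈ ball (a k) ε, (Z z).det ≠ 0 ∧ ∀ i j, AnalyticAt ℂ (fun w => Z w i j) z) ∧
        ∀ ζ : ℂ, ζ.re < Real.log ε →
          Y ζ = Z (a k + exp ζ) * NormedSpace.exp (ζ • E) * C

/-- Infinity is an apparent singularity, i.e. solutions near infinity have no branching there.
The universal covering of `|z| > R` is the half plane `Re ζ > log R` with `z = exp ζ`. -/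
def ApparentAtInfinity {m n : ℕ} (a : Fin m → ℂ) (A : ℂ → Matrix (Fin n) (Fin n) ℂ) : Prop :=
  ∃ R > 0, (∀ k, ‖a k‖ ≤ R) ∧
    ∀ Y : ℂ → Matrix (Fin n) (Fin n) ℂ,
      (∀ ζ : ℂ, Real.log R < ζ.re → (Y ζ).det ≠ 0 ∧
        SolvesSystemAt (fun ξ => exp ξ • A (exp ξ)) Y ζ) →
      ∀ ζ : ℂ, Real.log R < ζ.re → Y (ζ + 2 * Real.pi * I) = Y ζ

/-- Near infinity the (single-valued) solutions have the form
`diag(z^κ₁, …, z^κₙ) Z∞(z) C` with `Z∞` analytic and invertible, also at infinity; here `Z∞` is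
written as a function of `1 / z`. -/
def FormAtInfinity {m n : ℕ} (a : Fin m → ℂ) (A : ℂ → Matrix (Fin n) (Fin n) ℂ)
    (κ : Fin n → ℤ) : Prop :=
  ∃ R > 0, (∀ k, ‖a k‖ ≤ R) ∧
    ∀ Y : ℂ → Matrix (Fin n) (Fin n) ℂ,
      (∀ z : ℂ, R < ‖z‖ → (Y z).det ≠ 0 ∧ SolvesSystemAt A Y z) →
      ∃ (Z : ℂ → Matrix (Fin n) (Fin n) ℂ) (C : GL (Fin n) ℂ),
        (∀ ξ ∈ ball (0 : ℂ) R⁻¹, (Z ξ).det ≠ 0 ∧ ∀ i j, AnalyticAt ℂ (fun w => Z w i j) ξ) ∧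
        ∀ z : ℂ, R < ‖z‖ →
          Y z = Matrix.diagonal (fun i => z ^ κ i) * Z z⁻¹ * C

/-- The system `Y' = A(z) Y` is of standard form with respect to the data `M`, `E`, with
singularities `a` and indices `κ`. -/
structure IsStandardForm {m n : ℕ} (a : Fin m → ℂ) (x₀ : PSphere a)
    (ℓ : Fin m → Path.Homotopic.Quotient x₀ x₀) (A : ℂ → Matrix (Fin n) (Fin n) ℂ)
    (M E : Fin m → Matrix (Fin n) (Fin n) ℂ) (κ : Fin n → ℤ) : Prop where
  admissible : Admissible M E
  antitone : Antitone κ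
  analytic : ∀ z : ℂ, (∀ k, z ≠ a k) → ∀ i j, AnalyticAt ℂ (fun w => A w i j) z
  apparent : ApparentAtInfinity a A
  monodromy : SystemMonodromy a x₀ ℓ A M
  localForm : ∀ k, LocalForm a A k (E k)
  formAtInfinity : FormAtInfinity a A κ

/-- The polynomials of degree at most `d`; only the zero polynomial if `d < 0`. -/
def DegLE (d : ℤ) (f : Polynomial ℂ) : Prop := f = 0 ∨ (f.natDegree : ℤ) ≤ d

/-- Off the points `a`, the matrix function `A(z)` is `1 / ((z - a₁) ⋯ (z - aₘ))` times the upper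
Hessenberg matrix with the diagonal entries `κᵢ z^(m-1) + pᵢᵢ(z)`, the entries `pᵢⱼ(z)` above the
diagonal, and nonzero constants `α₁, …, α₍ₙ₋₁₎` just below the diagonal, where `pᵢⱼ` has degree at
most `(m-2)(1+j-i)`. -/
def HasHessenbergForm {m n : ℕ} (a : Fin m → ℂ) (κ : Fin n → ℤ)
    (A : ℂ → Matrix (Fin n) (Fin n) ℂ) : Prop :=
  ∃ (α : Fin n → ℂ) (p : Fin n → Fin n → Polynomial ℂ),
    (∀ j : Fin n, (j : ℕ) + 1 < n → α j ≠ 0) ∧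
    (∀ i j : Fin n, i ≤ j → DegLE (((m : ℤ) - 2) * (1 + (j : ℕ) - (i : ℕ))) (p i j)) ∧
    ∀ z : ℂ, (∀ k, z ≠ a k) → ∀ i j : Fin n,
      A z i j = (∏ k, (z - a k))⁻¹ *
        (if i = j then (κ i : ℂ) * z ^ (m - 1) + (p i j).eval z
         else if i < j then (p i j).eval z
         else if (i : ℕ) = (j : ℕ) + 1 then α j
         else 0)

/-! ### Scalar equations `y⁽ⁿ⁾ + q₁(z) y⁽ⁿ⁻¹⁾ + ⋯ + qₙ(z) y = 0` -/

/-- The left hand side of the scalar equation at the point `z`; `q j` is the coefficient with the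
mathematical index `j + 1`. -/
def scalarOp {n : ℕ} (q : Fin n → ℂ → ℂ) (y : ℂ → ℂ) (z : ℂ) : ℂ :=
  iteratedDeriv n y z + ∑ j : Fin n, q j z * iteratedDeriv (n - 1 - (j : ℕ)) y z

/-- `y` is a solution of the scalar equation on the universal covering (over finite points). -/
def IsScalarSolution {m n : ℕ} (a : Fin m → ℂ) (x₀ : PSphere a) (q : Fin n → ℂ → ℂ)
    (y : Cover a x₀ → ℂ) : Prop :=
  ∀ x : Cover a x₀, ∃ r > 0, ∃ F : ℂ → ℂ,
    (∀ w ∈ ball x.proj r, AnalyticAt ℂ F w ∧ scalarOp q F w = 0) ∧ IsSheetOf y x r F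

/-- The monodromy of the scalar equation is the simultaneous similarity class of `[M₁, …, Mₘ]`. -/
def ScalarMonodromy {m n : ℕ} (a : Fin m → ℂ) (x₀ : PSphere a)
    (ℓ : Fin m → Path.Homotopic.Quotient x₀ x₀)
    (q : Fin n → ℂ → ℂ) (M : Fin m → Matrix (Fin n) (Fin n) ℂ) : Prop :=
  ∃ y : Fin n → Cover a x₀ → ℂ, (∀ j, IsScalarSolution a x₀ q (y j)) ∧
    LinearIndependent ℂ y ∧
    ∃ χ : Fin m → Matrix (Fin n) (Fin n) ℂ,
      (∀ k x j, y j x = ∑ i, y i (deck (ℓ k) x) * χ k i j) ∧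
      ∃ C : GL (Fin n) ℂ, ∀ k, M k = (↑C⁻¹ : Matrix (Fin n) (Fin n) ℂ) * χ k * C

/-- The indicial polynomial `ρ(ρ-1)⋯(ρ-n+1) + ∑ₖ cₖ ρ(ρ-1)⋯(ρ-n+1+k)`, where `c j` has the
mathematical index `k = j + 1`. -/
def indicialPoly {n : ℕ} (c : Fin n → ℂ) : Polynomial ℂ :=
  descPochhammer ℂ n +
    ∑ j : Fin n, Polynomial.C (c j) * descPochhammer ℂ (n - 1 - (j : ℕ))

/-- The point `b` is (at most) a Fuchsian singularity of the scalar equation, with the multiset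
`s` of local exponents. -/
def FuchsianAt {n : ℕ} (q : Fin n → ℂ → ℂ) (b : ℂ) (s : Multiset ℂ) : Prop :=
  ∃ r : Fin n → ℂ → ℂ, (∀ j, AnalyticAt ℂ (r j) b) ∧
    (∀ j, ∀ᶠ z in nhdsWithin b {b}ᶜ, q j z = r j z / (z - b) ^ ((j : ℕ) + 1)) ∧
    (indicialPoly fun j => r j b).roots = s

/-- Infinity is not a singularity of the scalar equation: the equation that results from the change
of variables `z = 1 / ξ`, `ŷ(ξ) = y(1 / ξ)` has coefficients `q̂` that are analytic at `ξ = 0`. -/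
def RegularAtInfinity {n : ℕ} (q : Fin n → ℂ → ℂ) : Prop :=
  ∃ r > 0, ∃ qh : Fin n → ℂ → ℂ, (∀ j, ∀ ξ ∈ ball (0 : ℂ) r, AnalyticAt ℂ (qh j) ξ) ∧
    ∀ ξ ∈ ball (0 : ℂ) r, ξ ≠ 0 → ∀ y : ℂ → ℂ, AnalyticAt ℂ y ξ⁻¹ →
      (scalarOp q y ξ⁻¹ = 0 ↔ scalarOp qh (fun w => y w⁻¹) ξ = 0)

/-- The scalar equation has no singularities on the sphere except Fuchsian ones at the points `a`,
where the local exponents are `s k` at `a k`. -/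
structure IsFuchsianEquation {m n : ℕ} (a : Fin m → ℂ) (q : Fin n → ℂ → ℂ)
    (s : Fin m → Multiset ℂ) : Prop where
  analytic : ∀ z : ℂ, (∀ k, z ≠ a k) → ∀ j, AnalyticAt ℂ (q j) z
  fuchsian : ∀ k, FuchsianAt q (a k) (s k)
  regular : RegularAtInfinity q

end StdForm

end

/-! Number the components of a Hessenberg system from the last one. Since the subdiagonal constants
do not vanish, the equation of each component determines the next component, so the last component
`u` determines all the others. Put `g = (z - a_m)^κₙ` and `y = u / g`. The components are then `g ·
V_l y`, where `V_0 y = y` and `β_l V_{l+1} y = p (V_l y)' - ∑_{s ≤ l} K_{ls} V_s y + κₙ (p / (z -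
a_m)) V_l y`. Here `K` is `p A` in the reversed numbering and `β_l` are the subdiagonal constants.
The first row of the system closes this chain and says `V_n y = 0`, which is the scalar equation; in
it `β_{n-1}` is only an arbitrary nonzero normalisation. Both directions compare the system with
this equation.

At `a_k` the coefficient of `y⁽ʲ⁾` in `V_l` is divisible by `(z - a_k)^j`, and the leading
coefficient of `V_n` is a constant times `p^n`, so the equation is Fuchsian. The indicial
polynomials of the `V_l` satisfy the recursion that computes the characteristic polynomial of a
Hessenberg matrix. Hence the exponents are the eigenvalues of the residue of `A`, lowered by `κₙ` at
`a_m` because of `g` (`charpoly_of_recursion`, `HessData.fuchsianAt_q`). Under `z = 1/ξ` the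
operators `ξ^(l(m-2)) V_l` form a chain of the same shape with polynomial coefficients in `ξ`: the
degree bounds take care of the `p_ij`, while `g` and the gaps `m - 2` between the indices cancel the
leading terms of the diagonal (`HessData.V_inv`). So infinity is a regular point.

For (i) ⇒ (ii) it remains to see that the local form makes the residue similar to `E_k`
(`HessData.residue_conj`) and that the last row of a fundamental matrix, divided by the
single-valued `g`, consists of independent solutions with the same monodromy
(`HessData.scalarMonodromy`).

For (ii) ⇒ (i), start from the chain `V_l` of the system without the polynomials `p_ij` and expand
the given operator in `V_0, …, V_n`. The coefficients of this expansion extend to entire functions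
by the Fuchs condition and have bounded growth by regularity at infinity, so they are polynomials of
the required degrees (`HessData.exists_polynomial_lowerTerm`). They become the first row of the
matrix. Independent solutions `y_j` give the fundamental matrix with entries `g · V_l y_j`; its
determinant is nonzero by uniqueness for the equation and the identity theorem on the covering
(`HessData.systemMonodromy`).

The exponents give the residue the eigenvalues of `E_k`, so it is nonresonant and Frobenius' theorem
describes the solutions near `a_k` by the residue. Its exponential and that of `E_k` are both
conjugate to the monodromy, up to the factor `-2πi`, and without resonances an intertwiner of the
exponentials already intertwines the matrices (`intertwining_of_exp`). This yields the local form
with `E_k` itself. At infinity, removing `diag(z^κ_i)` leaves a system with residue zero. -/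

section

open Complex Metric Filter Topology

/-! ### Frobenius series in a Banach algebra -/

section Frobenius

variable {𝔸 : Type*} [NormedRing 𝔸] [NormedAlgebra ℂ 𝔸] [CompleteSpace 𝔸]

/-- The commutator with `R`, as a bounded operator. -/
noncomputable def adOp (R : 𝔸) : 𝔸 →L[ℂ] 𝔸 :=
  ContinuousLinearMap.mul ℂ 𝔸 R - (ContinuousLinearMap.mul ℂ 𝔸).flip R

omit [CompleteSpace 𝔸] in
@[simp] lemma adOp_apply (R X : 𝔸) : adOp R X = R * X - X * R := rfl

/-- The coefficients of the Frobenius series with exponent matrix `R = A 0`. -/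
noncomputable def frobeniusCoeff (A : ℕ → 𝔸) (R : 𝔸) : ℕ → 𝔸
  | 0 => 1
  | k + 1 => resolvent (adOp R) ((k + 1 : ℕ) : ℂ)
      (∑ l : Fin (k + 1), A (k + 1 - l) * frobeniusCoeff A R l)
decreasing_by exact l.2

-- This is the coefficient of `z^k` in `z Z' = A Z - Z A₀`. Isolating the terms with index `k` gives
-- `(k - ad A₀) v_k = ∑_{l<k} A_{k-l} v_l`, which the resolvent in `frobeniusCoeff` solves because
-- `k` is not in the spectrum of `ad A₀`.
omit [CompleteSpace 𝔸] in
lemma frobeniusCoeff_recursion (A : ℕ → 𝔸) (h : ∀ k : ℕ, 1 ≤ k → (k : ℂ) ∉ spectrum ℂ (adOp (A 0)))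
    (k : ℕ) : (k : ℂ) • frobeniusCoeff A (A 0) k =
      ∑ x ∈ Finset.HasAntidiagonal.antidiagonal k, A x.1 * frobeniusCoeff A (A 0) x.2
        - frobeniusCoeff A (A 0) k * A 0 := by
  rw [← Finset.Nat.sum_antidiagonal_swap]
  simp only [Prod.fst_swap, Prod.snd_swap]
  rw [Finset.Nat.sum_antidiagonal_eq_sum_range_succ
    (fun i j => A j * frobeniusCoeff A (A 0) i)]
  cases k with
  | zero => simp [frobeniusCoeff]
  | succ k =>
    have hs : ((k + 1 : ℕ) : ℂ) • frobeniusCoeff A (A 0) (k + 1)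
        - adOp (A 0) (frobeniusCoeff A (A 0) (k + 1)) =
        ∑ l ∈ Finset.range (k + 1), A (k + 1 - l) * frobeniusCoeff A (A 0) l := by
      have hu : IsUnit (algebraMap ℂ (𝔸 →L[ℂ] 𝔸) ((k + 1 : ℕ) : ℂ) - adOp (A 0)) :=
        spectrum.notMem_iff.1 (h (k + 1) (by omega))
      have := Ring.mul_inverse_cancel _ hu
      rw [← Fin.sum_univ_eq_sum_range (fun l => A (k + 1 - l) * frobeniusCoeff A (A 0) l)]
      rw [frobeniusCoeff, resolvent]
      generalize (∑ l : Fin (k + 1), A (k + 1 - l) * frobeniusCoeff A (A 0) l) = w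
      have := congrArg (fun T : 𝔸 →L[ℂ] 𝔸 => T w) this
      simpa [Algebra.algebraMap_eq_smul_one] using this
    rw [Finset.sum_range_succ, Nat.sub_self]
    rw [adOp_apply] at hs
    rw [← hs]
    abel

/-- The resolvent tends to zero at infinity, and a convergent sequence is bounded. Integers in the
spectrum do no harm, since the resolvent has some finite value there too. -/
lemma resolvent_natCast_bounded (T : 𝔸) :
    ∃ K : ℝ, 0 ≤ K ∧ ∀ k : ℕ, ‖resolvent T (k : ℂ)‖ ≤ K := by
  have h : Tendsto (fun k : ℕ => resolvent T (k : ℂ)) atTop (𝓝 0) :=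
    (spectrum.resolvent_tendsto_cobounded (𝕜 := ℂ) T).comp
      (tendsto_norm_atTop_iff_cobounded.1 (by simpa using tendsto_natCast_atTop_atTop))
  obtain ⟨K, hK⟩ := h.norm.bddAbove_range
  exact ⟨max K 0, le_max_right _ _, fun k => le_max_of_le_left (hK ⟨k, rfl⟩)⟩

lemma frobeniusCoeff_bound (A : ℕ → 𝔸) (R : 𝔸) {C r : ℝ} (hC : 0 ≤ C) (hr : 0 < r)
    (hA : ∀ k, ‖A k‖ ≤ C * r ^ k) :
    ∃ Q : ℝ, 0 < Q ∧ ∀ k, ‖frobeniusCoeff A R k‖ ≤ ‖(1 : 𝔸)‖ * Q ^ k := by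
  obtain ⟨K, hK0, hK⟩ := resolvent_natCast_bounded (adOp R)
  -- With `Q - r = r K C` the geometric sum telescopes to `K C ∑_{l<k} r^(k-l) Q^l = Q^k - r^k`, so
  -- the majorant reproduces itself in the recursion.
  set Q := r * (1 + K * C) with hQ
  have hQ0 : 0 < Q := by positivity
  refine ⟨Q, hQ0, fun k => ?_⟩
  have geom : ∀ k : ℕ, K * C * ∑ l ∈ Finset.range k, r ^ (k - l) * Q ^ l ≤ Q ^ k := by
    intro k
    induction k with
    | zero => simp
    | succ k ih =>
      have : ∑ l ∈ Finset.range (k + 1), r ^ (k + 1 - l) * Q ^ l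
          = r * ∑ l ∈ Finset.range k, r ^ (k - l) * Q ^ l + r * Q ^ k := by
        rw [Finset.sum_range_succ, Finset.mul_sum]
        congr 1
        · refine Finset.sum_congr rfl fun l hl => ?_
          rw [Nat.succ_sub (Finset.mem_range.1 hl).le, pow_succ]; ring
        · simp
      rw [this]
      calc _ = r * (K * C * ∑ l ∈ Finset.range k, r ^ (k - l) * Q ^ l) + r * (K * C) * Q ^ k := by
            ring
        _ ≤ r * Q ^ k + r * (K * C) * Q ^ k := by gcongr
        _ = Q ^ (k + 1) := by rw [pow_succ, hQ]; ring
  induction k using Nat.strong_induction_on with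
  | _ k ih =>
    cases k with
    | zero => simp [frobeniusCoeff]
    | succ k =>
      rw [frobeniusCoeff, Fin.sum_univ_eq_sum_range (fun l => A (k + 1 - l) * frobeniusCoeff A R l)]
      calc _ ≤ K * ‖∑ l ∈ Finset.range (k + 1), A (k + 1 - l) * frobeniusCoeff A R l‖ :=
            ContinuousLinearMap.le_of_opNorm_le _ (hK _) _
        _ ≤ K * ∑ l ∈ Finset.range (k + 1), (C * r ^ (k + 1 - l)) * (‖(1 : 𝔸)‖ * Q ^ l) := by
            gcongr
            refine norm_sum_le_of_le _ fun l hl => (norm_mul_le _ _).trans ?_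
            have := ih l (Finset.mem_range.1 hl)
            gcongr
            exact hA _
        _ = ‖(1 : 𝔸)‖ * (K * C * ∑ l ∈ Finset.range (k + 1), r ^ (k + 1 - l) * Q ^ l) := by
            simp only [Finset.mul_sum]
            exact Finset.sum_congr rfl fun _ _ => by ring
        _ ≤ _ := by gcongr; exact geom _

/-- **Frobenius' theorem.** A system `z Y' = A(z) Y` with analytic `A` such that no positive integer
is an eigenvalue of the commutator with `A 0` has the solution `Z(z) z ^ (A 0)`. -/
theorem exists_frobenius_solution {A : ℂ → 𝔸} (hA : AnalyticAt ℂ A 0)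
    (h : ∀ k : ℕ, 1 ≤ k → (k : ℂ) ∉ spectrum ℂ (adOp (A 0))) :
    ∃ ε > 0, ∃ Z : ℂ → 𝔸, Z 0 = 1 ∧ DifferentiableOn ℂ Z (ball 0 ε) ∧
      ∀ z ∈ ball (0 : ℂ) ε, ∃ Z', HasDerivAt Z Z' z ∧ z • Z' = A z * Z z - Z z * A 0 := by
  obtain ⟨p, ρ, hp⟩ := hA
  obtain ⟨C, r, hC, hr, hpn⟩ := p.le_mul_pow_of_radius_pos (hp.r_pos.trans_le hp.r_le)
  have hcoeff : ∀ k, ‖p.coeff k‖ ≤ C * r ^ k := fun k => by simpa using hpn k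
  have hp0 : p.coeff 0 = A 0 := by
    exact hp.coeff_zero 1
  rw [← hp0] at h
  set v := frobeniusCoeff p.coeff (p.coeff 0) with hv
  obtain ⟨Q, hQ, hvb⟩ := frobeniusCoeff_bound p.coeff (p.coeff 0) hC.le hr hcoeff
  have hrec := frobeniusCoeff_recursion p.coeff h
  rw [← hv] at hvb hrec
  obtain ⟨ε₁, hε₁, hε₁ρ⟩ : ∃ ε₁ : ℝ, 0 < ε₁ ∧ ENNReal.ofReal ε₁ ≤ ρ := by
    rcases eq_or_ne ρ ⊤ with rfl | hρ
    · exact ⟨1, one_pos, le_top⟩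
    · exact ⟨ρ.toReal, ENNReal.toReal_pos hp.r_pos.ne' hρ, ENNReal.ofReal_toReal hρ |>.le⟩
  -- On this disc the series of `Z` and of `A` are both dominated by geometric series of ratio
  -- `1/2`, so their Cauchy product may be formed and compared termwise with `z Z'`.
  set ε := min ε₁ (min (1 / (2 * Q)) (1 / (2 * r)))
  have hε : 0 < ε := by positivity
  have hu : Summable fun k : ℕ => ‖(1 : 𝔸)‖ * (1 / 2 : ℝ) ^ k :=
    (summable_geometric_of_lt_one (by norm_num) (by norm_num)).mul_left _
  have hQb : ∀ z ∈ ball (0 : ℂ) ε, ‖z‖ * Q ≤ 1 / 2 := fun z hz => by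
    have : ‖z‖ ≤ 1 / (2 * Q) := ((mem_ball_zero_iff.1 hz).trans_le
      ((min_le_right _ _).trans (min_le_left _ _))).le
    calc ‖z‖ * Q ≤ 1 / (2 * Q) * Q := by gcongr
      _ = 1 / 2 := by field_simp
  have hrb : ∀ z ∈ ball (0 : ℂ) ε, ‖z‖ * r ≤ 1 / 2 := fun z hz => by
    have : ‖z‖ ≤ 1 / (2 * r) := ((mem_ball_zero_iff.1 hz).trans_le
      ((min_le_right _ _).trans (min_le_right _ _))).le
    calc ‖z‖ * r ≤ 1 / (2 * r) * r := by gcongr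
      _ = 1 / 2 := by field_simp
  have hle : ∀ k : ℕ, ∀ z ∈ ball (0 : ℂ) ε, ‖z ^ k • v k‖ ≤ ‖(1 : 𝔸)‖ * (1 / 2 : ℝ) ^ k := by
    intro k z hz
    calc ‖z ^ k • v k‖ ≤ ‖z‖ ^ k * (‖(1 : 𝔸)‖ * Q ^ k) := by
          rw [norm_smul, norm_pow]; gcongr; exact hvb k
      _ = ‖(1 : 𝔸)‖ * (‖z‖ * Q) ^ k := by rw [mul_pow]; ring
      _ ≤ _ := by gcongr; exact hQb z hz
  have hd : ∀ k : ℕ, DifferentiableOn ℂ (fun z : ℂ => z ^ k • v k) (ball 0 ε) := fun k => by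
    fun_prop
  have hdiff := differentiableOn_tsum_of_summable_norm hu hd isOpen_ball hle
  refine ⟨ε, hε, fun z => ∑' k : ℕ, z ^ k • v k, ?_, hdiff, fun z hz =>
    ⟨_, (hdiff.differentiableAt (isOpen_ball.mem_nhds hz)).hasDerivAt, ?_⟩⟩
  · refine (tsum_eq_single 0 fun k hk => ?_).trans ?_
    · simp [hk]
    · simp [hv, frobeniusCoeff]
  · have hvs : Summable fun k : ℕ => ‖z ^ k • v k‖ :=
      Summable.of_nonneg_of_le (fun _ => norm_nonneg _) (fun k => hle k z hz) hu
    have hAs : Summable fun k : ℕ => ‖z ^ k • p.coeff k‖ := by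
      refine Summable.of_nonneg_of_le (fun _ => norm_nonneg _) (fun k => ?_)
        ((summable_geometric_of_lt_one (r := (1 / 2 : ℝ)) (by norm_num) (by norm_num)).mul_left C)
      calc ‖z ^ k • p.coeff k‖ ≤ ‖z‖ ^ k * (C * r ^ k) := by
            rw [norm_smul, norm_pow]; gcongr; exact hcoeff k
        _ = C * (‖z‖ * r) ^ k := by rw [mul_pow]; ring
        _ ≤ _ := by gcongr; exact hrb z hz
    have hAz : HasSum (fun k : ℕ => z ^ k • p.coeff k) (A z) := by
      have : z ∈ eball (0 : ℂ) ρ := by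
        rw [mem_eball, edist_dist]
        refine lt_of_lt_of_le ((ENNReal.ofReal_lt_ofReal_iff hε₁).2 ?_) hε₁ρ
        exact lt_of_lt_of_le (mem_ball.1 hz) (min_le_left _ _)
      simpa using hp.hasSum this
    have hder := (hasSum_deriv_of_summable_norm hu hd isOpen_ball hle hz).const_smul z
    have hprod := tsum_mul_tsum_eq_tsum_sum_antidiagonal_of_summable_norm hAs hvs
    have hprods := (summable_norm_sum_mul_antidiagonal_of_summable_norm hAs hvs).of_norm.hasSum
    rw [← hprod, hAz.tsum_eq] at hprods
    have hright := (hvs.of_norm.hasSum).mul_right (A 0)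
    refine hder.unique ((hprods.sub hright).congr_fun ?_)
    intro k
    have hdk : deriv (fun w : ℂ => w ^ k • v k) z = ((k : ℂ) * z ^ (k - 1)) • v k := by
      rw [deriv_smul_const (by fun_prop)]; simp
    have : z * ((k : ℂ) * z ^ (k - 1)) = z ^ k * k := by
      cases k with
      | zero => simp
      | succ k => simp [pow_succ]; ring
    rw [hdk, smul_smul, this, mul_smul, hrec k, ← hp0, smul_sub, Finset.smul_sum, smul_mul_assoc]
    congr 1
    refine Finset.sum_congr rfl fun x hx => ?_
    rw [smul_mul_smul_comm, ← pow_add, Finset.HasAntidiagonal.mem_antidiagonal.1 hx]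

omit [CompleteSpace 𝔸] in
lemma notMem_spectrum_adOp [FiniteDimensional ℂ 𝔸] {R : 𝔸} {s : ℂ}
    (h : ∀ X, R * X - X * R = s • X → X = 0) : s ∉ spectrum ℂ (adOp R) := by
  have := FiniteDimensional.complete ℂ 𝔸
  rw [spectrum.notMem_iff, ContinuousLinearMap.isUnit_iff_bijective]
  have hinj : Function.Injective (algebraMap ℂ (𝔸 →L[ℂ] 𝔸) s - adOp R) := by
    rw [injective_iff_map_eq_zero]
    intro X hX
    refine h X (sub_eq_zero.1 ?_).symm
    simpa [Algebra.algebraMap_eq_smul_one] using hX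
  exact ⟨hinj, (LinearMap.injective_iff_surjective
    (f := (algebraMap ℂ (𝔸 →L[ℂ] 𝔸) s - adOp R : 𝔸 →L[ℂ] 𝔸).toLinearMap)).1 hinj⟩

end Frobenius

end

section

open Complex Metric Filter Topology
open scoped Matrix.Norms.Operator

namespace StdForm

/-! ### Matrix equations, intertwiners and exponentials -/

section MatrixLemmas

variable {n : ℕ}

lemma hasDerivAt_matrix_iff {Y : ℂ → Matrix (Fin n) (Fin n) ℂ} {Y' : Matrix (Fin n) (Fin n) ℂ}
    {z : ℂ} : HasDerivAt Y Y' z ↔ ∀ i j, HasDerivAt (fun w => Y w i j) (Y' i j) z := by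
  refine (hasDerivAt_pi (φ := Y) (φ' := Y')).trans ?_
  exact forall_congr' fun i => hasDerivAt_pi (φ := fun w => Y w i) (φ' := Y' i)

lemma solvesSystemAt_iff {A Y : ℂ → Matrix (Fin n) (Fin n) ℂ} {z : ℂ} :
    SolvesSystemAt A Y z ↔ HasDerivAt Y (A z * Y z) z :=
  hasDerivAt_matrix_iff.symm

lemma analyticAt_matrix_iff {Y : ℂ → Matrix (Fin n) (Fin n) ℂ} {z : ℂ} :
    AnalyticAt ℂ Y z ↔ ∀ i j, AnalyticAt ℂ (fun w => Y w i j) z := by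
  simp only [analyticAt_iff_eventually_differentiableAt]
  constructor
  · intro h i j
    filter_upwards [h] with w hw
    exact (hasDerivAt_matrix_iff.1 hw.hasDerivAt i j).differentiableAt
  · intro h
    have := (eventually_all.2 fun i => eventually_all.2 fun j => h i j)
    filter_upwards [this] with w hw
    exact ((hasDerivAt_matrix_iff (Y' := fun i j => deriv (fun w => Y w i j) w)).2
      fun i j => (hw i j).hasDerivAt).differentiableAt

/-- Any solution is a constant multiple of an invertible one. -/
lemma exists_eq_mul_of_solves {D : Set ℂ} (hD : IsOpen D) (hD' : IsPreconnected D)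
    {A Ψ Y : ℂ → Matrix (Fin n) (Fin n) ℂ} (hΨ : ∀ z ∈ D, (Ψ z).det ≠ 0 ∧ SolvesSystemAt A Ψ z)
    (hY : ∀ z ∈ D, SolvesSystemAt A Y z) :
    ∃ C : Matrix (Fin n) (Fin n) ℂ, ∀ z ∈ D, Y z = Ψ z * C := by
  -- Variation of constants: differentiating `Ψ⁻¹ Ψ = 1` gives `(Ψ⁻¹)' = -Ψ⁻¹ A`, so that `Ψ⁻¹ Y` is
  -- locally constant.
  have hder : ∀ z ∈ D, HasDerivAt (fun w => (Ψ w)⁻¹ * Y w) 0 z := by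
    intro z hz
    have hu : IsUnit (Ψ z) := (Matrix.isUnit_iff_isUnit_det _).2 (hΨ z hz).1.isUnit
    have hΨd := solvesSystemAt_iff.1 (hΨ z hz).2
    obtain ⟨P, hP⟩ : ∃ P, HasDerivAt (fun w => (Ψ w)⁻¹) P z := by
      have : DifferentiableAt ℂ (fun w => Ring.inverse (Ψ w)) z :=
        (differentiableAt_inverse (𝕜 := ℂ) hu).comp z hΨd.differentiableAt
      simp only [← Matrix.nonsing_inv_eq_ringInverse] at this
      exact ⟨_, this.hasDerivAt⟩
    have h1 := hP.mul hΨd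
    have h2 : HasDerivAt ((fun w => (Ψ w)⁻¹) * Ψ) 0 z := by
      refine (hasDerivAt_const z (1 : Matrix (Fin n) (Fin n) ℂ)).congr_of_eventuallyEq ?_
      filter_upwards [hD.mem_nhds hz] with w hw
      exact Matrix.nonsing_inv_mul _ (hΨ w hw).1.isUnit
    have h3 := h1.unique h2
    have h4 : P = -((Ψ z)⁻¹ * A z) := by
      have := congrArg (· * (Ψ z)⁻¹) h3
      simp only [add_mul, zero_mul, mul_assoc,
        Matrix.mul_nonsing_inv _ (hΨ z hz).1.isUnit, mul_one] at this
      exact eq_neg_of_add_eq_zero_left this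
    have h5 := hP.mul (solvesSystemAt_iff.1 (hY z hz))
    rw [h4] at h5
    convert! h5 using 1
    noncomm_ring
  rcases D.eq_empty_or_nonempty with rfl | ⟨z₀, hz₀⟩
  · exact ⟨0, by simp⟩
  refine ⟨(Ψ z₀)⁻¹ * Y z₀, fun z hz => ?_⟩
  have : (Ψ z)⁻¹ * Y z = (Ψ z₀)⁻¹ * Y z₀ :=
    hD.is_const_of_deriv_eq_zero hD' (f := fun w => (Ψ w)⁻¹ * Y w)
      (fun w hw => (hder w hw).differentiableAt.differentiableWithinAt)
      (fun w hw => (hder w hw).deriv) hz hz₀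
  rw [← this, ← mul_assoc, Matrix.mul_nonsing_inv _ (hΨ z hz).1.isUnit, one_mul]

/-- Sylvester's theorem: matrices with disjoint spectra are only intertwined by zero. -/
lemma eq_zero_of_intertwining {R F X : Matrix (Fin n) (Fin n) ℂ} (h : R * X = X * F)
    (hd : Disjoint (spectrum ℂ R) (spectrum ℂ F)) : X = 0 := by
  rcases Nat.eq_zero_or_pos n with rfl | hn
  · exact Subsingleton.elim _ _
  have : NeZero n := ⟨hn.ne'⟩
  have hp : ∀ p : Polynomial ℂ, Polynomial.aeval R p * X = X * Polynomial.aeval F p := by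
    intro p
    induction p using Polynomial.induction_on' with
    | add p q hp hq => simp [add_mul, mul_add, hp, hq]
    | monomial k c =>
      have hk : R ^ k * X = X * F ^ k :=
        (SemiconjBy.pow_right (show SemiconjBy X F R from h.symm) k).eq.symm
      simp [Polynomial.aeval_monomial, hk, Algebra.algebraMap_eq_smul_one]
  -- By Cayley–Hamilton this polynomial kills `R`, while its value at `F` is invertible because none
  -- of its roots is an eigenvalue of `F`.
  have h0 := hp R.charpoly
  rw [Matrix.aeval_self_charpoly, zero_mul] at h0
  have hu : IsUnit (Polynomial.aeval F R.charpoly) := by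
    rw [← spectrum.zero_notMem_iff ℂ, spectrum.map_polynomial_aeval_of_degree_pos]
    · rintro ⟨μ, hμ, hμ0⟩
      exact Set.disjoint_left.1 hd (Matrix.mem_spectrum_iff_isRoot_charpoly.2 hμ0) hμ
    · rw [Matrix.charpoly_degree_eq_dim]; simpa using hn
  exact (hu.mul_left_eq_zero).1 h0.symm

lemma spectrum_add_smul_one (E : Matrix (Fin n) (Fin n) ℂ) (s t : ℂ) :
    t ∈ spectrum ℂ (E + s • 1) ↔ t - s ∈ spectrum ℂ E := by
  rw [← Algebra.algebraMap_eq_smul_one, ← sub_add_cancel t s, add_sub_cancel_right, add_comm E]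
  exact spectrum.add_mem_add_iff

/-- Eigenvalues of `X ↦ R X - X E` are differences of eigenvalues. -/
lemma exists_sub_eq_of_eigen {R E X : Matrix (Fin n) (Fin n) ℂ} {s : ℂ} (hX : X ≠ 0)
    (h : R * X - X * E = s • X) : ∃ μ ∈ spectrum ℂ R, ∃ ν ∈ spectrum ℂ E, μ - ν = s := by
  by_contra hcon
  push Not at hcon
  refine hX (eq_zero_of_intertwining (R := R) (F := E + s • 1) ?_ ?_)
  · rw [mul_add, ← sub_eq_iff_eq_add', h]; simp
  · refine Set.disjoint_left.2 fun μ hμ hμ' => ?_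
    rw [spectrum_add_smul_one] at hμ'
    exact hcon μ hμ _ hμ' (by ring)

lemma hasDerivAt_exp_smul (E : Matrix (Fin n) (Fin n) ℂ) (t : ℂ) :
    HasDerivAt (fun u : ℂ => NormedSpace.exp (u • E)) (E * NormedSpace.exp (t • E)) t :=
  hasDerivAt_exp_smul_const' E t

lemma det_exp_ne_zero (E : Matrix (Fin n) (Fin n) ℂ) : (NormedSpace.exp E).det ≠ 0 :=
  ((Matrix.isUnit_iff_isUnit_det _).1 (Matrix.isUnit_exp E)).ne_zero

lemma commute_exp_smul (E : Matrix (Fin n) (Fin n) ℂ) (t : ℂ) :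
    Commute E (NormedSpace.exp (t • E)) :=
  Commute.exp_right ((Commute.refl E).smul_right t)

/-- Exponentials of two matrices and an intertwiner of second order. -/
lemma exp_smul_mul_of_sq {R E X Y : Matrix (Fin n) (Fin n) ℂ} (hX : R * X - X * E = Y)
    (hY : R * Y = Y * E) (t : ℂ) :
    NormedSpace.exp (t • R) * X = (X + t • Y) * NormedSpace.exp (t • E) := by
  -- The right-hand side solves `U' = R U` with value `X` at `0`, so by uniqueness it is `exp(tR)
  -- X`.
  have hder : ∀ s : ℂ, SolvesSystemAt (fun _ => R)
      (fun u => (X + u • Y) * NormedSpace.exp (u • E)) s := by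
    intro s
    rw [solvesSystemAt_iff]
    have h1 : HasDerivAt (fun u : ℂ => X + u • Y) Y s := by
      have := ((hasDerivAt_id' s).smul_const Y).const_add X
      rwa [one_smul] at this
    convert! h1.mul (hasDerivAt_exp_smul E s) using 1
    have : R * X = Y + X * E := sub_eq_iff_eq_add.1 hX
    rw [← mul_assoc, ← mul_assoc, ← add_mul, mul_add, this, mul_smul_comm, hY, add_mul X,
      smul_mul_assoc, add_assoc]
  obtain ⟨C, hC⟩ := exists_eq_mul_of_solves (Ψ := fun u => NormedSpace.exp (u • R))
    isOpen_univ isPreconnected_univ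
    (fun z _ => ⟨det_exp_ne_zero _, solvesSystemAt_iff.2 (hasDerivAt_exp_smul R z)⟩)
    (fun z _ => hder z)
  have h0 := hC 0 trivial
  simp only [zero_smul, add_zero, NormedSpace.exp_zero, mul_one, one_mul] at h0
  rw [hC t trivial, h0]

lemma exp_mul_eq_one_iff_int {s : ℂ} (h : exp (-(2 * Real.pi * I) * s) = 1) : ∃ d : ℤ, s = d := by
  obtain ⟨d, hd⟩ := Complex.exp_eq_one_iff.1 h
  refine ⟨-d, ?_⟩
  have : (2 * Real.pi * I : ℂ) ≠ 0 := Complex.two_pi_I_ne_zero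
  apply mul_left_cancel₀ this
  push_cast
  linear_combination -hd

/-- In the absence of resonances, matrices are intertwined if the exponentials are. -/
lemma intertwining_of_exp {R E X : Matrix (Fin n) (Fin n) ℂ}
    (hd : ∀ s ∈ spectrum ℂ R, ∀ t ∈ spectrum ℂ E, ∀ d : ℤ, s - t = (d : ℂ) → d = 0)
    (h : NormedSpace.exp ((-(2 * Real.pi * I) : ℂ) • R) * X
      = X * NormedSpace.exp ((-(2 * Real.pi * I) : ℂ) • E)) : R * X = X * E := by
  set c : ℂ := -(2 * Real.pi * I) with hc
  set T : Module.End ℂ (Matrix (Fin n) (Fin n) ℂ) :=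
    LinearMap.mulLeft ℂ R - LinearMap.mulRight ℂ E with hT
  have hTX : ∀ X, T X = R * X - X * E := fun X => rfl
  set W : Submodule ℂ (Matrix (Fin n) (Fin n) ℂ) :=
    LinearMap.ker (LinearMap.mulLeft ℂ (NormedSpace.exp (c • R))
      - LinearMap.mulRight ℂ (NormedSpace.exp (c • E))) with hW
  have hmem : ∀ X, X ∈ W ↔ NormedSpace.exp (c • R) * X = X * NormedSpace.exp (c • E) := fun X => by
    rw [hW, LinearMap.mem_ker, LinearMap.sub_apply, LinearMap.mulLeft_apply,
      LinearMap.mulRight_apply, sub_eq_zero]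
  have hWT : ∀ X ∈ W, T X ∈ W := by
    intro X hX
    rw [hmem] at hX ⊢
    have h1 := (commute_exp_smul R c).eq
    have h2 := (commute_exp_smul E c).eq
    rw [hTX, mul_sub, sub_mul, ← mul_assoc, ← h1, mul_assoc, hX, ← mul_assoc, ← mul_assoc, hX,
      mul_assoc, mul_assoc, mul_assoc, h2]
  -- On the kernel of `T²` the exponentials produce `X = X + c T X`, so `T` has no Jordan block at
  -- zero inside `W`. It then suffices to show that a nonzero image `T W` would contain a vector
  -- killed by `T`.
  have key : ∀ X ∈ W, T (T X) = 0 → T X = 0 := by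
    intro X hX hTT
    have h1 := exp_smul_mul_of_sq (hTX X).symm (sub_eq_zero.1 ((hTX _).symm.trans hTT)) c
    rw [(hmem X).1 hX] at h1
    have h2 : X = X + c • T X := by
      have := congrArg (· * (NormedSpace.exp (c • E))⁻¹) h1
      simpa only [mul_assoc, Matrix.mul_nonsing_inv _ (det_exp_ne_zero _).isUnit, mul_one]
        using this
    have hc0 : c ≠ 0 := neg_ne_zero.2 Complex.two_pi_I_ne_zero
    exact (smul_eq_zero.1 (left_eq_add.1 h2)).resolve_left hc0
  by_contra hne
  set W' : Submodule ℂ (Matrix (Fin n) (Fin n) ℂ) := W.map T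
  have hW' : ∀ X ∈ W', T X ∈ W' := by
    rintro _ ⟨X, hX, rfl⟩
    exact ⟨T X, hWT X hX, rfl⟩
  have hnt : Nontrivial W' := by
    rw [Submodule.nontrivial_iff_ne_bot, Submodule.ne_bot_iff]
    exact ⟨T X, ⟨X, (hmem X).2 h, rfl⟩, fun h0 => hne (sub_eq_zero.1 ((hTX X).symm.trans h0))⟩
  obtain ⟨s, hs⟩ := Module.End.exists_eigenvalue (T.restrict hW')
  obtain ⟨⟨Y, X', hX', rfl⟩, hv⟩ := hs.exists_hasEigenvector
  have hYs : T (T X') = s • T X' := congrArg Subtype.val hv.apply_eq_smul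
  have hY0 : T X' ≠ 0 := fun h0 => hv.2 (Subtype.ext h0)
  have hYW := hWT X' hX'
  clear hv
  generalize hYdef : T X' = Y at *
  -- An eigenvalue `s` of `T` is a difference of eigenvalues of `R` and `E`. Membership in `W`
  -- forces `exp(-2πi s) = 1`, so `s` is an integer and the hypothesis on differences makes it zero.
  have hs0 : s = 0 := by
    obtain ⟨μ, hμ, ν, hν, hμν⟩ := exists_sub_eq_of_eigen hY0 ((hTX Y).symm.trans hYs)
    have h1 : R * Y - Y * (E + s • 1) = 0 := by
      have := (hTX Y).symm.trans hYs
      rw [mul_add, sub_add_eq_sub_sub, this]; simp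
    have h2 := exp_smul_mul_of_sq h1 (by simp) c
    have h3 : NormedSpace.exp (c • (E + s • (1 : Matrix (Fin n) (Fin n) ℂ)))
        = exp (c * s) • NormedSpace.exp (c • E) := by
      have h4 : NormedSpace.exp ((c * s) • (1 : Matrix (Fin n) (Fin n) ℂ))
          = exp (c * s) • 1 := by
        rw [← Matrix.diagonal_one, ← Matrix.diagonal_smul, Matrix.exp_diagonal,
          ← Matrix.diagonal_smul]
        congr 1
        ext i
        rw [Pi.coe_exp, Complex.exp_eq_exp_ℂ]
        simp
      rw [smul_add, Matrix.exp_add_of_commute, smul_smul, h4]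
      · simp
      · exact ((Commute.one_right _).smul_right s).smul_left c |>.smul_right c
    rw [smul_zero, add_zero, (hmem Y).1 hYW, h3, mul_smul_comm] at h2
    have h4 : Y = exp (c * s) • Y := by
      have := congrArg (· * (NormedSpace.exp (c • E))⁻¹) h2
      simpa only [smul_mul_assoc, mul_assoc, Matrix.mul_nonsing_inv _ (det_exp_ne_zero _).isUnit,
        mul_one] using this
    have h5 : exp (c * s) = 1 := by
      have : (exp (c * s) - 1) • Y = 0 := by rw [sub_smul, one_smul, ← h4, sub_self]
      exact sub_eq_zero.1 ((smul_eq_zero.1 this).resolve_right hY0)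
    obtain ⟨d, rfl⟩ := exp_mul_eq_one_iff_int h5
    rw [hd μ hμ ν hν d hμν]; simp
  exact hY0 (hYdef ▸ key X' hX' (by rw [hYdef, hYs, hs0, zero_smul]))

/-- The eigenvalues of the commutator with `R` are differences of eigenvalues of `R`; this turns
nonresonance into the hypothesis of Frobenius' theorem. -/
lemma natCast_notMem_spectrum_adOp {R : Matrix (Fin n) (Fin n) ℂ} (hR : NonResonant R) (k : ℕ)
    (hk : 1 ≤ k) : (k : ℂ) ∉ spectrum ℂ (adOp R) := by
  refine notMem_spectrum_adOp fun X h1 => ?_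
  by_contra hX0
  obtain ⟨μ, hμ, ν, hν, h2⟩ := exists_sub_eq_of_eigen hX0 h1
  have := hR μ hμ ν hν k (by simpa using h2)
  omega

/-- The local normal form of a nonresonant system at a singular point of the first kind. -/
lemma exists_local_solution {B : ℂ → Matrix (Fin n) (Fin n) ℂ} (hB : AnalyticAt ℂ B 0)
    (hR : NonResonant (B 0)) :
    ∃ ε > 0, ∃ Z : ℂ → Matrix (Fin n) (Fin n) ℂ,
      (∀ z ∈ ball (0 : ℂ) ε, (Z z).det ≠ 0 ∧ AnalyticAt ℂ Z z) ∧
      ∀ z ∈ ball (0 : ℂ) ε, ∃ Z', HasDerivAt Z Z' z ∧ z • Z' = B z * Z z - Z z * B 0 := by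
  obtain ⟨ε, hε, Z, hZ0, hZd, hZ⟩ := exists_frobenius_solution hB
    (fun k hk => natCast_notMem_spectrum_adOp hR k hk)
  have hc : ContinuousAt Z 0 :=
    (hZd.differentiableAt (ball_mem_nhds 0 hε)).continuousAt
  have hdet : ∀ᶠ z in 𝓝 0, (Z z).det ≠ 0 := by
    have : ContinuousAt (fun z => (Z z).det) 0 :=
      (Continuous.matrix_det continuous_id).continuousAt.comp hc
    exact this.eventually_ne (by simp [hZ0])
  obtain ⟨δ, hδ, hδ'⟩ := Metric.eventually_nhds_iff_ball.1 hdet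
  refine ⟨min ε δ, lt_min hε hδ, Z, fun z hz =>
      ⟨hδ' z (ball_subset_ball (min_le_right _ _) hz), ?_⟩,
    fun z hz => hZ z (ball_subset_ball (min_le_left _ _) hz)⟩
  exact hZd.analyticAt (isOpen_ball.mem_nhds (ball_subset_ball (min_le_left _ _) hz))

/-- The substitution `z = exp ζ` turns `z d/dz` into `d/dζ` and the multivalued `z^R` into
`exp(ζR)`. -/
lemma local_solution_solves {B Z : ℂ → Matrix (Fin n) (Fin n) ℂ} {R : Matrix (Fin n) (Fin n) ℂ}
    {ζ : ℂ} (h : ∃ Z', HasDerivAt Z Z' (exp ζ) ∧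
      exp ζ • Z' = B (exp ζ) * Z (exp ζ) - Z (exp ζ) * R) :
    SolvesSystemAt (fun ξ => B (exp ξ)) (fun ξ => Z (exp ξ) * NormedSpace.exp (ξ • R)) ζ := by
  obtain ⟨Z', hZ, h⟩ := h
  rw [solvesSystemAt_iff]
  have h1 := (hZ.scomp ζ (Complex.hasDerivAt_exp ζ)).mul (hasDerivAt_exp_smul R ζ)
  convert! h1 using 1
  simp only [Function.comp]
  rw [h]
  noncomm_ring

lemma norm_exp_lt_iff {ζ : ℂ} {ε : ℝ} (hε : 0 < ε) : ‖exp ζ‖ < ε ↔ ζ.re < Real.log ε := by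
  rw [Complex.norm_exp, Real.lt_log_iff_exp_lt hε]

end MatrixLemmas

end StdForm

end

section

open Complex Metric Filter Topology
open scoped Matrix.Norms.Operator

namespace StdForm

/-! ### Analytic continuation and the identity theorem on the covering -/

section CoverTopology


variable {m : ℕ} {a : Fin m → ℂ} {x₀ : PSphere a}

local notation "⟦" c "⟧ₕ" => Path.Homotopic.Quotient.mk c

lemma continuous_toSphere : Continuous (PPlane.toSphere : PPlane a → PSphere a) :=
  (OnePoint.continuous_coe.comp continuous_subtype_val).subtype_mk _

lemma toSphere_injective : Function.Injective (PPlane.toSphere : PPlane a → PSphere a) := by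
  intro z w h
  exact Subtype.ext (OnePoint.coe_injective (congrArg Subtype.val h))

/-- The straight path in a convex set. -/
noncomputable def convexPath {D : Set ℂ} (hD : Convex ℝ D) (ξ ζ : D) : Path ξ ζ where
  toFun t := ⟨AffineMap.lineMap ξ.1 ζ.1 (t : ℝ), hD.lineMap_mem ξ.2 ζ.2 t.2⟩
  continuous_toFun := by
    refine Continuous.subtype_mk ?_ _
    exact AffineMap.lineMap_continuous.comp continuous_subtype_val
  source' := by simp
  target' := by simp

lemma convexPath_mem {D : Set ℂ} (hD : Convex ℝ D) (ξ ζ : D) {B : Set ℂ} (hB : Convex ℝ B)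
    (h1 : ξ.1 ∈ B) (h2 : ζ.1 ∈ B) (t : unitInterval) : (convexPath hD ξ ζ t).1 ∈ B :=
  hB.lineMap_mem h1 h2 t.2

/-- Continuation of the class `γ` along a map from a simply connected space. -/
noncomputable def liftClass {X : Type*} [TopologicalSpace X] [SimplyConnectedSpace X]
    (e : C(X, PSphere a)) {ξ₀ : X} (γ : Path.Homotopic.Quotient x₀ (e ξ₀)) (ξ : X) :
        Path.Homotopic.Quotient x₀ (e ξ) :=
  γ.trans ((Path.Homotopic.Quotient.mk (PathConnectedSpace.somePath ξ₀ ξ)).map e)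

/-- In a simply connected space all paths with the same ends are homotopic, so the arbitrary path in
the definition can be replaced by a convenient one. -/
lemma liftClass_eq {X : Type*} [TopologicalSpace X] [SimplyConnectedSpace X]
    (e : C(X, PSphere a)) {ξ₀ : X} (γ : Path.Homotopic.Quotient x₀ (e ξ₀)) {ξ : X} (p : Path ξ₀ ξ) :
    liftClass e γ ξ = γ.trans ((Path.Homotopic.Quotient.mk p).map e) := by
  rw [liftClass, Subsingleton.elim (Path.Homotopic.Quotient.mk (PathConnectedSpace.somePath ξ₀ ξ))
      (Path.Homotopic.Quotient.mk p)]

lemma quotient_map_trans {X Y : Type*} [TopologicalSpace X] [TopologicalSpace Y] (e : C(X, Y))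
    {x y z : X} (p : Path.Homotopic.Quotient x y) (q : Path.Homotopic.Quotient y z) :
    (p.trans q).map e = (p.map e).trans (q.map e) := by
  induction p using Path.Homotopic.Quotient.ind
  induction q using Path.Homotopic.Quotient.ind
  rw [← Path.Homotopic.Quotient.mk_trans, ← Path.Homotopic.Quotient.mk_map, Path.map_trans]
  rfl

lemma liftClass_trans {X : Type*} [TopologicalSpace X] [SimplyConnectedSpace X]
    (e : C(X, PSphere a)) {ξ₀ : X} (γ : Path.Homotopic.Quotient x₀ (e ξ₀)) {ξ ξ' : X}
        (p : Path ξ ξ') :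
    liftClass e γ ξ' = (liftClass e γ ξ).trans (Path.Homotopic.Quotient.mk (p.map e.continuous)) :=
        by
  rw [liftClass_eq e γ ((PathConnectedSpace.somePath ξ₀ ξ).trans p),
      Path.Homotopic.Quotient.mk_trans,
    quotient_map_trans, ← Path.Homotopic.Quotient.trans_assoc]
  rfl

/-- Path classes depend on their end points. End points in a chart agree with points of the
punctured plane only up to a proved equality, so the transport has to be moved through
concatenation. -/
lemma trans_mk_cast {s t s' : PSphere a} (γ : Path.Homotopic.Quotient x₀ s) (q : Path s t)
    (h : s' = t) : γ.trans ⟦q.cast rfl h⟧ₕ = (γ.trans ⟦q⟧ₕ).cast rfl h := by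
  subst h
  simp

lemma IsSheetOf.apply_cast {α : Type*} {f : Cover a x₀ → α} {r : ℝ} {F : ℂ → α} {s s' : PSphere a}
    {γ : Path.Homotopic.Quotient x₀ s} {z w : PPlane a} (hz : z.toSphere = s) (hw : w.toSphere = s')
    (h : IsSheetOf f ⟨z, γ.cast rfl hz⟩ r F) (δ : Path s s')
    (hδ : ∀ t, ∃ u ∈ ball z.1 r, (δ t).1 = ((u : ℂ) : OnePoint ℂ)) :
    f ⟨w, (γ.trans (Path.Homotopic.Quotient.mk δ)).cast rfl hw⟩ = F w.1 := by
  subst hz hw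
  simpa using h w δ hδ

/-- Along a map from a convex set, a function on the covering is given near `ξ` by its sheets. -/
lemma IsSheetOf.eventually_liftClass {α : Type*} {f : Cover a x₀ → α} {r : ℝ} {F : ℂ → α}
    {D : Set ℂ} [SimplyConnectedSpace D] (hD : Convex ℝ D) (e : C(D, PSphere a)) {ξ₀ : D}
    (γ : Path.Homotopic.Quotient x₀ (e ξ₀)) {ξ : D} {z : PPlane a} (hz : z.toSphere = e ξ)
        (hr : 0 < r)
    (h : IsSheetOf f ⟨z, (liftClass e γ ξ).cast rfl hz⟩ r F) {φ : ℂ → ℂ}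
    (hφ : ContinuousAt φ ξ.1)
    (he : ∀ᶠ ζ in 𝓝 ξ.1, ∀ hζ : ζ ∈ D, (e ⟨ζ, hζ⟩).1 = ((φ ζ : ℂ) : OnePoint ℂ)) :
    ∀ᶠ ζ in 𝓝 ξ.1, ∀ hζ : ζ ∈ D, ∀ (w : PPlane a) (hw : w.toSphere = e ⟨ζ, hζ⟩),
      f ⟨w, (liftClass e γ ⟨ζ, hζ⟩).cast rfl hw⟩ = F w.1 := by
  have hz1 : z.1 = φ ξ.1 := by
    have h1 := he.self_of_nhds ξ.2
    have h2 := congrArg Subtype.val hz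
    exact OnePoint.coe_injective (h2.trans h1)
  have hball : ∀ᶠ ζ in 𝓝 ξ.1, φ ζ ∈ ball z.1 r :=
    hφ.eventually_mem (hz1 ▸ ball_mem_nhds _ hr)
  obtain ⟨δ, hδ, hδ'⟩ := Metric.eventually_nhds_iff_ball.1 (he.and hball)
  filter_upwards [ball_mem_nhds _ hδ] with ζ hζδ hζ w hw
  rw [liftClass_trans e γ (convexPath hD ξ ⟨ζ, hζ⟩)]
  refine h.apply_cast hz hw _ fun t => ?_
  have hmem := convexPath_mem hD ξ ⟨ζ, hζ⟩ (convex_ball ξ.1 δ) (mem_ball_self hδ) hζδ t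
  exact ⟨_, (hδ' _ hmem).2, (hδ' _ hmem).1 (convexPath hD ξ ⟨ζ, hζ⟩ t).2⟩

/-- A function on the covering that is analytic in the local coordinate. -/
def IsAnalyticOnCover (f : Cover a x₀ → ℂ) : Prop :=
  ∀ x : Cover a x₀, ∃ r > 0, ∃ F : ℂ → ℂ, (∀ w ∈ ball x.proj r, AnalyticAt ℂ F w) ∧
    IsSheetOf f x r F

/-- A disc in the sphere, with a coordinate map that is analytic over the finite points. -/
structure SphereChart (a : Fin m → ℂ) where
  dom : Set ℂ
  convex : Convex ℝ dom
  toMap : C(dom, PSphere a)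
  isEmbedding : IsEmbedding toMap
  isOpen_range : IsOpen (Set.range toMap)
  fin : Set ℂ
  isOpen_fin : IsOpen fin
  fin_subset : fin ⊆ dom
  isPreconnected_fin : IsPreconnected fin
  dense : dom ⊆ closure fin
  coord : ℂ → ℂ
  analytic : ∀ ξ ∈ fin, AnalyticAt ℂ coord ξ
  coord_eq : ∀ ξ : dom, ξ.1 ∈ fin → (toMap ξ).1 = ((coord ξ.1 : ℂ) : OnePoint ℂ)
  mem_fin : ∀ (ξ : dom) (z : PPlane a), z.toSphere = toMap ξ → ξ.1 ∈ fin

/-- The function `f` vanishes on the sheets near the point of the full covering given by `γ`. -/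
def VanishesNear (f : Cover a x₀ → ℂ) {s : PSphere a} (γ : Path.Homotopic.Quotient x₀ s) : Prop :=
  ∃ N ∈ 𝓝 s, ∀ (w : PPlane a) (c : Path s w.toSphere), Set.range c ⊆ N →
    f ⟨w, γ.trans (Path.Homotopic.Quotient.mk c)⟩ = 0

/-- The chart is an embedding, so its inverse on the range carries the path back to the disc. -/
lemma SphereChart.exists_lift (S : SphereChart a) {ξ₀ : S.dom} {s : PSphere a}
    (c : Path (S.toMap ξ₀) s) (hc : Set.range c ⊆ Set.range S.toMap) :
    ∃ (ξ₁ : S.dom) (hs : s = S.toMap ξ₁) (p : Path ξ₀ ξ₁),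
      c = (p.map S.toMap.continuous).cast rfl hs := by
  set g := S.isEmbedding.toHomeomorph
  have hmem : ∀ t, c t ∈ Set.range S.toMap := fun t => hc ⟨t, rfl⟩
  have hg : ∀ y (hy : y ∈ Set.range S.toMap), S.toMap (g.symm ⟨y, hy⟩) = y := fun y hy =>
    congrArg Subtype.val (g.apply_symm_apply ⟨y, hy⟩)
  have hs : s ∈ Set.range S.toMap := by simpa using hmem 1
  refine ⟨g.symm ⟨s, hs⟩, (hg s hs).symm, ⟨⟨fun t => g.symm ⟨c t, hmem t⟩, ?_⟩, ?_, ?_⟩, ?_⟩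
  · exact g.symm.continuous.comp (c.continuous.subtype_mk _)
  · apply S.isEmbedding.injective
    simp [hg]
  · simp
  · ext t
    simp [hg]

lemma VanishesNear.of_cast {f : Cover a x₀ → ℂ} {s : PSphere a} {γ : Path.Homotopic.Quotient x₀ s}
    {N : Set (PSphere a)}
    (h : ∀ (w : PPlane a) (c : Path s w.toSphere), Set.range c ⊆ N →
      f ⟨w, γ.trans (Path.Homotopic.Quotient.mk c)⟩ = 0) {s' : PSphere a} (c : Path s s')
          (hc : Set.range c ⊆ N)
    {w : PPlane a} (hw : w.toSphere = s') : f
        ⟨w, (γ.trans (Path.Homotopic.Quotient.mk c)).cast rfl hw⟩ = 0 := by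
  subst hw
  simpa using h w c hc

/-- Continuing the class through the disc turns `f` into an analytic function on the finite part of
the chart. That part is connected and the function vanishes near the start, so it vanishes
altogether. Working with sheets near a point of the sphere, not with values of `f`, lets the paths
run through infinity, over which the covering used here has no points. -/
lemma VanishesNear.trans_of_chart {f : Cover a x₀ → ℂ} (hf : IsAnalyticOnCover f)
    (S : SphereChart a) {s s' : PSphere a} {γ : Path.Homotopic.Quotient x₀ s} (h : VanishesNear f γ)
    (c : Path s s') (hc : Set.range c ⊆ Set.range S.toMap) :
    VanishesNear f (γ.trans (Path.Homotopic.Quotient.mk c)) := by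
  obtain ⟨ξ₀, rfl⟩ : s ∈ Set.range S.toMap := by simpa using hc ⟨0, rfl⟩
  obtain ⟨ξ₁, rfl, p, rfl⟩ := S.exists_lift c hc
  have hne : S.dom.Nonempty := ⟨ξ₀.1, ξ₀.2⟩
  have : ContractibleSpace S.dom := S.convex.contractibleSpace hne
  have hsph : ∀ ξ (hξ : ξ ∈ S.fin), ∃ z : PPlane a,
      z.1 = S.coord ξ ∧ z.toSphere = S.toMap ⟨ξ, S.fin_subset hξ⟩ := by
    intro ξ hξ
    have h1 := S.coord_eq ⟨ξ, S.fin_subset hξ⟩ hξ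
    refine ⟨⟨S.coord ξ, fun k hk => (S.toMap ⟨ξ, S.fin_subset hξ⟩).2 k ?_⟩, rfl, ?_⟩
    · rw [h1, hk]
    · exact Subtype.ext h1.symm
  choose z hz1 hz2 using hsph
  classical
  set g : ℂ → ℂ := fun ξ => if hξ : ξ ∈ S.fin then
    f ⟨z ξ hξ, (liftClass S.toMap γ ⟨ξ, S.fin_subset hξ⟩).cast rfl (hz2 ξ hξ)⟩ else 0 with hg
  have hga : AnalyticOnNhd ℂ g S.fin := by
    intro ξ hξ
    obtain ⟨r, hr, F, hF, hsheet⟩ :=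
      hf ⟨z ξ hξ, (liftClass S.toMap γ ⟨ξ, S.fin_subset hξ⟩).cast rfl (hz2 ξ hξ)⟩
    have hev := hsheet.eventually_liftClass S.convex S.toMap γ (ξ := ⟨ξ, S.fin_subset hξ⟩)
      (hz2 ξ hξ) hr (S.analytic ξ hξ).continuousAt (by
        filter_upwards [S.isOpen_fin.mem_nhds hξ] with ζ hζ hζ'
        exact S.coord_eq ⟨ζ, hζ'⟩ hζ)
    have hFφ : AnalyticAt ℂ (fun ζ => F (S.coord ζ)) ξ := by
      refine AnalyticAt.comp (hF _ ?_) (S.analytic ξ hξ)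
      rw [← hz1 ξ hξ]
      exact mem_ball_self hr
    refine hFφ.congr ?_
    filter_upwards [hev, S.isOpen_fin.mem_nhds hξ] with ζ h1 hζ
    simp only [hg, dif_pos hζ]
    rw [h1 (S.fin_subset hζ) (z ζ hζ) (hz2 ζ hζ), hz1 ζ hζ]
  obtain ⟨N, hN, hvan⟩ := h
  have hgz : ∀ᶠ ξ in 𝓝 ξ₀.1, ξ ∈ S.fin → g ξ = 0 := by
    have h1 : S.toMap ⁻¹' N ∈ 𝓝 ξ₀ := S.toMap.continuous.continuousAt hN
    rw [nhds_subtype_eq_comap] at h1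
    obtain ⟨N', hN', hsub⟩ := h1
    obtain ⟨δ, hδ, hδ'⟩ := Metric.mem_nhds_iff.1 hN'
    filter_upwards [ball_mem_nhds _ hδ] with ξ hξδ hξ
    simp only [hg, dif_pos hξ]
    rw [liftClass_eq S.toMap γ (convexPath S.convex ξ₀ ⟨ξ, S.fin_subset hξ⟩), ←
        Path.Homotopic.Quotient.mk_map]
    refine VanishesNear.of_cast hvan _ ?_ _
    rintro _ ⟨t, rfl⟩
    exact hsub (hδ' (convexPath_mem S.convex ξ₀ ⟨ξ, S.fin_subset hξ⟩ (convex_ball ξ₀.1 δ)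
      (mem_ball_self hδ) hξδ t))
  -- The start may be the point at infinity, where `g` is not given by `f`. The identity theorem is
  -- therefore applied at a nearby point of the dense finite part.
  have hg0 : ∀ ξ ∈ S.fin, g ξ = 0 := by
    obtain ⟨δ, hδ, hδ'⟩ := Metric.eventually_nhds_iff_ball.1 hgz
    obtain ⟨ξ', hξ'1, hξ'2⟩ :=
      mem_closure_iff.1 (S.dense ξ₀.2) (ball ξ₀.1 δ) isOpen_ball (mem_ball_self hδ)
    refine hga.eqOn_of_preconnected_of_eventuallyEq (g := fun _ => 0)
      (fun _ _ => analyticAt_const) S.isPreconnected_fin hξ'2 ?_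
    filter_upwards [isOpen_ball.mem_nhds hξ'1, S.isOpen_fin.mem_nhds hξ'2] with ζ h1 h2
    exact hδ' ζ h1 h2
  refine ⟨_, S.isOpen_range.mem_nhds ⟨ξ₁, rfl⟩, fun w c' hc' => ?_⟩
  obtain ⟨ξ₂, hw, p', rfl⟩ := S.exists_lift c' hc'
  have h2 : ξ₂.1 ∈ S.fin := S.mem_fin ξ₂ w hw
  have h3 := hg0 _ h2
  simp only [hg, dif_pos h2] at h3
  have hzw : z ξ₂.1 h2 = w := toSphere_injective ((hz2 _ h2).trans hw.symm)
  rw [liftClass_eq S.toMap γ (p.trans p')] at h3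
  rw [← h3]
  have key : ∀ (w' : PPlane a) (hw' : w'.toSphere = S.toMap ξ₂), w' = w →
      (⟨w, (γ.trans (Path.Homotopic.Quotient.mk ((p.map S.toMap.continuous).cast rfl rfl))).trans
        (Path.Homotopic.Quotient.mk ((p'.map S.toMap.continuous).cast rfl hw))⟩ : Cover a x₀) =
      ⟨w', (γ.trans ((Path.Homotopic.Quotient.mk (p.trans p')).map S.toMap)).cast rfl hw'⟩ := by
    rintro _ hw' rfl
    congr 1
    rw [Path.Homotopic.Quotient.mk_trans, quotient_map_trans, ← Path.Homotopic.Quotient.mk_map, ←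
        Path.Homotopic.Quotient.mk_map,
      ← Path.Homotopic.Quotient.trans_assoc]
    exact trans_mk_cast _ _ hw
  exact congrArg f (key _ (hz2 _ h2) hzw)

/-- Continuation along paths, provided that the sphere is covered by discs. -/
lemma VanishesNear.trans {f : Cover a x₀ → ℂ} (hf : IsAnalyticOnCover f)
    (hS : ∀ s : PSphere a, ∃ S : SphereChart a, s ∈ Set.range S.toMap)
    {s s' : PSphere a} {γ : Path.Homotopic.Quotient x₀ s} (h : VanishesNear f γ) (c : Path s s') :
    VanishesNear f (γ.trans ⟦c⟧ₕ) := by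
  -- By compactness the path splits into finitely many pieces, each inside one chart, and vanishing
  -- is passed on from piece to piece.
  obtain ⟨t, ht0, htm, ⟨n, hn⟩, hsub⟩ := exists_monotone_Icc_subset_open_cover_unitInterval
    (c := fun S : SphereChart a => c ⁻¹' Set.range S.toMap)
    (fun S => S.isOpen_range.preimage c.continuous) (fun u _ => by
      obtain ⟨S, hS⟩ := hS (c u)
      exact Set.mem_iUnion.2 ⟨S, hS⟩)
  have h0 : VanishesNear f (γ.cast rfl c.source) := by
    have : ∀ s₀ (e : s₀ = s), VanishesNear f (γ.cast rfl e) := by rintro _ rfl; simpa using h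
    exact this _ _
  have step : ∀ k, VanishesNear f ((γ.cast rfl c.source).trans ⟦c.subpath 0 (t k)⟧ₕ) := by
    intro k
    induction k with
    | zero =>
      have : ∀ u, u = 0 → VanishesNear f ((γ.cast rfl c.source).trans ⟦c.subpath 0 u⟧ₕ) := by
        rintro _ rfl
        rw [Path.subpath_self, Path.Homotopic.Quotient.mk_refl,
          Path.Homotopic.Quotient.trans_refl]
        exact h0
      exact this _ ht0
    | succ k ih =>
      obtain ⟨S, hSk⟩ := hsub k
      have := ih.trans_of_chart hf S (c.subpath (t k) (t (k + 1))) (by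
        rw [Path.range_subpath_of_le _ _ _ (htm k.le_succ)]
        rintro _ ⟨u, hu, rfl⟩
        exact hSk hu)
      rw [Path.Homotopic.Quotient.trans_assoc, ← Path.Homotopic.Quotient.mk_trans] at this
      rwa [Path.Homotopic.Quotient.eq.2 ⟨Path.Homotopy.subpathTransSubpath c 0 (t k) (t (k + 1))⟩]
        at this
  have h1 := step n
  rw [hn n le_rfl, Path.subpath_zero_one] at h1
  have : ∀ s₀ s₁ (e₀ : s₀ = s) (e₁ : s₁ = s'), VanishesNear f ((γ.cast rfl e₀).trans
      ⟦c.cast e₀ e₁⟧ₕ) → VanishesNear f (γ.trans ⟦c⟧ₕ) := by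
    rintro _ _ rfl rfl h; simpa using h
  exact this _ _ _ _ h1

/-- The disc around a finite point. -/
lemma exists_chart_finite (b : PPlane a) : ∃ S : SphereChart a, b.toSphere ∈ Set.range S.toMap := by
  obtain ⟨δ, hδ, hδ'⟩ : ∃ δ > 0, ∀ w ∈ ball b.1 δ, ∀ k, w ≠ a k := by
    refine Metric.eventually_nhds_iff_ball.1 (eventually_all.2 fun k => ?_)
    exact isOpen_ne.mem_nhds (b.2 k)
  set φ : ball b.1 δ → PPlane a := fun w => ⟨w.1, hδ' w.1 w.2⟩
  have hφ : Continuous φ := continuous_subtype_val.subtype_mk _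
  have hemb : IsEmbedding (fun w : ball b.1 δ => (φ w).toSphere) := by
    refine IsEmbedding.of_comp (continuous_toSphere.comp hφ) continuous_subtype_val ?_
    exact OnePoint.isOpenEmbedding_coe.isEmbedding.comp IsEmbedding.subtypeVal
  refine ⟨{ dom := ball b.1 δ, convex := convex_ball _ _,
            toMap := ⟨fun w => (φ w).toSphere, continuous_toSphere.comp hφ⟩, isEmbedding := hemb,
            isOpen_range := ?_, fin := ball b.1 δ, isOpen_fin := isOpen_ball, fin_subset := le_rfl,
            isPreconnected_fin := (convex_ball _ _).isPreconnected, dense := subset_closure,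
            coord := id, analytic := fun _ _ => analyticAt_id, coord_eq := fun _ _ => rfl,
            mem_fin := fun ξ _ _ => ξ.2 }, ⟨⟨b.1, mem_ball_self hδ⟩, rfl⟩⟩
  have : Set.range (fun w : ball b.1 δ => (φ w).toSphere)
      = Subtype.val ⁻¹' ((fun z : ℂ => (z : OnePoint ℂ)) '' ball b.1 δ) := by
    ext s
    constructor
    · rintro ⟨w, rfl⟩
      exact ⟨w.1, w.2, rfl⟩
    · rintro ⟨w, hw, h⟩
      exact ⟨⟨w, hw⟩, Subtype.ext h⟩
  exact this ▸ (OnePoint.isOpenEmbedding_coe.isOpenMap _ isOpen_ball).preimage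
    continuous_subtype_val

open Classical in
/-- The inversion `z ↦ 1 / z` of the sphere. -/
noncomputable def sphereInv : OnePoint ℂ → OnePoint ℂ
  | none => ((0 : ℂ) : OnePoint ℂ)
  | some z => if z = 0 then OnePoint.infty else ((z⁻¹ : ℂ) : OnePoint ℂ)

lemma sphereInv_infty : sphereInv OnePoint.infty = ((0 : ℂ) : OnePoint ℂ) := rfl

lemma sphereInv_zero : sphereInv ((0 : ℂ) : OnePoint ℂ) = OnePoint.infty := if_pos rfl

lemma sphereInv_coe {z : ℂ} (hz : z ≠ 0) :
    sphereInv (z : OnePoint ℂ) = ((z⁻¹ : ℂ) : OnePoint ℂ) := if_neg hz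

lemma sphereInv_sphereInv (s : OnePoint ℂ) : sphereInv (sphereInv s) = s := by
  induction s using OnePoint.rec with
  | infty => rw [sphereInv_infty, sphereInv_zero]
  | coe z =>
    by_cases hz : z = 0
    · rw [hz, sphereInv_zero, sphereInv_infty]
    · rw [sphereInv_coe hz, sphereInv_coe (inv_ne_zero hz), inv_inv]

lemma continuous_sphereInv : Continuous sphereInv := by
  rw [continuous_iff_continuousAt]
  intro s
  induction s using OnePoint.rec with
  | infty =>
    rw [OnePoint.continuousAt_infty']
    have h1 : Tendsto (fun z : ℂ => ((z⁻¹ : ℂ) : OnePoint ℂ)) (coclosedCompact ℂ)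
        (𝓝 (sphereInv OnePoint.infty)) := by
      rw [sphereInv_infty]
      refine (OnePoint.continuous_coe.tendsto (0 : ℂ)).comp ?_
      rw [coclosedCompact_eq_cocompact, ← Metric.cobounded_eq_cocompact]
      exact tendsto_inv₀_cobounded
    refine h1.congr' ?_
    have : ({0}ᶜ : Set ℂ) ∈ coclosedCompact ℂ := by
      rw [coclosedCompact_eq_cocompact]
      exact isCompact_singleton.compl_mem_cocompact
    filter_upwards [this] with z hz
    exact (sphereInv_coe hz).symm
  | coe z =>
    rw [OnePoint.continuousAt_coe]
    by_cases hz : z = 0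
    · subst hz
      have h1 : Tendsto (fun z : ℂ => ((z⁻¹ : ℂ) : OnePoint ℂ)) (𝓝[≠] 0)
          (𝓝 OnePoint.infty) := by
        refine (OnePoint.tendsto_coe_infty).comp ?_
        rw [coclosedCompact_eq_cocompact, ← Metric.cobounded_eq_cocompact]
        exact tendsto_inv₀_nhdsNE_zero
      rw [continuousAt_iff_punctured_nhds, Function.comp, sphereInv_zero]
      refine h1.congr' ?_
      filter_upwards [self_mem_nhdsWithin] with w hw
      exact (sphereInv_coe hw).symm
    · have h1 : ContinuousAt (fun z : ℂ => ((z⁻¹ : ℂ) : OnePoint ℂ)) z :=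
        OnePoint.continuous_coe.continuousAt.comp (continuousAt_inv₀ hz)
      refine h1.congr ?_
      filter_upwards [isOpen_ne.mem_nhds hz] with w hw
      exact (sphereInv_coe hw).symm

/-- The inversion of the sphere as a homeomorphism. -/
noncomputable def sphereInvHomeo : OnePoint ℂ ≃ₜ OnePoint ℂ where
  toFun := sphereInv
  invFun := sphereInv
  left_inv := sphereInv_sphereInv
  right_inv := sphereInv_sphereInv
  continuous_toFun := continuous_sphereInv
  continuous_invFun := continuous_sphereInv

/-- The punctured disc is the image of a half plane under the exponential. -/
lemma isPreconnected_punctured_ball {δ : ℝ} (hδ : 0 < δ) :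
    IsPreconnected (ball (0 : ℂ) δ \ {0}) := by
  have : ball (0 : ℂ) δ \ {0} = exp '' {ζ : ℂ | ζ.re < Real.log δ} := by
    ext z
    constructor
    · rintro ⟨h1, h2⟩
      refine ⟨log z, ?_, exp_log h2⟩
      rw [Set.mem_ofPred_eq, ← norm_exp_lt_iff hδ, exp_log h2]
      exact mem_ball_zero_iff.1 h1
    · rintro ⟨ζ, hζ, rfl⟩
      exact ⟨mem_ball_zero_iff.2 ((norm_exp_lt_iff hδ).2 hζ), exp_ne_zero ζ⟩
  rw [this]
  exact (convex_halfSpace_re_lt _).isPreconnected.image _ continuous_exp.continuousOn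

/-- The disc around infinity. -/
lemma exists_chart_infty (s : PSphere a) (hs : s.1 = OnePoint.infty) :
    ∃ S : SphereChart a, s ∈ Set.range S.toMap := by
  -- Written as a product, the condition that `1 / w` avoids the nodes is continuous in `w` and also
  -- makes sense at `w = 0`.
  obtain ⟨δ, hδ, hδ'⟩ : ∃ δ > 0, ∀ w ∈ ball (0 : ℂ) δ, ∀ k, w * a k ≠ 1 := by
    refine Metric.eventually_nhds_iff_ball.1 (eventually_all.2 fun k => ?_)
    have : Continuous fun w : ℂ => w * a k := by fun_prop
    exact this.continuousAt.eventually_ne (by simp)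
  have hne : ∀ w ∈ ball (0 : ℂ) δ, ∀ k, sphereInv (w : OnePoint ℂ) ≠ ((a k : ℂ) : OnePoint ℂ) := by
    intro w hw k h
    by_cases hw0 : w = 0
    · rw [hw0, sphereInv_zero] at h
      exact OnePoint.infty_ne_coe _ h
    · rw [sphereInv_coe hw0] at h
      have := OnePoint.coe_injective h
      exact hδ' w hw k (by rw [← this, mul_inv_cancel₀ hw0])
  set e : ball (0 : ℂ) δ → PSphere a := fun w => ⟨sphereInv (w.1 : OnePoint ℂ), hne w.1 w.2⟩
  have he : Continuous e := (continuous_sphereInv.comp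
    (OnePoint.continuous_coe.comp continuous_subtype_val)).subtype_mk _
  have hemb : IsEmbedding e := by
    refine IsEmbedding.of_comp he continuous_subtype_val ?_
    exact sphereInvHomeo.isEmbedding.comp
      (OnePoint.isOpenEmbedding_coe.isEmbedding.comp IsEmbedding.subtypeVal)
  refine ⟨{ dom := ball 0 δ, convex := convex_ball _ _,
            toMap := ⟨e, he⟩, isEmbedding := hemb,
            isOpen_range := ?_, fin := ball 0 δ \ {0},
            isOpen_fin := isOpen_ball.sdiff isClosed_singleton,
            fin_subset := Set.sdiff_subset,
            isPreconnected_fin := isPreconnected_punctured_ball hδ, dense := ?_,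
            coord := fun z => z⁻¹, analytic := fun ξ hξ => analyticAt_inv hξ.2,
            coord_eq := fun ξ hξ => sphereInv_coe hξ.2,
            mem_fin := fun ξ z hz => ⟨ξ.2, fun h0 => ?_⟩ },
          ⟨⟨0, mem_ball_self hδ⟩, Subtype.ext (sphereInv_zero.trans hs.symm)⟩⟩
  · have : Set.range e
        = Subtype.val ⁻¹' (sphereInv '' ((fun z : ℂ => (z : OnePoint ℂ)) '' ball (0 : ℂ) δ)) := by
      ext s
      constructor
      · rintro ⟨w, rfl⟩
        exact ⟨_, ⟨w.1, w.2, rfl⟩, rfl⟩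
      · rintro ⟨_, ⟨w, hw, rfl⟩, h⟩
        exact ⟨⟨w, hw⟩, Subtype.ext h⟩
    exact this ▸ (sphereInvHomeo.isOpenMap _
      (OnePoint.isOpenEmbedding_coe.isOpenMap _ isOpen_ball)).preimage continuous_subtype_val
  · have h1 : Dense ({0}ᶜ : Set ℂ) := dense_compl_singleton 0
    exact h1.open_subset_closure_inter isOpen_ball
  · have h1 := congrArg Subtype.val hz
    have h2 : (e ξ).1 = OnePoint.infty := by
      have h0' : ξ.1 = 0 := h0
      change sphereInv (ξ.1 : OnePoint ℂ) = _
      rw [h0', sphereInv_zero]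
    exact OnePoint.coe_ne_infty _ (h1.trans h2)

lemma exists_chart (s : PSphere a) : ∃ S : SphereChart a, s ∈ Set.range S.toMap := by
  obtain ⟨s, hs⟩ := s
  induction s using OnePoint.rec with
  | infty => exact exists_chart_infty _ rfl
  | coe z => exact exists_chart_finite ⟨z, fun k hk => hs k (by rw [hk])⟩

/-- The identity theorem on the covering. -/
lemma eq_zero_of_sheet {f : Cover a x₀ → ℂ} (hf : IsAnalyticOnCover f) {x : Cover a x₀} {r : ℝ}
    (hr : 0 < r) {F : ℂ → ℂ} (h : IsSheetOf f x r F) (hF : ∀ w ∈ ball x.proj r, F w = 0) :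
    f = 0 := by
  have h0 : VanishesNear f x.2 := by
    refine ⟨Subtype.val ⁻¹' ((fun z : ℂ => (z : OnePoint ℂ)) '' ball x.proj r),
      ((OnePoint.isOpenEmbedding_coe.isOpenMap _ isOpen_ball).preimage
        continuous_subtype_val).mem_nhds ⟨x.proj, mem_ball_self hr, rfl⟩, fun w c hc => ?_⟩
    have hc' : ∀ t, ∃ u ∈ ball x.proj r, (c t).1 = ((u : ℂ) : OnePoint ℂ) := fun t => by
      obtain ⟨u, hu, hu'⟩ := hc ⟨t, rfl⟩
      exact ⟨u, hu, hu'.symm⟩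
    rw [h w c hc']
    obtain ⟨u, hu, hu'⟩ := hc' 1
    rw [c.target] at hu'
    rw [show w.1 = u from OnePoint.coe_injective hu']
    exact hF u hu
  funext y
  -- A path representing `x⁻¹ · y` leads from the sheet at `x` to the point `y` of the covering.
  obtain ⟨c, hc⟩ := Path.Homotopic.Quotient.mk_surjective (x.2.symm.trans y.2)
  obtain ⟨N, hN, hvan⟩ := h0.trans hf exists_chart c
  rw [hc, ← Path.Homotopic.Quotient.trans_assoc, Path.Homotopic.Quotient.trans_symm,
    Path.Homotopic.Quotient.refl_trans] at hvan
  have := hvan y.1 (Path.refl _) (by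
    rintro _ ⟨t, rfl⟩
    exact mem_of_mem_nhds hN)
  rw [Path.Homotopic.Quotient.mk_refl, Path.Homotopic.Quotient.trans_refl] at this
  exact this

/-- The points `ζ` such that `a k + exp ζ` lies in the largest punctured disc around `a k`. -/
def loopDomain (a : Fin m → ℂ) (k : Fin m) : Set ℂ :=
  {ζ | ∀ j, j ≠ k → Real.exp ζ.re < ‖a j - a k‖}

lemma convex_loopDomain (a : Fin m → ℂ) (k : Fin m) : Convex ℝ (loopDomain a k) := by
  have : loopDomain a k = ⋂ j, ⋂ (_ : j ≠ k), {ζ : ℂ | Real.exp ζ.re < ‖a j - a k‖} := by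
    ext ζ; simp [loopDomain]
  rw [this]
  refine convex_iInter fun j => convex_iInter fun _ => ?_
  -- The nodes are not assumed to be distinct here; coinciding nodes give the empty set instead of a
  -- half plane.
  rcases (norm_nonneg (a j - a k)).eq_or_lt with h | h
  · have : {ζ : ℂ | Real.exp ζ.re < ‖a j - a k‖} = ∅ := by
      ext ζ; simp [← h, (Real.exp_pos _).le]
    rw [this]; exact convex_empty
  · have : {ζ : ℂ | Real.exp ζ.re < ‖a j - a k‖} = {ζ : ℂ | ζ.re < Real.log ‖a j - a k‖} := by
      ext ζ; simp [Real.lt_log_iff_exp_lt h]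
    rw [this]; exact convex_halfSpace_re_lt _

lemma add_exp_ne {k : Fin m} {ζ : ℂ} (hζ : ζ ∈ loopDomain a k) (j : Fin m) :
    a k + exp ζ ≠ a j := by
  intro h
  by_cases hj : j = k
  · subst hj; exact exp_ne_zero ζ (add_eq_left.1 h)
  · have h1 := hζ j hj
    rw [← h, add_sub_cancel_left, Complex.norm_exp] at h1
    exact lt_irrefl _ h1

lemma add_two_pi_mem {k : Fin m} {ζ : ℂ} (hζ : ζ ∈ loopDomain a k) :
    ζ + 2 * Real.pi * I ∈ loopDomain a k := by
  intro j hj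
  simpa using hζ j hj

lemma trans_mk_cast_trans {s t t' w w' : PSphere a} (γ : Path.Homotopic.Quotient x₀ s)
    (d : Path s t) (q : Path t w) (h : t' = t) (h' : w' = w) :
    (γ.trans ⟦d.cast rfl h⟧ₕ).trans ⟦q.cast h h'⟧ₕ
      = ((γ.trans ⟦d⟧ₕ).trans ⟦q⟧ₕ).cast rfl h' := by
  subst h h'
  simp

lemma cover_cast_eq {z z' : PPlane a} (h : z' = z) (h' : z'.toSphere = z.toSphere)
    (γ : Path.Homotopic.Quotient x₀ z.toSphere) :
    (⟨z', γ.cast rfl h'⟩ : Cover a x₀) = ⟨z, γ⟩ := by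
  subst h
  simp

/-- The universal covering of the punctured disc around `a k`, lifted to the covering of the
sphere. -/
lemma exists_lift_loopDomain {k : Fin m} {ℓ : Path.Homotopic.Quotient x₀ x₀}
    (hℓ : GoesOnceAround a x₀ k ℓ) :
    ∃ L : loopDomain a k → Cover a x₀, (∀ ζ, (L ζ).proj = a k + exp ζ.1) ∧
      (∀ (α : Type) (f : Cover a x₀ → α) (ζ : loopDomain a k) (r : ℝ) (F : ℂ → α), 0 < r →
        IsSheetOf f (L ζ) r F →
        ∀ᶠ ξ in 𝓝 ζ.1, ∀ hξ : ξ ∈ loopDomain a k, f (L ⟨ξ, hξ⟩) = F (a k + exp ξ)) ∧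
      ∀ ζ : loopDomain a k, L ⟨ζ.1 + 2 * Real.pi * I, add_two_pi_mem ζ.2⟩ = deck ℓ (L ζ) := by
  obtain ⟨r, hr, hrj, b, c, d, hd, rfl⟩ := hℓ
  have hD := convex_loopDomain a k
  -- The point `ζ₀` lies over `a k + r`, where the circle `d` begins and ends.
  set ζ₀ : loopDomain a k := ⟨(Real.log r : ℝ), fun j hj => by
    rw [ofReal_re, Real.exp_log hr]; exact hrj j hj⟩ with hζ₀
  have : ContractibleSpace (loopDomain a k) := hD.contractibleSpace ⟨_, ζ₀.2⟩
  set φ : loopDomain a k → PPlane a := fun ζ => ⟨a k + exp ζ.1, add_exp_ne ζ.2⟩ with hφ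
  have hφc : Continuous φ := by
    refine Continuous.subtype_mk ?_ _
    fun_prop
  set e : C(loopDomain a k, PSphere a) := ⟨fun ζ => (φ ζ).toSphere, continuous_toSphere.comp hφc⟩
  have hexp : exp ((Real.log r : ℝ) : ℂ) = r := by rw [← ofReal_exp, Real.exp_log hr]
  obtain rfl : b = e ζ₀ := by
    have h0 := hd 0
    simp only [Path.source] at h0
    refine Subtype.ext (h0.trans ?_)
    change _ = ((a k + exp ((Real.log r : ℝ) : ℂ) : ℂ) : OnePoint ℂ)
    rw [hexp]
    simp
  refine ⟨fun ζ => ⟨φ ζ, liftClass e ⟦c⟧ₕ ζ⟩, fun ζ => rfl, ?_, ?_⟩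
  · intro α f ζ r F hr h
    have h' : IsSheetOf f ⟨φ ζ, (liftClass e ⟦c⟧ₕ ζ).cast rfl rfl⟩ r F := by simpa using h
    have := h'.eventually_liftClass hD e ⟦c⟧ₕ (rfl : (φ ζ).toSphere = e ζ) hr
      (φ := fun ζ => a k + exp ζ) (by fun_prop)
      (Eventually.of_forall fun ξ hξ => rfl)
    filter_upwards [this] with ξ h1 hξ
    simpa using h1 hξ (φ ⟨ξ, hξ⟩) rfl
  · intro ζ
    set σ : loopDomain a k → loopDomain a k := fun ζ => ⟨ζ.1 + 2 * Real.pi * I, add_two_pi_mem ζ.2⟩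
    have hσ : Continuous σ := by
      refine Continuous.subtype_mk ?_ _
      fun_prop
    have hφσ : ∀ ζ, φ (σ ζ) = φ ζ := fun ζ => Subtype.ext (by
      change a k + exp (ζ.1 + 2 * Real.pi * I) = a k + exp ζ.1
      rw [Complex.exp_periodic])
    have heσ : ∀ ζ, e (σ ζ) = e ζ := fun ζ => congrArg PPlane.toSphere (hφσ ζ)
    -- The straight segment from `ζ₀` to `ζ₀ + 2πi` is mapped exactly onto the circle `d`. Going to
    -- `ζ + 2πi` by this segment and then by the translated path therefore inserts `d` after `c`,
    -- which is the effect of the loop `c d c⁻¹`.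
    have h1 : (convexPath hD ζ₀ (σ ζ₀)).map e.continuous = d.cast rfl (heσ ζ₀) := by
      ext t
      rw [Path.cast_coe, hd t]
      change ((a k + exp (AffineMap.lineMap ((Real.log r : ℝ) : ℂ)
        (((Real.log r : ℝ) : ℂ) + 2 * Real.pi * I) (t : ℝ)) : ℂ) : OnePoint ℂ) = _
      rw [AffineMap.lineMap_apply, vsub_eq_sub, add_sub_cancel_left, vadd_eq_add, exp_add, hexp,
        real_smul, mul_comm (t : ℂ), mul_comm (exp _)]
    set p := convexPath hD ζ₀ ζ
    have h2 : (p.map hσ).map e.continuous = (p.map e.continuous).cast (heσ ζ₀) (heσ ζ) := by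
      ext t
      exact congrArg Subtype.val (heσ (p t))
    have h3 : liftClass e ⟦c⟧ₕ (σ ζ) = _ :=
      liftClass_eq e ⟦c⟧ₕ ((convexPath hD ζ₀ (σ ζ₀)).trans (p.map hσ))
    rw [Path.Homotopic.Quotient.mk_trans, quotient_map_trans, ← Path.Homotopic.Quotient.mk_map,
      ← Path.Homotopic.Quotient.mk_map, h1, h2, ← Path.Homotopic.Quotient.trans_assoc,
      trans_mk_cast_trans] at h3
    change (⟨φ (σ ζ), liftClass e ⟦c⟧ₕ (σ ζ)⟩ : Cover a x₀) = ⟨φ ζ, _⟩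
    rw [h3]
    refine (cover_cast_eq (hφσ ζ) _ _).trans ?_
    refine congrArg (Sigma.mk (φ ζ)) ?_
    change _ = Path.Homotopic.Quotient.trans _ (liftClass e ⟦c⟧ₕ ζ)
    rw [liftClass_eq e ⟦c⟧ₕ p, ← Path.Homotopic.Quotient.mk_map,
      ← Path.Homotopic.Quotient.trans_assoc]
    congr 1
    rw [Path.Homotopic.Quotient.trans_assoc _ _ ⟦c⟧ₕ, Path.Homotopic.Quotient.symm_trans,
      Path.Homotopic.Quotient.trans_refl]

lemma isOpen_loopDomain (a : Fin m → ℂ) (k : Fin m) : IsOpen (loopDomain a k) := by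
  simp only [loopDomain, Set.ofPred_forall]
  refine isOpen_iInter_of_finite fun j => isOpen_iInter_of_finite fun _ => ?_
  exact isOpen_lt (by fun_prop) continuous_const

/-- An invertible solution near `a k` whose monodromy comes from the solution on the covering. -/
lemma IsSystemSolution.exists_pullback {n : ℕ} {A : ℂ → Matrix (Fin n) (Fin n) ℂ}
    {Y : Cover a x₀ → Matrix (Fin n) (Fin n) ℂ} (hY : IsSystemSolution a x₀ A Y) {k : Fin m}
    {ℓ : Path.Homotopic.Quotient x₀ x₀} (hℓ : GoesOnceAround a x₀ k ℓ) :
    ∃ W : ℂ → Matrix (Fin n) (Fin n) ℂ,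
      (∀ ζ ∈ loopDomain a k, (W ζ).det ≠ 0 ∧
        SolvesSystemAt (fun ξ => exp ξ • A (a k + exp ξ)) W ζ) ∧
      ∀ χ : Matrix (Fin n) (Fin n) ℂ, (∀ x, Y x = Y (deck ℓ x) * χ) →
        ∀ ζ ∈ loopDomain a k, W ζ = W (ζ + 2 * Real.pi * I) * χ := by
  classical
  obtain ⟨L, hproj, hsheet, hdeck⟩ := exists_lift_loopDomain hℓ
  refine ⟨fun ζ => if h : ζ ∈ loopDomain a k then Y (L ⟨ζ, h⟩) else 1, fun ζ hζ => ⟨?_, ?_⟩, ?_⟩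
  · simp only [dif_pos hζ]
    exact (hY _).1
  · obtain ⟨-, r, hr, F, hF, hFs⟩ := hY (L ⟨ζ, hζ⟩)
    have hev := hsheet _ Y ⟨ζ, hζ⟩ r F hr hFs
    rw [solvesSystemAt_iff]
    have hmem : a k + exp ζ ∈ ball (L ⟨ζ, hζ⟩).proj r := by rw [hproj]; exact mem_ball_self hr
    have hFd := solvesSystemAt_iff.1 (hF _ hmem)
    have h1 : HasDerivAt (fun ξ => F (a k + exp ξ)) (exp ζ • (A (a k + exp ζ) * F (a k + exp ζ))) ζ
        :=
      hFd.scomp ζ ((Complex.hasDerivAt_exp ζ).const_add (a k))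
    have h2 := hev.self_of_nhds hζ
    simp only [dif_pos hζ]
    rw [h2, smul_mul_assoc]
    refine h1.congr_of_eventuallyEq ?_
    filter_upwards [hev, (isOpen_loopDomain a k).mem_nhds hζ] with ξ h3 hξ
    rw [dif_pos hξ, h3 hξ]
  · intro χ hχ ζ hζ
    simp only [dif_pos hζ, dif_pos (add_two_pi_mem hζ)]
    rw [hdeck ⟨ζ, hζ⟩, ← hχ]

end CoverTopology

end StdForm

end

section

open Complex Metric Filter Topology

namespace StdForm

/-! ### Triangular chains of differential operators -/

section JetOperators

open Polynomial

variable (F : ℕ → ℂ[X]) (c : ℕ → ℕ → ℂ[X])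

/-- The differential operators `V₀ y = y`, `Vᵢ₊₁ y = Fᵢ (Vᵢ y)' + ∑ₗ cᵢₗ Vₗ y`. -/
noncomputable def jetOp : ℕ → (ℂ → ℂ) → ℂ → ℂ
  | 0, y => y
  | i + 1, y => fun z => (F i).eval z * deriv (jetOp i y) z
      + ∑ l : Fin (i + 1), (c i l).eval z * jetOp l y z
termination_by i => i
decreasing_by
  · exact Nat.lt_succ_self i
  · exact l.2

/-- The coefficients of the operators `jetOp`. -/
noncomputable def jetCoeff : ℕ → ℕ → ℂ[X]
  | 0, j => if j = 0 then 1 else 0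
  | i + 1, j => F i * (derivative (jetCoeff i j) + if j = 0 then 0 else jetCoeff i (j - 1))
      + ∑ l : Fin (i + 1), c i l * jetCoeff l j
termination_by i => i
decreasing_by
  · exact Nat.lt_succ_self i
  · exact Nat.lt_succ_self i
  · exact l.2

lemma jetOp_zero (y : ℂ → ℂ) : jetOp F c 0 y = y := by rw [jetOp]

lemma jetOp_succ (i : ℕ) (y : ℂ → ℂ) (z : ℂ) : jetOp F c (i + 1) y z =
    (F i).eval z * deriv (jetOp F c i y) z
      + ∑ l ∈ Finset.range (i + 1), (c i l).eval z * jetOp F c l y z := by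
  rw [jetOp, ← Fin.sum_univ_eq_sum_range (fun l => (c i l).eval z * jetOp F c l y z)]

lemma jetCoeff_zero (j : ℕ) : jetCoeff F c 0 j = if j = 0 then 1 else 0 := by rw [jetCoeff]

lemma jetCoeff_succ (i j : ℕ) : jetCoeff F c (i + 1) j =
    F i * (derivative (jetCoeff F c i j) + if j = 0 then 0 else jetCoeff F c i (j - 1))
      + ∑ l ∈ Finset.range (i + 1), c i l * jetCoeff F c l j := by
  rw [jetCoeff, ← Fin.sum_univ_eq_sum_range (fun l => c i l * jetCoeff F c l j)]

lemma jetCoeff_eq_zero {i j : ℕ} (h : i < j) : jetCoeff F c i j = 0 := by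
  induction i using Nat.strong_induction_on generalizing j with
  | _ i ih =>
    cases i with
    | zero => rw [jetCoeff_zero, if_neg h.ne']
    | succ i =>
      rw [jetCoeff_succ, ih i (by omega) (by omega), if_neg (by omega), ih i (by omega) (by omega),
        Finset.sum_eq_zero]
      · simp
      · intro l hl
        rw [ih l (by simpa using hl) (by have := Finset.mem_range.1 hl; omega), mul_zero]

lemma jetCoeff_diag (i : ℕ) : jetCoeff F c i i = ∏ l ∈ Finset.range i, F l := by
  induction i with
  | zero => simp [jetCoeff_zero]
  | succ i ih =>
    rw [jetCoeff_succ, jetCoeff_eq_zero F c (Nat.lt_succ_self i), if_neg (by omega),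
      Finset.sum_eq_zero]
    · simp [ih, Finset.prod_range_succ, mul_comm]
    · intro l hl
      rw [jetCoeff_eq_zero F c (Finset.mem_range.1 hl), mul_zero]

lemma analyticAt_iteratedDeriv {y : ℂ → ℂ} {z : ℂ} (hy : AnalyticAt ℂ y z) (j : ℕ) :
    AnalyticAt ℂ (iteratedDeriv j y) z := by
  rw [iteratedDeriv_eq_iterate]
  exact hy.iterated_deriv j

/-- The product rule gives the recursion of `jetCoeff`. The upper bound of the sum is free because
the coefficients beyond the diagonal vanish, so operators of different orders can be added over one
range. -/
lemma jetOp_eq_sum {y : ℂ → ℂ} {z : ℂ} (hy : AnalyticAt ℂ y z) {i N : ℕ} (hN : i < N) :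
    jetOp F c i y z = ∑ j ∈ Finset.range N, (jetCoeff F c i j).eval z * iteratedDeriv j y z := by
  induction i using Nat.strong_induction_on generalizing z with
  | _ i ih =>
    cases i with
    | zero =>
      rw [jetOp_zero, Finset.sum_eq_single 0]
      · simp [jetCoeff_zero]
      · intro j _ hj; simp [jetCoeff_zero, hj]
      · intro h; simp [hN] at h
    | succ i =>
      obtain ⟨N, rfl⟩ : ∃ N', N = N' + 1 := ⟨N - 1, by omega⟩
      have h1 : jetOp F c i y =ᶠ[𝓝 z]
          fun w => ∑ j ∈ Finset.range (N + 1), (jetCoeff F c i j).eval w * iteratedDeriv j y w := by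
        filter_upwards [hy.eventually_analyticAt] with w hw
        exact ih i (by omega) hw (by omega)
      have h2 : ∀ j, HasDerivAt (fun w => (jetCoeff F c i j).eval w * iteratedDeriv j y w)
          ((derivative (jetCoeff F c i j)).eval z * iteratedDeriv j y z
            + (jetCoeff F c i j).eval z * iteratedDeriv (j + 1) y z) z := by
        intro j
        refine ((jetCoeff F c i j).hasDerivAt z).mul ?_
        rw [iteratedDeriv_succ]
        exact (analyticAt_iteratedDeriv hy j).differentiableAt.hasDerivAt
      rw [jetOp_succ, h1.deriv_eq, (HasDerivAt.fun_sum fun j _ => h2 j).deriv]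
      have h3 : ∀ l ∈ Finset.range (i + 1), (c i l).eval z * jetOp F c l y z =
          ∑ j ∈ Finset.range (N + 1),
            (c i l * jetCoeff F c l j).eval z * iteratedDeriv j y z := by
        intro l hl
        rw [ih l (Finset.mem_range.1 hl) hy (by have := Finset.mem_range.1 hl; omega),
          Finset.mul_sum]
        exact Finset.sum_congr rfl fun j _ => by rw [eval_mul]; ring
      rw [Finset.sum_congr rfl h3, Finset.sum_comm, Finset.sum_add_distrib]
      have h4 : ∑ j ∈ Finset.range (N + 1), (jetCoeff F c i j).eval z * iteratedDeriv (j + 1) y z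
          = ∑ j ∈ Finset.range (N + 1), (if j = 0 then 0 else jetCoeff F c i (j - 1)).eval z
              * iteratedDeriv j y z := by
        rw [Finset.sum_range_succ, jetCoeff_eq_zero F c (by omega : i < N), Finset.sum_range_succ']
        simp
      rw [h4, ← Finset.sum_add_distrib, Finset.mul_sum, ← Finset.sum_add_distrib]
      refine Finset.sum_congr rfl fun j _ => ?_
      rw [jetCoeff_succ, eval_add, eval_mul, eval_add, eval_finsetSum, ← Finset.sum_mul]
      ring

lemma analyticAt_jetOp {y : ℂ → ℂ} {z : ℂ} (hy : AnalyticAt ℂ y z) (i : ℕ) :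
    AnalyticAt ℂ (jetOp F c i y) z := by
  have h1 : jetOp F c i y =ᶠ[𝓝 z] fun w => ∑ j ∈ Finset.range (i + 1),
      (jetCoeff F c i j).eval w * iteratedDeriv j y w := by
    filter_upwards [hy.eventually_analyticAt] with w hw
    exact jetOp_eq_sum F c hw (Nat.lt_succ_self i)
  refine AnalyticAt.congr ?_ h1.symm
  refine Finset.analyticAt_fun_sum _ fun j _ => ?_
  exact (AnalyticAt.aeval_polynomial (f := id) analyticAt_id _).mul (analyticAt_iteratedDeriv hy j)

variable {F c} in
lemma jetOp_congr {y y' : ℂ → ℂ} {z : ℂ} (h : y =ᶠ[𝓝 z] y') (i : ℕ) :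
    jetOp F c i y =ᶠ[𝓝 z] jetOp F c i y' := by
  induction i using Nat.strong_induction_on with
  | _ i ih =>
    cases i with
    | zero => simpa [jetOp_zero] using h
    | succ i =>
      have h1 : ∀ᶠ w in 𝓝 z, ∀ l ∈ Finset.range (i + 1), jetOp F c l y w = jetOp F c l y' w :=
        (Filter.eventually_all_finset _).2 fun l hl => ih l (Finset.mem_range.1 hl)
      filter_upwards [h1, (ih i (by omega)).eventuallyEq_nhds] with w hw hw'
      rw [jetOp_succ, jetOp_succ, hw'.deriv_eq]
      congr 1
      exact Finset.sum_congr rfl fun l hl => by rw [hw l hl]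

lemma jetOp_sum {ι : Type*} (s : Finset ι) (b : ι → ℂ) {y : ι → ℂ → ℂ} {z : ℂ}
    (hy : ∀ i ∈ s, AnalyticAt ℂ (y i) z) (k : ℕ) :
    jetOp F c k (fun w => ∑ i ∈ s, b i * y i w) z = ∑ i ∈ s, b i * jetOp F c k (y i) z := by
  have han : AnalyticAt ℂ (fun w => ∑ i ∈ s, b i * y i w) z :=
    Finset.analyticAt_fun_sum _ fun i hi => analyticAt_const.mul (hy i hi)
  rw [jetOp_eq_sum F c han (Nat.lt_succ_self k)]
  have : ∀ j, iteratedDeriv j (fun w => ∑ i ∈ s, b i * y i w) z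
      = ∑ i ∈ s, b i * iteratedDeriv j (y i) z := by
    intro j
    rw [iteratedDeriv_fun_sum fun i hi => contDiffAt_const.mul (hy i hi).contDiffAt]
    exact Finset.sum_congr rfl fun i hi => iteratedDeriv_const_mul_field _ _
  simp only [this, Finset.mul_sum]
  rw [Finset.sum_comm]
  refine Finset.sum_congr rfl fun i hi => ?_
  rw [jetOp_eq_sum F c (hy i hi) (Nat.lt_succ_self k), Finset.mul_sum]
  exact Finset.sum_congr rfl fun j _ => by ring

/-- The triangular system for the jet has a unique solution. -/
lemma iteratedDeriv_eq_zero_of_jetOp {y : ℂ → ℂ} {z : ℂ} (hy : AnalyticAt ℂ y z) {n : ℕ}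
    (hF : ∀ l < n, (F l).eval z ≠ 0) (h : ∀ l < n, jetOp F c l y z = 0) :
    ∀ j < n, iteratedDeriv j y z = 0 := by
  intro j
  induction j using Nat.strong_induction_on with
  | _ j ih =>
    intro hj
    have h1 := h j hj
    rw [jetOp_eq_sum F c hy (Nat.lt_succ_self j), Finset.sum_range_succ, Finset.sum_eq_zero,
      zero_add, jetCoeff_diag, eval_prod] at h1
    · refine (mul_eq_zero.1 h1).resolve_left ?_
      exact Finset.prod_ne_zero_iff.2 fun l hl => hF l ((Finset.mem_range.1 hl).trans hj)
    · intro l hl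
      have := Finset.mem_range.1 hl
      rw [ih l this (by omega), mul_zero]

/-- A polynomial with given derivatives at a point. -/
lemma exists_jet (z : ℂ) (n : ℕ) (v : ℕ → ℂ) :
    ∃ y : ℂ → ℂ, (∀ w, AnalyticAt ℂ y w) ∧ ∀ j < n, iteratedDeriv j y z = v j := by
  refine ⟨fun w => ∑ i ∈ Finset.range n, (v i / (i.factorial : ℂ)) * (w - z) ^ i, ?_, ?_⟩
  · intro w
    refine Finset.analyticAt_fun_sum _ fun i _ => ?_
    fun_prop
  · intro j hj
    rw [iteratedDeriv_fun_sum (fun i _ => by fun_prop)]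
    rw [Finset.sum_eq_single j]
    · rw [iteratedDeriv_const_mul_field, iteratedDeriv_comp_sub_const j (fun w => w ^ j) z]
      simp [Nat.factorial_ne_zero, Nat.descFactorial_self]
    · intro i _ hij
      rw [iteratedDeriv_const_mul_field, iteratedDeriv_comp_sub_const j (fun w => w ^ i) z]
      simp only [sub_self, iteratedDeriv_eq_iterate, iter_deriv_pow]
      rcases lt_or_gt_of_ne hij with h | h
      · rw [Finset.prod_eq_zero (Finset.mem_range.2 h) (sub_self _)]; simp
      · simp [Nat.sub_ne_zero_of_lt h]
    · intro h; exact absurd (Finset.mem_range.2 hj) h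

/-- The map from derivatives to operator values is triangular with diagonal entries `∏ F`, so
forward substitution solves for the derivatives one at a time; a polynomial then realises them. -/
lemma exists_jetOp_eq {z : ℂ} {n : ℕ} (hF : ∀ l < n, (F l).eval z ≠ 0) (v : ℕ → ℂ) :
    ∃ y : ℂ → ℂ, (∀ w, AnalyticAt ℂ y w) ∧ ∀ l < n, jetOp F c l y z = v l := by
  have key : ∀ N ≤ n, ∃ u : ℕ → ℂ, ∀ l < N, ∑ j ∈ Finset.range N,
      (jetCoeff F c l j).eval z * u j = v l := by
    intro N
    induction N with
    | zero => exact fun _ => ⟨0, by simp⟩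
    | succ N ih =>
      intro hN
      obtain ⟨u, hu⟩ := ih (by omega)
      have hd : (jetCoeff F c N N).eval z ≠ 0 := by
        rw [jetCoeff_diag, eval_prod]
        exact Finset.prod_ne_zero_iff.2 fun l hl => hF l (by have := Finset.mem_range.1 hl; omega)
      refine ⟨Function.update u N ((v N - ∑ j ∈ Finset.range N,
        (jetCoeff F c N j).eval z * u j) / (jetCoeff F c N N).eval z), fun l hl => ?_⟩
      have h1 : ∀ b, ∑ j ∈ Finset.range N, (jetCoeff F c l j).eval z * Function.update u N b j
          = ∑ j ∈ Finset.range N, (jetCoeff F c l j).eval z * u j := fun b =>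
        Finset.sum_congr rfl fun j hj => by
          rw [Function.update_of_ne (Finset.mem_range.1 hj).ne]
      rw [Finset.sum_range_succ, h1, Function.update_self]
      rcases Nat.lt_succ_iff_lt_or_eq.1 hl with h | rfl
      · rw [jetCoeff_eq_zero F c h, hu l h]; simp
      · rw [mul_div_cancel₀ _ hd]; ring
  obtain ⟨u, hu⟩ := key n le_rfl
  obtain ⟨y, hy, hyu⟩ := exists_jet z n u
  refine ⟨y, hy, fun l hl => ?_⟩
  rw [jetOp_eq_sum F c (hy z) hl, ← hu l hl]
  exact Finset.sum_congr rfl fun j hj => by rw [hyu j (Finset.mem_range.1 hj)]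

end JetOperators

end StdForm

end

section

open Complex Metric Filter Topology

namespace StdForm

/-! ### The chain at infinity and at a Fuchsian point -/

section JetTransformations

open Polynomial

/-- The operators `jetOp` under the change of variables `z = 1 / ξ`. -/
lemma jetOp_inv {F Fh : ℕ → ℂ[X]} {c ch : ℕ → ℕ → ℂ[X]} {μ : ℤ} {n : ℕ}
    (hF : ∀ i < n, ∀ ξ : ℂ, ξ ≠ 0 → (Fh i).eval ξ = -(ξ ^ 2 * ξ ^ μ * (F i).eval ξ⁻¹))
    (hc : ∀ i < n, ∀ l ≤ i, ∀ ξ : ℂ, ξ ≠ 0 → (ch i l).eval ξ =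
      ξ ^ (((i : ℤ) + 1 - l) * μ) * (c i l).eval ξ⁻¹
        + if l = i then ((i * μ : ℤ) : ℂ) * ξ * ξ ^ μ * (F i).eval ξ⁻¹ else 0)
    {y : ℂ → ℂ} {i : ℕ} (hi : i ≤ n) {ξ : ℂ} (hξ : ξ ≠ 0) (hy : AnalyticAt ℂ y ξ⁻¹) :
    jetOp Fh ch i (fun w => y w⁻¹) ξ = ξ ^ ((i : ℤ) * μ) * jetOp F c i y ξ⁻¹ := by
  induction i using Nat.strong_induction_on generalizing ξ with
  | _ i ih =>
    cases i with
    | zero => simp [jetOp_zero]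
    | succ i =>
      have hev : jetOp Fh ch i (fun w => y w⁻¹) =ᶠ[𝓝 ξ]
          fun w => w ^ ((i : ℤ) * μ) * jetOp F c i y w⁻¹ := by
        have h1 : ∀ᶠ w in 𝓝 ξ, AnalyticAt ℂ y w⁻¹ :=
          (continuousAt_inv₀ hξ).eventually hy.eventually_analyticAt
        filter_upwards [h1, isOpen_ne.mem_nhds hξ] with w hw hw0
        exact ih i (by omega) (by omega) hw0 hw
      -- Differentiating the power factor is what adds the extra term to the coefficient with `l =
      -- i`; the factor `-ξ^2` in the leading coefficient undoes the derivative of `1 / ξ`.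
      have hd : HasDerivAt (fun w => w ^ ((i : ℤ) * μ) * jetOp F c i y w⁻¹)
          ((((i : ℤ) * μ : ℤ) : ℂ) * ξ ^ ((i : ℤ) * μ - 1) * jetOp F c i y ξ⁻¹
            + ξ ^ ((i : ℤ) * μ) * (deriv (jetOp F c i y) ξ⁻¹ * (-(ξ ^ 2)⁻¹))) ξ := by
        refine (hasDerivAt_zpow _ _ (Or.inl hξ)).mul ?_
        exact (analyticAt_jetOp F c hy i).differentiableAt.hasDerivAt.comp ξ (hasDerivAt_inv hξ)
      rw [jetOp_succ, hev.deriv_eq, hd.deriv, jetOp_succ, hF i (by omega) ξ hξ]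
      have hs : ∑ l ∈ Finset.range (i + 1), (ch i l).eval ξ * jetOp Fh ch l (fun w => y w⁻¹) ξ
          = ξ ^ (((i + 1 : ℕ) : ℤ) * μ) *
              ∑ l ∈ Finset.range (i + 1), (c i l).eval ξ⁻¹ * jetOp F c l y ξ⁻¹
            + ((i * μ : ℤ) : ℂ) * ξ * ξ ^ μ * (F i).eval ξ⁻¹ *
              (ξ ^ ((i : ℤ) * μ) * jetOp F c i y ξ⁻¹) := by
        have h1 : ∀ l ∈ Finset.range (i + 1),
            (ch i l).eval ξ * jetOp Fh ch l (fun w => y w⁻¹) ξ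
            = ξ ^ (((i + 1 : ℕ) : ℤ) * μ) * ((c i l).eval ξ⁻¹ * jetOp F c l y ξ⁻¹)
              + if l = i then ((i * μ : ℤ) : ℂ) * ξ * ξ ^ μ * (F i).eval ξ⁻¹ *
                (ξ ^ ((i : ℤ) * μ) * jetOp F c i y ξ⁻¹) else 0 := by
          intro l hl
          have hl' := Finset.mem_range.1 hl
          rw [ih l hl' (by omega) hξ hy, hc i (by omega) l (by omega) ξ hξ]
          have : ξ ^ (((i + 1 : ℕ) : ℤ) * μ) = ξ ^ (((i : ℤ) + 1 - l) * μ) * ξ ^ ((l : ℤ) * μ) := by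
            rw [← zpow_add₀ hξ]; congr 1; push_cast; ring
          rw [this]
          split_ifs with h
          · subst h; ring
          · ring
        rw [Finset.sum_congr rfl h1, Finset.sum_add_distrib, Finset.sum_ite_eq',
          if_pos (Finset.self_mem_range_succ i), Finset.mul_sum]
      rw [hs]
      have e1 : ξ ^ (((i + 1 : ℕ) : ℤ) * μ) = ξ ^ ((i : ℤ) * μ) * ξ ^ μ := by
        rw [← zpow_add₀ hξ]; congr 1; push_cast; ring
      rw [e1, zpow_sub_one₀ hξ]
      field_simp
      push_cast
      ring

variable (b : ℂ) (G : ℕ → ℂ[X]) (c : ℕ → ℕ → ℂ[X])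

/-- The coefficients of the operators `jetOp` with respect to `(z - b) ^ j y⁽ʲ⁾`, where
`Fᵢ = (z - b) Gᵢ`. -/
noncomputable def localCoeff : ℕ → ℕ → ℂ[X]
  | 0, j => if j = 0 then 1 else 0
  | i + 1, j => G i * ((X - C b) * derivative (localCoeff i j) + C (j : ℂ) * localCoeff i j
        + if j = 0 then 0 else localCoeff i (j - 1))
      + ∑ l : Fin (i + 1), c i l * localCoeff l j
termination_by i => i
decreasing_by
  · exact Nat.lt_succ_self i
  · exact Nat.lt_succ_self i
  · exact l.2

lemma localCoeff_zero (j : ℕ) : localCoeff b G c 0 j = if j = 0 then 1 else 0 := by rw [localCoeff]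

lemma localCoeff_succ (i j : ℕ) : localCoeff b G c (i + 1) j =
    G i * ((X - C b) * derivative (localCoeff b G c i j) + C (j : ℂ) * localCoeff b G c i j
      + if j = 0 then 0 else localCoeff b G c i (j - 1))
      + ∑ l ∈ Finset.range (i + 1), c i l * localCoeff b G c l j := by
  rw [localCoeff, ← Fin.sum_univ_eq_sum_range (fun l => c i l * localCoeff b G c l j)]

/-- The operator `θ = (z - b) d/dz` maps `f (z - b)^j y⁽ʲ⁾` to `((z - b) f' + j f) (z - b)^j y⁽ʲ⁾ +
f (z - b)^(j+1) y⁽ʲ⁺¹⁾`, so the factors `(z - b)^j` persist along the chain. -/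
lemma jetCoeff_eq_localCoeff {F : ℕ → ℂ[X]} {n : ℕ} (hF : ∀ i < n, F i = (X - C b) * G i) {i : ℕ}
    (hi : i ≤ n) (j : ℕ) : jetCoeff F c i j = (X - C b) ^ j * localCoeff b G c i j := by
  induction i using Nat.strong_induction_on generalizing j with
  | _ i ih =>
    cases i with
    | zero =>
      rw [jetCoeff_zero, localCoeff_zero]
      split_ifs with h <;> simp [h]
    | succ i =>
      rw [jetCoeff_succ, localCoeff_succ, hF i (by omega), ih i (by omega) (by omega)]
      have hs : ∑ l ∈ Finset.range (i + 1), c i l * jetCoeff F c l j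
          = (X - C b) ^ j * ∑ l ∈ Finset.range (i + 1), c i l * localCoeff b G c l j := by
        rw [Finset.mul_sum]
        refine Finset.sum_congr rfl fun l hl => ?_
        have := Finset.mem_range.1 hl
        rw [ih l this (by omega)]
        ring
      rw [hs]
      cases j with
      | zero => simp; ring
      | succ j =>
        rw [if_neg (by omega), if_neg (by omega), ih i (by omega) (by omega)]
        simp [derivative_X_sub_C_pow]
        ring

lemma localCoeff_eq_zero {i j : ℕ} (h : i < j) : localCoeff b G c i j = 0 := by
  have := jetCoeff_eq_localCoeff b G c (F := fun i => (X - C b) * G i) (n := i)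
    (fun _ _ => rfl) le_rfl j
  rw [jetCoeff_eq_zero _ _ h] at this
  exact (mul_eq_zero.1 this.symm).resolve_left (pow_ne_zero _ (X_sub_C_ne_zero b))

lemma localCoeff_diag (i : ℕ) : localCoeff b G c i i = ∏ l ∈ Finset.range i, G l := by
  have := jetCoeff_eq_localCoeff b G c (F := fun i => (X - C b) * G i) (n := i)
    (fun _ _ => rfl) le_rfl i
  rw [jetCoeff_diag, Finset.prod_mul_distrib, Finset.prod_const, Finset.card_range] at this
  exact (mul_left_cancel₀ (pow_ne_zero _ (X_sub_C_ne_zero b)) this).symm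

/-- The indicial polynomial of the operator `Vᵢ` at `b`. -/
noncomputable def jetIndicial (i : ℕ) : ℂ[X] :=
  ∑ j ∈ Finset.range (i + 1), C ((localCoeff b G c i j).eval b) * descPochhammer ℂ j

lemma jetIndicial_eq_sum {i N : ℕ} (h : i < N) : jetIndicial b G c i =
    ∑ j ∈ Finset.range N, C ((localCoeff b G c i j).eval b) * descPochhammer ℂ j := by
  refine Finset.sum_subset (Finset.range_mono (by omega)) fun j _ hj => ?_
  rw [localCoeff_eq_zero b G c (by simpa using hj)]
  simp

lemma X_mul_descPochhammer (j : ℕ) : (X : ℂ[X]) * descPochhammer ℂ j =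
    descPochhammer ℂ (j + 1) + C (j : ℂ) * descPochhammer ℂ j := by
  rw [descPochhammer_succ_right, C_eq_natCast]
  ring

lemma jetIndicial_zero : jetIndicial b G c 0 = 1 := by
  simp [jetIndicial, localCoeff_zero]

/-- On `(z - b)^ρ` the operator `(z - b) d/dz` acts as multiplication by `ρ`. The leading behaviour
at `b` thus obeys the recursion of the chain, with coefficients evaluated at `b` and the derivative
replaced by the variable `X`. -/
lemma jetIndicial_succ (i : ℕ) : jetIndicial b G c (i + 1) =
    C ((G i).eval b) * (X * jetIndicial b G c i)
      + ∑ l ∈ Finset.range (i + 1), C ((c i l).eval b) * jetIndicial b G c l := by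
  have h1 : ∀ l ∈ Finset.range (i + 1), C ((c i l).eval b) * jetIndicial b G c l =
      ∑ j ∈ Finset.range (i + 2), C ((c i l * localCoeff b G c l j).eval b)
        * descPochhammer ℂ j := by
    intro l hl
    have := Finset.mem_range.1 hl
    rw [jetIndicial_eq_sum b G c (show l < i + 2 by omega), Finset.mul_sum]
    refine Finset.sum_congr rfl fun j _ => ?_
    rw [eval_mul, C_mul]; ring
  have h2 : X * jetIndicial b G c i = ∑ j ∈ Finset.range (i + 2),
      C ((C (j : ℂ) * localCoeff b G c i j
        + if j = 0 then 0 else localCoeff b G c i (j - 1)).eval b) * descPochhammer ℂ j := by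
    have h3 : X * jetIndicial b G c i =
        ∑ j ∈ Finset.range (i + 1), C ((localCoeff b G c i j).eval b) * descPochhammer ℂ (j + 1)
        + ∑ j ∈ Finset.range (i + 2), C ((C (j : ℂ) * localCoeff b G c i j).eval b)
          * descPochhammer ℂ j := by
      rw [Finset.sum_range_succ _ (i + 1), localCoeff_eq_zero b G c (Nat.lt_succ_self i)]
      simp only [mul_zero, eval_zero, C_0, zero_mul, add_zero]
      rw [jetIndicial, Finset.mul_sum, ← Finset.sum_add_distrib]
      refine Finset.sum_congr rfl fun j _ => ?_
      rw [mul_left_comm, X_mul_descPochhammer, eval_mul, eval_C, C_mul]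
      ring
    have h4 : ∑ j ∈ Finset.range (i + 1), C ((localCoeff b G c i j).eval b) *
          descPochhammer ℂ (j + 1) = ∑ j ∈ Finset.range (i + 2),
          C ((if j = 0 then 0 else localCoeff b G c i (j - 1)).eval b) * descPochhammer ℂ j := by
      rw [Finset.sum_range_succ' _ (i + 1)]
      simp
    rw [h3, h4, ← Finset.sum_add_distrib]
    refine Finset.sum_congr rfl fun j _ => ?_
    rw [eval_add, C_add]
    ring
  rw [Finset.sum_congr rfl h1, Finset.sum_comm, h2, Finset.mul_sum, ← Finset.sum_add_distrib,
    jetIndicial]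
  refine Finset.sum_congr rfl fun j _ => ?_
  rw [localCoeff_succ, ← Finset.sum_mul]
  simp only [eval_add, eval_mul, eval_sub, eval_X, eval_C, sub_self, zero_mul, zero_add,
    eval_finsetSum, C_add, C_mul, map_sum]
  ring

end JetTransformations

/-! ### Characteristic polynomials of Hessenberg matrices -/

section Hessenberg

open Polynomial

/-- The characteristic polynomial of a lower Hessenberg matrix by recursion. -/
lemma charpoly_of_recursion {n : ℕ} {r : ℕ → ℕ → ℂ} {γ : ℕ → ℂ} {P : ℕ → ℂ[X]}
    (hr : ∀ l s, l + 1 < s → r l s = 0) (hγ : ∀ l, l + 1 < n → r l (l + 1) * γ l = 1)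
    (hP0 : P 0 = 1) (hP : ∀ i < n, P (i + 1) =
      C (γ i) * (X * P i - ∑ l ∈ Finset.range (i + 1), C (r i l) * P l)) :
    P n = C (∏ i ∈ Finset.range n, γ i) *
      (Matrix.of fun i j : Fin n => r i j : Matrix (Fin n) (Fin n) ℂ).charpoly := by
  cases n with
  | zero => simp [hP0]
  | succ N =>
    set R : Matrix (Fin (N + 1)) (Fin (N + 1)) ℂ := Matrix.of fun i j => r i j with hR
    set M := R.charmatrix with hM
    set v : Fin (N + 1) → ℂ[X] := fun i => P i with hv
    have hMv : ∀ i : Fin (N + 1), (M.mulVec v) i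
        = X * P i - ∑ s ∈ Finset.range (N + 1), C (r i s) * P s := by
      intro i
      rw [hM, Matrix.charmatrix, Matrix.sub_mulVec, Pi.sub_apply]
      congr 1
      · simp [hv]
      · rw [← Fin.sum_univ_eq_sum_range (fun s => C (r i s) * P s)]
        rfl
    have hsum : ∀ i ≤ N, ∑ s ∈ Finset.range (N + 1), C (r i s) * P s
        = ∑ s ∈ Finset.range (i + 1), C (r i s) * P s
          + if i < N then C (r i (i + 1)) * P (i + 1) else 0 := by
      intro i hi
      split_ifs with h
      · rw [← Finset.sum_range_succ]
        symm
        refine Finset.sum_subset (Finset.range_mono (by omega)) fun s _ hs => ?_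
        rw [hr i s (by have : ¬ s < i + 1 + 1 := by simpa using hs
                       have h2 : s ≠ i + 1 := by omega
                       omega)]
        simp
      · rw [show i = N by omega]; simp
    -- The recursion says that `v = (P 0, …, P N)` is annihilated by every row of `X - R` except the
    -- last, where the value is `P (N + 1)` up to the factor `γ N`.
    have hlow : ∀ i : Fin N, (M.mulVec v) i.castSucc = 0 := by
      intro i
      have hi := i.2
      rw [hMv, hsum _ (by simp)]
      simp only [Fin.val_castSucc]
      rw [if_pos hi, hP i (by omega), ← mul_assoc, ← C_mul, hγ i (by omega)]
      simp
    have hlast : C (γ N) * (M.mulVec v) (Fin.last N) = P (N + 1) := by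
      rw [hMv, hsum _ (by simp), hP N (by omega)]
      simp
    -- Cramer's rule for the entry of `v` with index `0`, which is `P 0 = 1`. The new column has
    -- only its last entry nonzero, and the remaining minor is triangular with the superdiagonal of
    -- `-R` on its diagonal.
    have hcr : (M.updateCol 0 (M.mulVec v)).det = M.det := by
      have h1 : M.cramer (M.mulVec v) = M.det • v := by
        rw [Matrix.cramer_eq_adjugate_mulVec, Matrix.mulVec_mulVec, Matrix.adjugate_mul,
          Matrix.smul_mulVec, Matrix.one_mulVec]
      rw [← Matrix.cramer_apply, h1]
      simp [hv, hP0]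
    have hdet : M.det = (-1) ^ N * (M.mulVec v) (Fin.last N) *
        ∏ i : Fin N, (-C (r i (i + 1))) := by
      rw [← hcr, Matrix.det_succ_column_zero, Fin.sum_univ_castSucc, Finset.sum_eq_zero, zero_add]
      · rw [Matrix.updateCol_self, Fin.val_last, Fin.succAbove_last]
        congr 1
        rw [Matrix.det_of_isLowerTriangular]
        · refine Finset.prod_congr rfl fun i _ => ?_
          rw [Matrix.submatrix_apply, Matrix.updateCol_ne (Fin.succ_ne_zero i), hM,
            Matrix.charmatrix_apply_ne _ _ _ (by simp [Fin.ext_iff])]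
          simp [hR]
        · intro i j hij
          have hij' : (i : ℕ) < j := hij
          rw [Matrix.submatrix_apply, Matrix.updateCol_ne (Fin.succ_ne_zero j), hM,
            Matrix.charmatrix_apply_ne _ _ _ (by simp [Fin.ext_iff]; omega)]
          simp [hR, hr i (j + 1) (by omega)]
      · intro i _
        rw [Matrix.updateCol_self, hlow]
        simp
    rw [Matrix.charpoly, ← hM, hdet, Finset.prod_range_succ, C_mul, ← hlast, Finset.prod_neg,
      Fin.prod_univ_eq_prod_range (fun i => C (r i (i + 1)) : ℕ → ℂ[X])]
    have h1 : C (∏ i ∈ Finset.range N, γ i) * ∏ i ∈ Finset.range N, C (r i (i + 1)) = 1 := by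
      rw [← map_prod C, ← C_mul, mul_comm, ← Finset.prod_mul_distrib, Finset.prod_eq_one, C_1]
      exact fun i hi => hγ i (by have := Finset.mem_range.1 hi; omega)
    have h2 : ((-1 : ℂ[X]) ^ N) * (-1) ^ N = 1 := by rw [← mul_pow]; simp
    simp only [Finset.card_univ, Fintype.card_fin]
    linear_combination (-(C (γ N) * (M.mulVec v) (Fin.last N))) * (h1)
      - (C (γ N) * (M.mulVec v) (Fin.last N)) *
        (C (∏ i ∈ Finset.range N, γ i) * ∏ i ∈ Finset.range N, C (r i (i + 1))) * h2

end Hessenberg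

end StdForm

end

section

open Complex Metric Filter Topology

namespace StdForm

/-! ### The scalar equation of a Hessenberg system -/

section HessenbergData

open Polynomial

/-- Coefficients of a Hessenberg system of the required type, with rows and columns numbered from
the last one; `κ₀` is the last of the indices. -/
structure HessData {m : ℕ} (a : Fin m → ℂ) (n : ℕ) (κ₀ : ℤ) where
  β : ℕ → ℂ
  β_ne : ∀ l, β l ≠ 0
  K : ℕ → ℕ → ℂ[X]
  K_zero : ∀ l s, l + 1 < s → K l s = 0
  K_super : ∀ l, l + 1 < n → K l (l + 1) = C (β l)
  G : ℕ → ℕ → ℂ[X]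
  G_spec : ∀ l < n, ∀ s ≤ l, ∀ ξ : ℂ, ξ ≠ 0 → (K l s).eval ξ⁻¹ =
    (if s = l then ((κ₀ + l * ((m : ℤ) - 2) : ℤ) : ℂ) * ξ⁻¹ ^ (m - 1) else 0)
      + ξ ^ (-(((m : ℤ) - 2) * (1 + l - s))) * (G l s).eval ξ

namespace HessData

variable {m : ℕ} {a : Fin m → ℂ} {n : ℕ} {κ₀ : ℤ} (D : HessData a n κ₀)

/-- The matrix of the system. -/
noncomputable def A (z : ℂ) : Matrix (Fin n) (Fin n) ℂ :=
  Matrix.of fun i j => (∏ k, (z - a k))⁻¹ * (D.K (n - 1 - i) (n - 1 - j)).eval z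

/-- The polynomial with the zeros `a k`. -/
noncomputable def nodePoly (a : Fin m → ℂ) : ℂ[X] := ∏ k, (X - C (a k))

/-- The polynomial with the zeros `a j`, `j ≠ k`. -/
noncomputable def nodePolyErase (a : Fin m → ℂ) (k : Fin m) : ℂ[X] :=
  ∏ j ∈ Finset.univ.erase k, (X - C (a j))

lemma eval_nodePoly (z : ℂ) : (nodePoly a).eval z = ∏ k, (z - a k) := by
  simp [nodePoly, eval_prod]

lemma eval_nodePoly_ne {z : ℂ} (hz : ∀ k, z ≠ a k) : (nodePoly a).eval z ≠ 0 := by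
  rw [eval_nodePoly]
  exact Finset.prod_ne_zero_iff.2 fun k _ => sub_ne_zero.2 (hz k)

lemma nodePoly_eq (k : Fin m) : nodePoly a = (X - C (a k)) * nodePolyErase a k :=
  (Finset.mul_prod_erase _ _ (Finset.mem_univ k)).symm

lemma eval_nodePolyErase_self (ha : Function.Injective a) (k : Fin m) :
    (nodePolyErase a k).eval (a k) ≠ 0 := by
  rw [nodePolyErase, eval_prod]
  refine Finset.prod_ne_zero_iff.2 fun j hj => ?_
  simpa [sub_eq_zero] using fun h => (Finset.ne_of_mem_erase hj) (ha h).symm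

lemma eval_nodePolyErase_ne {j k : Fin m} (h : j ≠ k) : (nodePolyErase a k).eval (a j) = 0 := by
  rw [nodePolyErase, eval_prod]
  exact Finset.prod_eq_zero (Finset.mem_erase.2 ⟨h, Finset.mem_univ j⟩) (by simp)

/-- The reversed polynomial of `nodePoly`. -/
noncomputable def revNodePoly (s : Finset (Fin m)) (a : Fin m → ℂ) : ℂ[X] :=
  ∏ k ∈ s, (1 - C (a k) * X)

lemma eval_revNodePoly (s : Finset (Fin m)) {ξ : ℂ} (hξ : ξ ≠ 0) :
    (revNodePoly s a).eval ξ = ξ ^ s.card * ∏ k ∈ s, (ξ⁻¹ - a k) := by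
  rw [revNodePoly, eval_prod, ← Finset.prod_const, ← Finset.prod_mul_distrib]
  refine Finset.prod_congr rfl fun k _ => ?_
  rw [mul_sub, mul_inv_cancel₀ hξ, eval_sub, eval_one, eval_mul, eval_C, eval_X, mul_comm]

/-- The constant coefficient is `1`. Hence after removing `1` there is a factor `ξ`, which absorbs
the simple poles that arise at infinity. -/
lemma revNodePoly_eq (s : Finset (Fin m)) (ξ : ℂ) :
    (revNodePoly s a).eval ξ = 1 + ξ * (revNodePoly s a).divX.eval ξ := by
  conv_lhs => rw [← divX_mul_X_add (revNodePoly s a)]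
  have : (revNodePoly s a).coeff 0 = 1 := by
    rw [coeff_zero_eq_eval_zero, revNodePoly, eval_prod]
    simp
  rw [this]
  simp
  ring

/-- The leading coefficients of the operators that belong to the system. -/
noncomputable def F (l : ℕ) : ℂ[X] := C (D.β l)⁻¹ * nodePoly a

/-- The lower coefficients of the operators that belong to the system. -/
noncomputable def c (k₀ : Fin m) (l s : ℕ) : ℂ[X] :=
  C (D.β l)⁻¹ * (-D.K l s + if s = l then C (κ₀ : ℂ) * nodePolyErase a k₀ else 0)

/-- The leading coefficients in the variable `1 / z`. -/
noncomputable def Fh (l : ℕ) : ℂ[X] := C (D.β l)⁻¹ * -(revNodePoly Finset.univ a)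

/-- The lower coefficients in the variable `1 / z`. -/
noncomputable def ch (k₀ : Fin m) (l s : ℕ) : ℂ[X] :=
  C (D.β l)⁻¹ * (-D.G l s + if s = l then
    C (κ₀ : ℂ) * (revNodePoly (Finset.univ.erase k₀) a).divX
      + C ((l * ((m : ℤ) - 2) : ℤ) : ℂ) * (revNodePoly Finset.univ a).divX else 0)

/-- The operators that belong to the system. -/
noncomputable abbrev V (k₀ : Fin m) (l : ℕ) (y : ℂ → ℂ) : ℂ → ℂ := jetOp D.F (D.c k₀) l y

lemma eval_F_ne (l : ℕ) {z : ℂ} (hz : ∀ k, z ≠ a k) : (D.F l).eval z ≠ 0 := by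
  rw [F, eval_mul, eval_C]
  exact mul_ne_zero (inv_ne_zero (D.β_ne l)) (eval_nodePoly_ne hz)

/-- The degree bounds allow `ξ^((l+1-s)(m-2))` to clear the denominators below the leading terms. On
the diagonal the term `(κ₀ + l(m-2)) / ξ` is left. Its first part is cancelled by the correction
with `nodePolyErase`, which comes from the factor `(z - a k₀)^κ₀`, and its second part by the
derivative of `ξ^(l(m-2))`. -/
lemma V_inv (k₀ : Fin m) {y : ℂ → ℂ} {i : ℕ} (hi : i ≤ n) {ξ : ℂ} (hξ : ξ ≠ 0)
    (hy : AnalyticAt ℂ y ξ⁻¹) : jetOp D.Fh (D.ch k₀) i (fun w => y w⁻¹) ξ =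
      ξ ^ ((i : ℤ) * ((m : ℤ) - 2)) * D.V k₀ i y ξ⁻¹ := by
  have hm : 1 ≤ m := k₀.pos
  refine jetOp_inv (n := n) (fun i hi ξ hξ => ?_) (fun l hl s hs ξ hξ => ?_) hi hξ hy
  · have e1 : ξ ^ 2 * ξ ^ ((m : ℤ) - 2) = ξ ^ m := by
      rw [← zpow_natCast, ← zpow_natCast, ← zpow_add₀ hξ]; congr 1; push_cast; ring
    rw [Fh, F, eval_mul, eval_mul, eval_neg, eval_revNodePoly _ hξ, eval_nodePoly, e1]
    simp
    ring
  · have hG := D.G_spec l hl s hs ξ hξ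
    rw [ch, c, F]
    simp only [eval_mul, eval_add, eval_neg, eval_C, hG]
    split_ifs with h
    · subst h
      have e2 : ((s : ℤ) + 1 - s) * ((m : ℤ) - 2) = (m : ℤ) - 2 := by ring
      have e3 : -(((m : ℤ) - 2) * (1 + (s : ℤ) - s)) = -((m : ℤ) - 2) := by ring
      rw [e2, e3]
      have e4 : ξ ^ ((m : ℤ) - 2) * ξ ^ (-((m : ℤ) - 2)) = 1 := by
        rw [← zpow_add₀ hξ]; simp
      have e5 : ξ * (ξ ^ ((m : ℤ) - 2) * ξ⁻¹ ^ (m - 1)) = 1 := by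
        rw [inv_pow, ← zpow_natCast, ← zpow_neg, ← zpow_add₀ hξ, ← zpow_one_add₀ hξ]
        rw [show 1 + ((m : ℤ) - 2 + -((m - 1 : ℕ) : ℤ)) = 0 by push_cast [hm]; ring]
        simp
      have e6 : ξ * (ξ * ξ ^ ((m : ℤ) - 2)) = ξ ^ m := by
        rw [← zpow_natCast ξ m, ← zpow_one_add₀ hξ, ← zpow_one_add₀ hξ]; congr 1; ring
      have e7 : ξ * ξ ^ ((m : ℤ) - 2) = ξ ^ (m - 1) := by
        rw [← zpow_natCast ξ (m - 1), ← zpow_one_add₀ hξ]; congr 1; push_cast [hm]; ring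
      have p1 := revNodePoly_eq (a := a) Finset.univ ξ
      have p2 := revNodePoly_eq (a := a) (Finset.univ.erase k₀) ξ
      rw [eval_revNodePoly _ hξ] at p1 p2
      rw [Finset.card_univ, Fintype.card_fin, ← eval_nodePoly] at p1
      rw [Finset.card_erase_of_mem (Finset.mem_univ _), Finset.card_univ, Fintype.card_fin] at p2
      have p2' : ξ ^ (m - 1) * (nodePolyErase a k₀).eval ξ⁻¹ =
          1 + ξ * (revNodePoly (Finset.univ.erase k₀) a).divX.eval ξ := by
        rw [← p2, nodePolyErase, eval_prod]; simp
      apply mul_left_cancel₀ hξ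
      simp only [eval_mul, eval_add, eval_C]
      rw [← e6] at p1
      rw [← e7] at p2'
      push_cast
      linear_combination (-(D.β s)⁻¹ * (κ₀ : ℂ)) * p2'
        - ((D.β s)⁻¹ * (s * ((m : ℂ) - 2))) * p1
        + (D.β s)⁻¹ * ((κ₀ : ℂ) + s * ((m : ℂ) - 2)) * e5
        + (D.β s)⁻¹ * ξ * (D.G s s).eval ξ * e4
    · have e3 : ξ ^ (((l : ℤ) + 1 - s) * ((m : ℤ) - 2)) *
          ξ ^ (-(((m : ℤ) - 2) * (1 + (l : ℤ) - s))) = 1 := by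
        rw [← zpow_add₀ hξ, show ((l : ℤ) + 1 - s) * ((m : ℤ) - 2)
          + -(((m : ℤ) - 2) * (1 + (l : ℤ) - s)) = 0 by ring]
        simp
      simp only [eval_zero, add_zero, zero_add]
      linear_combination ((D.β l)⁻¹ * (D.G l s).eval ξ) * e3

/-- The coefficients of the scalar equation for the last component. -/
noncomputable def q (k₀ : Fin m) (j : Fin n) (z : ℂ) : ℂ :=
  (jetCoeff D.F (D.c k₀) n (n - 1 - j)).eval z / (jetCoeff D.F (D.c k₀) n n).eval z

lemma _root_.StdForm.jetOp_eq_scalarOp {F : ℕ → ℂ[X]} {c : ℕ → ℕ → ℂ[X]} {y : ℂ → ℂ} {z : ℂ}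
    (hy : AnalyticAt ℂ y z) (h : (jetCoeff F c n n).eval z ≠ 0) (q : Fin n → ℂ → ℂ)
    (hq : ∀ j, q j z = (jetCoeff F c n (n - 1 - j)).eval z / (jetCoeff F c n n).eval z) :
    jetOp F c n y z = (jetCoeff F c n n).eval z * scalarOp q y z := by
  rw [jetOp_eq_sum F c hy (Nat.lt_succ_self n), Finset.sum_range_succ, scalarOp, mul_add, add_comm]
  congr 1
  rw [← Finset.sum_range_reflect, Finset.mul_sum,
    ← Fin.sum_univ_eq_sum_range (fun j => (jetCoeff F c n (n - 1 - j)).eval z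
      * iteratedDeriv (n - 1 - j) y z)]
  refine Finset.sum_congr rfl fun j _ => ?_
  rw [hq]
  field_simp

lemma eval_jetCoeff_ne (k₀ : Fin m) {z : ℂ} (hz : ∀ k, z ≠ a k) :
    (jetCoeff D.F (D.c k₀) n n).eval z ≠ 0 := by
  rw [jetCoeff_diag, eval_prod]
  exact Finset.prod_ne_zero_iff.2 fun l _ => D.eval_F_ne l hz

lemma V_eq_scalarOp (k₀ : Fin m) {y : ℂ → ℂ} {z : ℂ} (hz : ∀ k, z ≠ a k) (hy : AnalyticAt ℂ y z) :
    D.V k₀ n y z = (jetCoeff D.F (D.c k₀) n n).eval z * scalarOp (D.q k₀) y z :=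
  jetOp_eq_scalarOp hy (D.eval_jetCoeff_ne k₀ hz) _ fun _ => rfl

lemma analyticAt_q (k₀ : Fin m) {z : ℂ} (hz : ∀ k, z ≠ a k) (j : Fin n) :
    AnalyticAt ℂ (D.q k₀ j) z :=
  (AnalyticAt.aeval_polynomial (f := id) analyticAt_id _).div
    (AnalyticAt.aeval_polynomial (f := id) analyticAt_id _) (D.eval_jetCoeff_ne k₀ hz)

/-- The transformed chain has polynomial coefficients, and its leading coefficient at order `n` is a
nonzero constant times a power of the reversed node polynomial, which is `1` at `ξ = 0`. Dividing by
it gives analytic coefficients. -/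
lemma regularAtInfinity_q (k₀ : Fin m) : RegularAtInfinity (D.q k₀) := by
  have hT : ∀ ξ, (jetCoeff D.Fh (D.ch k₀) n n).eval ξ =
      ∏ l ∈ Finset.range n, ((D.β l)⁻¹ * -((revNodePoly Finset.univ a).eval ξ)) := by
    intro ξ
    rw [jetCoeff_diag, eval_prod]
    simp [Fh]
  obtain ⟨r, hr, hr0⟩ : ∃ r > 0, ∀ ξ ∈ ball (0 : ℂ) r, (revNodePoly Finset.univ a).eval ξ ≠ 0 := by
    refine Metric.eventually_nhds_iff_ball.1 ?_
    refine (revNodePoly Finset.univ a).continuous.continuousAt.eventually_ne ?_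
    simp [revNodePoly, eval_prod]
  have hr' : ∀ ξ ∈ ball (0 : ℂ) r, (jetCoeff D.Fh (D.ch k₀) n n).eval ξ ≠ 0 := fun ξ hξ => by
    rw [hT]
    exact Finset.prod_ne_zero_iff.2 fun l _ =>
      mul_ne_zero (inv_ne_zero (D.β_ne l)) (neg_ne_zero.2 (hr0 ξ hξ))
  refine ⟨r, hr, fun j ξ => (jetCoeff D.Fh (D.ch k₀) n (n - 1 - j)).eval ξ /
    (jetCoeff D.Fh (D.ch k₀) n n).eval ξ, fun j ξ hξ => ?_, fun ξ hξ hξ0 y hy => ?_⟩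
  · exact (AnalyticAt.aeval_polynomial (f := id) analyticAt_id _).div
      (AnalyticAt.aeval_polynomial (f := id) analyticAt_id _) (hr' ξ hξ)
  · have hz : ∀ k, ξ⁻¹ ≠ a k := by
      intro k hk
      refine hr0 ξ hξ ?_
      rw [eval_revNodePoly _ hξ0, Finset.prod_eq_zero (Finset.mem_univ k) (by rw [hk, sub_self]),
        mul_zero]
    have hyi : AnalyticAt ℂ (fun w => y w⁻¹) ξ := hy.comp (analyticAt_inv hξ0)
    have h1 := D.V_inv k₀ le_rfl hξ0 hy
    rw [D.V_eq_scalarOp k₀ hz hy, jetOp_eq_scalarOp hyi (hr' ξ hξ) (fun j ξ =>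
      (jetCoeff D.Fh (D.ch k₀) n (n - 1 - j)).eval ξ /
        (jetCoeff D.Fh (D.ch k₀) n n).eval ξ) (fun _ => rfl)] at h1
    constructor
    · intro h
      rw [h, mul_zero, mul_zero] at h1
      exact (mul_eq_zero.1 h1).resolve_left (hr' ξ hξ)
    · intro h
      rw [h, mul_zero] at h1
      exact ((mul_eq_zero.1 h1.symm).resolve_left (zpow_ne_zero _ hξ0) |>
          mul_eq_zero.1).resolve_left
        (D.eval_jetCoeff_ne k₀ hz)

/-- The residue of the system at `a k`. -/
noncomputable def residue (k : Fin m) : Matrix (Fin n) (Fin n) ℂ :=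
  Matrix.of fun i j => (D.K (n - 1 - i) (n - 1 - j)).eval (a k) / (nodePolyErase a k).eval (a k)

lemma roots_charpoly_sub_scalar (R : Matrix (Fin n) (Fin n) ℂ) (s : ℂ) :
    (R - Matrix.scalar (Fin n) s).charpoly.roots = R.charpoly.roots.map (· - s) := by
  rw [Matrix.charpoly_sub_scalar]
  have := roots_comp_C_mul_X_add_C R.charpoly 1 s isUnit_one
  simpa using this

/-- The indicial polynomials of the chain satisfy the hypotheses of `charpoly_of_recursion` for the
residue, with reversed numbering and shifted by a scalar. The reversal is a simultaneous permutation
of rows and columns and leaves the characteristic polynomial unchanged. -/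
lemma fuchsianAt_q (ha : Function.Injective a) (k₀ k : Fin m) :
    FuchsianAt (D.q k₀) (a k) ((D.residue k).charpoly.roots.map fun e : ℂ =>
      if k = k₀ then e - (κ₀ : ℂ) else e) := by
  set b := a k with hb
  set e := (nodePolyErase a k).eval b with he
  have he0 : e ≠ 0 := eval_nodePolyErase_self ha k
  set Gk : ℕ → ℂ[X] := fun l => C (D.β l)⁻¹ * nodePolyErase a k with hGk
  have hF : ∀ i < n, D.F i = (X - C b) * Gk i := fun i _ => by
    rw [F, nodePoly_eq k, hGk]; ring
  set S := localCoeff b Gk (D.c k₀) with hS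
  have hTS := fun j => jetCoeff_eq_localCoeff b Gk (D.c k₀) hF le_rfl j
  set γ : ℕ → ℂ := fun l => (D.β l)⁻¹ * e with hγ
  have hGe : ∀ l, (Gk l).eval b = γ l := fun l => by simp [hGk, hγ, he]
  have hSnn : (S n n).eval b = ∏ l ∈ Finset.range n, γ l := by
    rw [hS, localCoeff_diag, eval_prod]
    exact Finset.prod_congr rfl fun l _ => hGe l
  have hSne : (S n n).eval b ≠ 0 := by
    rw [hSnn]
    exact Finset.prod_ne_zero_iff.2 fun l _ => mul_ne_zero (inv_ne_zero (D.β_ne l)) he0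
  -- The correction term contains `nodePolyErase a k₀`, which vanishes at every node other than `a
  -- k₀`; only there are the exponents shifted.
  set s : ℂ := if k = k₀ then (κ₀ : ℂ) else 0 with hs
  set r : ℕ → ℕ → ℂ := fun l t => (D.K l t).eval b / e - if t = l then s else 0 with hr
  have hch := charpoly_of_recursion (n := n) (r := r) (γ := γ)
    (P := jetIndicial b Gk (D.c k₀)) (fun l t h => by
      simp [hr, D.K_zero l t h, show t ≠ l by omega]) (fun l hl => by
      simp only [hr, hγ, D.K_super l hl, eval_C, if_neg (show l + 1 ≠ l by omega), sub_zero]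
      have := D.β_ne l
      field_simp) (jetIndicial_zero _ _ _) (fun i hi => by
      rw [jetIndicial_succ, hGe, mul_sub, sub_eq_add_neg]
      congr 1
      rw [Finset.mul_sum, ← Finset.sum_neg_distrib]
      refine Finset.sum_congr rfl fun l hl => ?_
      rw [← mul_assoc, ← C_mul, ← neg_mul, ← C_neg]
      congr 2
      have h2 : (nodePolyErase a k₀).eval b * κ₀ = s * e := by
        rw [hs]
        split_ifs with h
        · rw [he, h]; ring
        · rw [hb, eval_nodePolyErase_ne h]; simp
      simp only [c, hr, hγ, eval_mul, eval_add, eval_neg, eval_C]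
      have hK : (D.K i l).eval b / e * e = (D.K i l).eval b := div_mul_cancel₀ _ he0
      split_ifs with h
      · simp only [eval_mul, eval_C]
        linear_combination (D.β i)⁻¹ * h2 + (D.β i)⁻¹ * hK
      · simp only [eval_zero]
        linear_combination (D.β i)⁻¹ * hK)
  have hmat : (Matrix.of fun i j : Fin n => r i j : Matrix (Fin n) (Fin n) ℂ) =
      Matrix.reindex Fin.revPerm Fin.revPerm (D.residue k) - Matrix.scalar (Fin n) s := by
    ext i j
    have hi := i.2
    have hj := j.2
    simp only [hr, residue, Matrix.of_apply, Matrix.sub_apply, Matrix.reindex_apply,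
      Matrix.submatrix_apply, Fin.revPerm_symm, Fin.revPerm_apply, Fin.val_rev,
      Matrix.scalar_apply, Matrix.diagonal_apply, Fin.ext_iff]
    rw [show n - 1 - (n - ((i : ℕ) + 1)) = i by omega, show n - 1 - (n - ((j : ℕ) + 1)) = j by
        omega]
    simp only [eq_comm]
    rfl
  have hroots : (jetIndicial b Gk (D.c k₀) n).roots =
      (D.residue k).charpoly.roots.map fun e : ℂ => if k = k₀ then e - (κ₀ : ℂ) else e := by
    rw [hch, roots_C_mul _ (hSnn ▸ hSne), hmat, roots_charpoly_sub_scalar, Matrix.charpoly_reindex]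
    refine Multiset.map_congr rfl fun x _ => ?_
    rw [hs]; split_ifs <;> simp
  refine ⟨fun j z => (S n (n - 1 - j)).eval z / (S n n).eval z, fun j => ?_, fun j => ?_, ?_⟩
  · exact (AnalyticAt.aeval_polynomial (f := id) analyticAt_id _).div
      (AnalyticAt.aeval_polynomial (f := id) analyticAt_id _) hSne
  · filter_upwards [self_mem_nhdsWithin] with z hz
    have hz' : z - b ≠ 0 := sub_ne_zero.2 hz
    have hj := j.2
    rw [q, hTS, hTS, eval_mul, eval_mul, eval_pow, eval_pow, eval_sub, eval_X, eval_C,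
      div_div, mul_comm ((S n n).eval z)]
    have : (z - b) ^ n = (z - b) ^ (n - 1 - (j : ℕ)) * (z - b) ^ ((j : ℕ) + 1) := by
      rw [← pow_add]; congr 1; omega
    rw [this, mul_assoc, mul_div_mul_left _ _ (pow_ne_zero _ hz')]
  · rw [← hroots, ← roots_C_mul (jetIndicial b Gk (D.c k₀) n) (inv_ne_zero hSne)]
    congr 1
    rw [jetIndicial, Finset.sum_range_succ, mul_add, indicialPoly, add_comm]
    congr 1
    · rw [← Finset.sum_range_reflect, Finset.mul_sum, ← Fin.sum_univ_eq_sum_range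
        (fun j => C ((S n n).eval b)⁻¹ * (C ((S n (n - 1 - j)).eval b)
          * descPochhammer ℂ (n - 1 - j)))]
      refine Finset.sum_congr rfl fun j _ => ?_
      rw [← mul_assoc, ← C_mul, ← div_eq_inv_mul]
    · rw [← mul_assoc, ← C_mul, inv_mul_cancel₀ hSne]; simp

end HessData

end HessenbergData

end StdForm

end

section

open Complex Metric Filter Topology
open scoped Matrix.Norms.Operator

namespace StdForm

namespace HessData

/-! ### Passing between solutions of the system and of the equation -/

section Gauge

variable {m : ℕ} {a : Fin m → ℂ} {n : ℕ} {κ₀ : ℤ} (D : HessData a n κ₀)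

lemma A_apply (z : ℂ) (i j : Fin n) : D.A z i j =
    ((nodePoly a).eval z)⁻¹ * (D.K (n - 1 - i) (n - 1 - j)).eval z := by
  rw [eval_nodePoly]; rfl

lemma sum_rev (x : ℕ → ℂ) : ∑ j : Fin n, x (n - 1 - j) = ∑ s ∈ Finset.range n, x s := by
  rw [Fin.sum_univ_eq_sum_range (fun j => x (n - 1 - j)), Finset.sum_range_reflect]

/-- With the convention `x n = 0` the row `l = n - 1`, which has no superdiagonal entry, has the
same shape as the others. This is why the value of `β (n - 1)` does not matter. -/
lemma sum_K {l : ℕ} (hl : l < n) (z : ℂ) {x : ℕ → ℂ} (hx : x n = 0) :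
    ∑ s ∈ Finset.range n, (D.K l s).eval z * x s =
      ∑ s ∈ Finset.range (l + 1), (D.K l s).eval z * x s + D.β l * x (l + 1) := by
  rcases (show l + 1 ≤ n from hl).eq_or_lt with h | h
  · rw [h, hx]; simp
  · have : D.β l = (D.K l (l + 1)).eval z := by rw [D.K_super l h]; simp
    rw [this, ← Finset.sum_range_succ]
    symm
    refine Finset.sum_subset (Finset.range_mono (by omega)) fun s _ hs => ?_
    rw [D.K_zero l s (by simp at hs; omega)]
    simp

lemma sum_A_mul (z : ℂ) (i : Fin n) (x : ℕ → ℂ) : ∑ j : Fin n, D.A z i j * x (n - 1 - j) =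
    ((nodePoly a).eval z)⁻¹ * ∑ s ∈ Finset.range n, (D.K (n - 1 - i) s).eval z * x s := by
  rw [Finset.mul_sum, ← sum_rev (fun s => ((nodePoly a).eval z)⁻¹ *
      ((D.K (n - 1 - i) s).eval z * x s))]
  refine Finset.sum_congr rfl fun j _ => ?_
  rw [A_apply]; ring

lemma V_succ (k₀ : Fin m) (l : ℕ) (y : ℂ → ℂ) (z : ℂ) :
    D.β l * D.V k₀ (l + 1) y z = (nodePoly a).eval z * deriv (D.V k₀ l y) z
      - ∑ s ∈ Finset.range (l + 1), (D.K l s).eval z * D.V k₀ s y z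
      + κ₀ * (nodePolyErase a k₀).eval z * D.V k₀ l y z := by
  have h1 : ∀ s ∈ Finset.range (l + 1), (D.c k₀ l s).eval z * D.V k₀ s y z =
      (D.β l)⁻¹ * (-((D.K l s).eval z * D.V k₀ s y z)
        + if s = l then κ₀ * (nodePolyErase a k₀).eval z * D.V k₀ l y z else 0) := by
    intro s _
    rw [c]
    split_ifs with h
    · subst h; simp; ring
    · simp; ring
  rw [V, jetOp_succ, Finset.sum_congr rfl h1, ← Finset.mul_sum, Finset.sum_add_distrib,
    Finset.sum_ite_eq', if_pos (Finset.self_mem_range_succ l), Finset.sum_neg_distrib]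
  have := D.β_ne l
  simp only [F, Polynomial.eval_mul, Polynomial.eval_C]
  field_simp
  ring

/-- The factor `(z - a k₀) ^ κ₀`. -/
noncomputable def gauge (a : Fin m → ℂ) (k₀ : Fin m) (κ₀ : ℤ) (z : ℂ) : ℂ := (z - a k₀) ^ κ₀

lemma gauge_ne {k₀ : Fin m} {z : ℂ} (hz : ∀ k, z ≠ a k) : gauge a k₀ κ₀ z ≠ 0 :=
  zpow_ne_zero _ (sub_ne_zero.2 (hz k₀))

/-- The logarithmic derivative is `κ₀ / (z - a k₀)`, written with denominator `nodePoly a` to match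
the coefficients of the chain. -/
lemma hasDerivAt_gauge {k₀ : Fin m} {z : ℂ} (hz : ∀ k, z ≠ a k) :
    HasDerivAt (gauge a k₀ κ₀)
      (κ₀ * (nodePolyErase a k₀).eval z * ((nodePoly a).eval z)⁻¹ * gauge a k₀ κ₀ z) z := by
  have h0 : z - a k₀ ≠ 0 := sub_ne_zero.2 (hz k₀)
  have h1 := (hasDerivAt_zpow κ₀ (z - a k₀) (Or.inl h0)).comp_sub_const z (a k₀)
  have h2 := eval_nodePoly_ne hz
  rw [nodePoly_eq k₀, Polynomial.eval_mul] at h2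
  convert! h1 using 1
  rw [gauge, zpow_sub_one₀ h0, nodePoly_eq k₀, Polynomial.eval_mul]
  have h3 := right_ne_zero_of_mul h2
  have : Polynomial.eval z (Polynomial.X - Polynomial.C (a k₀)) = z - a k₀ := by simp
  rw [this]
  field_simp

/-- A solution of the scalar equation gives a solution of the system. -/
lemma hasDerivAt_of_V {k₀ : Fin m} {y : ℂ → ℂ} {z : ℂ} (hz : ∀ k, z ≠ a k)
    (hy : AnalyticAt ℂ y z) (hV : D.V k₀ n y z = 0) (i : Fin n) :
    HasDerivAt (fun w => gauge a k₀ κ₀ w * D.V k₀ (n - 1 - i) y w)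
      (∑ j : Fin n, D.A z i j * (gauge a k₀ κ₀ z * D.V k₀ (n - 1 - j) y z)) z := by
  have h1 := (hasDerivAt_gauge (κ₀ := κ₀) (k₀ := k₀) hz).mul
    (analyticAt_jetOp D.F (D.c k₀) hy (n - 1 - i)).differentiableAt.hasDerivAt
  convert! h1 using 1
  rw [D.sum_A_mul z i (fun s => gauge a k₀ κ₀ z * D.V k₀ s y z)]
  have hl : n - 1 - (i : ℕ) < n := by have := i.2; omega
  generalize n - 1 - (i : ℕ) = l at hl ⊢
  rw [D.sum_K hl z (by rw [hV, mul_zero])]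
  have h2 := D.V_succ k₀ l y z
  have h3 := eval_nodePoly_ne hz
  have h4 : ∑ s ∈ Finset.range (l + 1), (D.K l s).eval z * (gauge a k₀ κ₀ z * D.V k₀ s y z) =
      gauge a k₀ κ₀ z * ∑ s ∈ Finset.range (l + 1), (D.K l s).eval z * D.V k₀ s y z := by
    rw [Finset.mul_sum]
    exact Finset.sum_congr rfl fun _ _ => by ring
  rw [h4]
  generalize ∑ s ∈ Finset.range (l + 1), (D.K l s).eval z * D.V k₀ s y z = S at h2 ⊢
  field_simp
  linear_combination (gauge a k₀ κ₀ z) * h2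

/-- A solution of the system comes from a solution of the scalar equation. -/
lemma V_of_hasDerivAt {k₀ : Fin m} {u : Fin n → ℂ → ℂ} {z₀ : ℂ} (hz₀ : ∀ k, z₀ ≠ a k) (hn : 0 < n)
    (hu : ∀ᶠ z in 𝓝 z₀, ∀ i, HasDerivAt (u i) (∑ j, D.A z i j * u j z) z) {l : ℕ} (hl : l ≤ n) :
    ∀ᶠ z in 𝓝 z₀, D.V k₀ l (fun w => (gauge a k₀ κ₀ w)⁻¹ * u ⟨n - 1, Nat.sub_lt hn one_pos⟩ w) z =
      if h : l < n then (gauge a k₀ κ₀ z)⁻¹ * u ⟨n - 1 - l, by omega⟩ z else 0 := by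
  revert l
  have hza : ∀ᶠ z in 𝓝 z₀, ∀ k, z ≠ a k := eventually_all.2 fun k => isOpen_ne.mem_nhds (hz₀ k)
  set y := fun w => (gauge a k₀ κ₀ w)⁻¹ * u ⟨n - 1, Nat.sub_lt hn one_pos⟩ w with hy
  -- The components counted from the last one, continued by zero at `l = n`; one induction then
  -- treats the intermediate components and the final equation `V n y = 0` alike.
  set x : ℕ → ℂ → ℂ := fun l z => if h : l < n then u ⟨n - 1 - l, by omega⟩ z else 0 with hx
  have hxi : ∀ (i : Fin n) z, u i z = x (n - 1 - i) z := by
    intro i z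
    have := i.2
    simp only [hx, dif_pos (show n - 1 - (i : ℕ) < n by omega)]
    congr 1
    exact Fin.ext (by simp; omega)
  have hxd : ∀ᶠ z in 𝓝 z₀, ∀ l < n, HasDerivAt (x l)
      (((nodePoly a).eval z)⁻¹ * (∑ s ∈ Finset.range (l + 1), (D.K l s).eval z * x s z
        + D.β l * x (l + 1) z)) z := by
    filter_upwards [hu] with z hz l hl
    have h1 := hz ⟨n - 1 - l, by omega⟩
    have h2 : ∑ j, D.A z ⟨n - 1 - l, by omega⟩ j * u j z =
        ∑ j : Fin n, D.A z ⟨n - 1 - l, by omega⟩ j * x (n - 1 - j) z :=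
      Finset.sum_congr rfl fun j _ => by rw [hxi]
    rw [h2, D.sum_A_mul z _ (fun s => x s z), Fin.val_mk, show n - 1 - (n - 1 - l) = l by omega,
      D.sum_K hl z (by simp [hx])] at h1
    simpa only [hx, dif_pos hl] using h1
  intro l hl
  suffices h : ∀ᶠ z in 𝓝 z₀, D.V k₀ l y z = (gauge a k₀ κ₀ z)⁻¹ * x l z by
    filter_upwards [h] with z hz
    rw [hz]
    simp only [hx]
    split_ifs <;> simp
  induction l using Nat.strong_induction_on with
  | _ l ih =>
    cases l with
    | zero =>
      refine Eventually.of_forall fun z => ?_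
      simp only [V, jetOp_zero, hy, hx, dif_pos hn, Nat.sub_zero]
    | succ l =>
      have h1 : ∀ᶠ w in 𝓝 z₀, ∀ s ∈ Finset.range (l + 1),
          D.V k₀ s y w = (gauge a k₀ κ₀ w)⁻¹ * x s w :=
        (Filter.eventually_all_finset _).2 fun s hs =>
          ih s (Finset.mem_range.1 hs) (by have := Finset.mem_range.1 hs; omega)
      have h2 : D.V k₀ l y =ᶠ[𝓝 z₀] fun w => (gauge a k₀ κ₀ w)⁻¹ * x l w :=
        ih l (by omega) (by omega)
      filter_upwards [h1, h2.eventuallyEq_nhds, hza, hxd] with z e1 e2 hz e3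
      have hg := gauge_ne (κ₀ := κ₀) (k₀ := k₀) hz
      have h3 := D.V_succ k₀ l y z
      have h4 := ((hasDerivAt_gauge (κ₀ := κ₀) (k₀ := k₀) hz).fun_inv hg).fun_mul (e3 l (by omega))
      rw [e2.deriv_eq, h4.deriv] at h3
      have h5 : ∑ s ∈ Finset.range (l + 1), (D.K l s).eval z * D.V k₀ s y z =
          (gauge a k₀ κ₀ z)⁻¹ * ∑ s ∈ Finset.range (l + 1), (D.K l s).eval z * x s z := by
        rw [Finset.mul_sum]
        exact Finset.sum_congr rfl fun s hs => by rw [e1 s hs]; ring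
      rw [h5, e1 l (by simp)] at h3
      have hP := eval_nodePoly_ne hz
      apply mul_left_cancel₀ (D.β_ne l)
      rw [h3]
      generalize ∑ s ∈ Finset.range (l + 1), (D.K l s).eval z * x s z = S
      field_simp
      ring

end Gauge

/-! ### Residues and local forms at the nodes -/

section LocalBehaviour

variable {m : ℕ} {a : Fin m → ℂ} {n : ℕ} {κ₀ : ℤ} (D : HessData a n κ₀)

/-- The matrix `w A(a k + w)`, extended to `w = 0`. -/
noncomputable def B (k : Fin m) (w : ℂ) : Matrix (Fin n) (Fin n) ℂ :=
  Matrix.of fun i j => (D.K (n - 1 - i) (n - 1 - j)).eval (a k + w)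
    / (nodePolyErase a k).eval (a k + w)

lemma B_zero (k : Fin m) : D.B k 0 = D.residue k := by
  ext i j
  simp [B, residue]

lemma analyticAt_B (ha : Function.Injective a) (k : Fin m) : AnalyticAt ℂ (D.B k) 0 := by
  rw [analyticAt_matrix_iff]
  intro i j
  have h : ∀ p : Polynomial ℂ, AnalyticAt ℂ (fun w => p.eval (a k + w)) 0 := fun p =>
    AnalyticAt.aeval_polynomial (f := fun w => a k + w) (by fun_prop) p
  refine (h _).div (h _) ?_
  rw [add_zero]
  exact eval_nodePolyErase_self ha k

lemma exp_smul_A (k : Fin m) (ζ : ℂ) : exp ζ • D.A (a k + exp ζ) = D.B k (exp ζ) := by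
  ext i j
  have h : (nodePoly a).eval (a k + exp ζ)
      = exp ζ * (nodePolyErase a k).eval (a k + exp ζ) := by
    rw [nodePoly_eq k]; simp
  rw [Matrix.smul_apply, A_apply, h, B, Matrix.of_apply, smul_eq_mul, mul_inv, ← mul_assoc,
    mul_inv_cancel_left₀ (exp_ne_zero ζ)]
  rw [div_eq_inv_mul]

/-- The solution space near a singular point with nonresonant residue. -/
lemma localForm (ha : Function.Injective a) {k : Fin m} (hR : NonResonant (D.residue k))
    {E X : Matrix (Fin n) (Fin n) ℂ} (hX : IsUnit X) (hXE : D.residue k * X = X * E) :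
    LocalForm a D.A k E := by
  rw [← B_zero] at hR hXE
  obtain ⟨ε₁, hε₁, Z, hZ, hZd⟩ := exists_local_solution (D.analyticAt_B ha k) hR
  obtain ⟨ε₂, hε₂, hε₂a⟩ : ∃ ε > 0, ∀ j, j ≠ k → ε ≤ ‖a j - a k‖ := by
    have : ∀ᶠ ε in 𝓝[>] (0 : ℝ), ∀ j, j ≠ k → ε ≤ ‖a j - a k‖ := by
      refine eventually_all.2 fun j => ?_
      by_cases hj : j = k
      · exact Eventually.of_forall fun _ h => absurd hj h
      · have : 0 < ‖a j - a k‖ := norm_pos_iff.2 (sub_ne_zero.2 fun h => hj (ha h))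
        filter_upwards [Ioo_mem_nhdsGT this] with ε hε _
        exact hε.2.le
    obtain ⟨ε, h1, h2⟩ := (this.and self_mem_nhdsWithin).exists
    exact ⟨ε, h2, h1⟩
  have hε : 0 < min ε₁ ε₂ := lt_min hε₁ hε₂
  refine ⟨min ε₁ ε₂, hε, fun j hj => (min_le_right _ _).trans (hε₂a j hj), fun Y hY => ?_⟩
  have hball : ∀ ζ : ℂ, ζ.re < Real.log (min ε₁ ε₂) → exp ζ ∈ ball (0 : ℂ) ε₁ := fun ζ hζ =>
    mem_ball_zero_iff.2 (((norm_exp_lt_iff hε).2 hζ).trans_le (min_le_left _ _))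
  have hdX : X.det ≠ 0 := ((Matrix.isUnit_iff_isUnit_det _).1 hX).ne_zero
  have hexp : ∀ ζ : ℂ, NormedSpace.exp (ζ • D.B k 0) * X = X * NormedSpace.exp (ζ • E) := by
    intro ζ
    have := exp_smul_mul_of_sq (sub_eq_zero.2 hXE) (by simp) ζ
    simpa using this
  obtain ⟨C, hC⟩ := exists_eq_mul_of_solves (D := {ζ : ℂ | ζ.re < Real.log (min ε₁ ε₂)})
    (A := fun ξ => D.B k (exp ξ)) (Ψ := fun ζ => Z (exp ζ) * NormedSpace.exp (ζ • D.B k 0)) (Y := Y)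
    (isOpen_lt continuous_re continuous_const) (convex_halfSpace_re_lt _).isPreconnected
    (fun ζ hζ => ⟨by
      rw [Matrix.det_mul]
      exact mul_ne_zero (hZ _ (hball ζ hζ)).1 (det_exp_ne_zero _),
      local_solution_solves (hZd _ (hball ζ hζ))⟩)
    (fun ζ hζ => by
      have := (hY ζ hζ).2
      simp only [SolvesSystemAt, exp_smul_A] at this ⊢
      exact this)
  have hCdet : C.det ≠ 0 := by
    obtain ⟨ζ, hζ⟩ : ∃ ζ : ℂ, ζ.re < Real.log (min ε₁ ε₂) :=
      ⟨((Real.log (min ε₁ ε₂) - 1 : ℝ) : ℂ), by rw [ofReal_re]; linarith⟩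
    have h1 := (hY ζ hζ).1
    rw [hC ζ hζ, Matrix.det_mul] at h1
    exact right_ne_zero_of_mul h1
  have hC' : (X⁻¹ * C).det ≠ 0 := by
    rw [Matrix.det_mul, Matrix.det_nonsing_inv, Ring.inverse_eq_inv']
    exact mul_ne_zero (inv_ne_zero hdX) hCdet
  -- Since `exp(ζR) X = X exp(ζE)`, the solution `Z exp(ζR) C` equals `(Z X) exp(ζE) (X⁻¹ C)`.
  refine ⟨fun z => Z (z - a k) * X, Matrix.GeneralLinearGroup.mkOfDetNeZero _ hC',
    fun z hz => ⟨?_, ?_⟩, fun ζ hζ => ?_⟩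
  · have : z - a k ∈ ball (0 : ℂ) ε₁ := by
      rw [mem_ball_zero_iff, ← dist_eq_norm]
      exact (mem_ball.1 hz).trans_le (min_le_left _ _)
    rw [Matrix.det_mul]
    exact mul_ne_zero (hZ _ this).1 hdX
  · have : z - a k ∈ ball (0 : ℂ) ε₁ := by
      rw [mem_ball_zero_iff, ← dist_eq_norm]
      exact (mem_ball.1 hz).trans_le (min_le_left _ _)
    refine analyticAt_matrix_iff.1 (AnalyticAt.mul ?_ analyticAt_const)
    exact AnalyticAt.fun_comp (g := Z) (hZ _ this).2 (by fun_prop)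
  · rw [hC ζ hζ]
    change _ = Z (a k + exp ζ - a k) * X * NormedSpace.exp (ζ • E) * (X⁻¹ * C)
    rw [add_sub_cancel_left, mul_assoc (Z _) X, ← hexp, ← mul_assoc _ X⁻¹, ← mul_assoc (Z _),
      mul_assoc _ X, Matrix.mul_nonsing_inv _ hdX.isUnit, mul_one]

/-- The residue is similar to the local exponent matrix. -/
lemma residue_conj (ha : Function.Injective a) {k : Fin m} {E : Matrix (Fin n) (Fin n) ℂ}
    (hE : LocalForm a D.A k E) {W : ℂ → Matrix (Fin n) (Fin n) ℂ}
    (hW : ∀ ζ ∈ loopDomain a k, (W ζ).det ≠ 0 ∧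
        SolvesSystemAt (fun ξ => exp ξ • D.A (a k + exp ξ)) W ζ) :
    ∃ X : Matrix (Fin n) (Fin n) ℂ, IsUnit X ∧ D.residue k * X = X * E := by
  obtain ⟨ε, hε, hεa, hY⟩ := hE
  obtain ⟨Z, C, hZ, hWZ⟩ := hY W fun ζ hζ => hW ζ fun j hj => by
    rw [← Complex.norm_exp]
    exact ((norm_exp_lt_iff hε).2 hζ).trans_le (hεa j hj)
  have hak : a k ∈ ball (a k) ε := mem_ball_self hε
  refine ⟨Z (a k), (Matrix.isUnit_iff_isUnit_det _).2 (hZ _ hak).1.isUnit, ?_⟩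
  have hZan : ∀ z ∈ ball (a k) ε, AnalyticAt ℂ Z z := fun z hz => analyticAt_matrix_iff.2
      (hZ z hz).2
  obtain ⟨Z', hZ'c, hZ'⟩ : ∃ Z' : ℂ → Matrix (Fin n) (Fin n) ℂ, ContinuousAt Z' (a k) ∧
      ∀ z ∈ ball (a k) ε, HasDerivAt Z (Z' z) z :=
    ⟨deriv Z, (hZan _ hak).deriv.continuousAt, fun z hz => (hZan z hz).differentiableAt.hasDerivAt⟩
  -- Differentiating the local form and cancelling its invertible right factor gives an identity
  -- between single-valued functions. As `w → 0` the term with the derivative disappears and `B(0)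
  -- Z(a k) = Z(a k) E` remains.
  have key : ∀ w, w ≠ 0 → ‖w‖ < ε →
      D.B k w * Z (a k + w) = w • Z' (a k + w) + Z (a k + w) * E := by
    intro w hw0 hw
    have hζ : (log w).re < Real.log ε := by rw [← norm_exp_lt_iff hε, exp_log hw0]; exact hw
    set ζ := log w with hζdef
    have hexp : exp ζ = w := exp_log hw0
    have h1 := solvesSystemAt_iff.1 (hW ζ fun j hj => by
      rw [← Complex.norm_exp]
      exact ((norm_exp_lt_iff hε).2 hζ).trans_le (hεa j hj)).2
    have hmem : a k + exp ζ ∈ ball (a k) ε := by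
      rw [hexp, mem_ball, dist_eq_norm, add_sub_cancel_left]; exact hw
    have h2 : HasDerivAt (fun ξ => Z (a k + exp ξ) * NormedSpace.exp (ξ • E) *
        (C : Matrix (Fin n) (Fin n) ℂ)) ((exp ζ • Z' (a k + exp ζ) * NormedSpace.exp (ζ • E) +
          Z (a k + exp ζ) * (E * NormedSpace.exp (ζ • E))) * C) ζ :=
      (((hZ' _ hmem).scomp ζ ((Complex.hasDerivAt_exp ζ).const_add (a k))).mul
        (hasDerivAt_exp_smul E ζ)).mul_const _
    have hev : W =ᶠ[𝓝 ζ] fun ξ => Z (a k + exp ξ) * NormedSpace.exp (ξ • E) *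
        (C : Matrix (Fin n) (Fin n) ℂ) := by
      filter_upwards [(isOpen_lt continuous_re continuous_const).mem_nhds hζ] with ξ hξ
      exact hWZ ξ hξ
    have h3 := (h1.congr_of_eventuallyEq hev.symm).unique h2
    rw [exp_smul_A, hWZ ζ hζ, hexp] at h3
    have hu : IsUnit (NormedSpace.exp (ζ • E) * (C : Matrix (Fin n) (Fin n) ℂ)) :=
      (Matrix.isUnit_exp _).mul C.isUnit
    refine hu.mul_right_cancel ?_
    calc _ = D.B k w * (Z (a k + w) * NormedSpace.exp (ζ • E) * C) := by noncomm_ring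
      _ = _ := h3
      _ = _ := by noncomm_ring
  have hadd : Tendsto (fun w => a k + w) (𝓝[≠] 0) (𝓝 (a k)) := by
    have : ContinuousAt (fun w => a k + w) 0 := by fun_prop
    simpa using this.tendsto.mono_left nhdsWithin_le_nhds
  have hZlim := (hZan _ hak).continuousAt.tendsto.comp hadd
  have hBlim := (D.analyticAt_B ha k).continuousAt.tendsto.mono_left
    (nhdsWithin_le_nhds (s := {0}ᶜ))
  have hwlim : Tendsto (fun w : ℂ => w) (𝓝[≠] 0) (𝓝 0) := nhdsWithin_le_nhds
  have l1 := hBlim.mul hZlim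
  have l2 := (hwlim.smul (hZ'c.tendsto.comp hadd)).add (hZlim.mul_const E)
  rw [zero_smul, zero_add] at l2
  rw [← B_zero]
  refine tendsto_nhds_unique (l1.congr' ?_) l2
  filter_upwards [self_mem_nhdsWithin, nhdsWithin_le_nhds (ball_mem_nhds 0 hε)] with w hw0 hw
  exact key w hw0 (mem_ball_zero_iff.1 hw)

end LocalBehaviour

end HessData

end StdForm

end

section

open Complex Metric Filter Topology
open scoped Matrix.Norms.Operator

namespace StdForm

namespace HessData

/-! ### The solutions at infinity -/

section Infinity

variable {m : ℕ} {a : Fin m → ℂ} {n : ℕ} {κ₀ : ℤ} (D : HessData a n κ₀)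

/-- The regular parts at infinity of the coefficients `K`. -/
noncomputable def regPart (l s : ℕ) : Polynomial ℂ :=
  if s ≤ l then D.G l s else if s = l + 1 then Polynomial.C (D.β l) else 0

/-- The coefficient matrix at infinity of the system for `Z∞`, as a function of `ξ = 1 / z`. -/
noncomputable def N (κ : Fin n → ℤ) (ξ : ℂ) : Matrix (Fin n) (Fin n) ℂ :=
  Matrix.of fun i j => ((revNodePoly Finset.univ a).eval ξ)⁻¹ *
    ((if i = j then (κ i : ℂ) * ((revNodePoly Finset.univ a).eval ξ - 1) else 0) -
      ξ * (D.regPart (n - 1 - i) (n - 1 - j)).eval ξ)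

lemma eval_revNodePoly_zero (s : Finset (Fin m)) : (revNodePoly s a).eval 0 = 1 := by
  simp [revNodePoly, Polynomial.eval_prod]

lemma N_zero (κ : Fin n → ℤ) : D.N κ 0 = 0 := by
  ext i j
  simp [N, eval_revNodePoly_zero]

lemma analyticAt_N (κ : Fin n → ℤ) : AnalyticAt ℂ (D.N κ) 0 := by
  rw [analyticAt_matrix_iff]
  intro i j
  have h : ∀ p : Polynomial ℂ, AnalyticAt ℂ (fun w => p.eval w) 0 := fun p =>
    AnalyticAt.aeval_polynomial (f := id) analyticAt_id p
  refine ((h _).inv (by simp [eval_revNodePoly_zero])).mul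
      (AnalyticAt.sub ?_ (analyticAt_id.mul (h _)))
  split_ifs
  · exact analyticAt_const.mul ((h _).sub analyticAt_const)
  · exact analyticAt_const

/-- For `Y = diag(z^κ_i) W(1/z)` the system becomes `ξ W' = N W` with `N = diag(κ_i) - z ·
diag(z^(-κ_i)) A diag(z^κ_j)`. The gaps `m - 2` between the indices match the degree bounds exactly,
so the powers of `ξ` combine to a factor `ξ` and `N` vanishes at `ξ = 0`. -/
lemma N_eq (hm : 0 < m) {κ : Fin n → ℤ}
    (hκ : ∀ i : Fin n, κ i = κ₀ + (n - 1 - i : ℕ) * ((m : ℤ) - 2)) {ξ : ℂ} (hξ : ξ ≠ 0)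
    (hP : (revNodePoly Finset.univ a).eval ξ ≠ 0) (i j : Fin n) :
    D.N κ ξ i j = (if i = j then (κ i : ℂ) else 0) - ξ ^ (κ i - κ j - 1) * D.A ξ⁻¹ i j := by
  have hi := i.2
  have hj := j.2
  have hA : D.A ξ⁻¹ i j = ξ ^ m * ((revNodePoly Finset.univ a).eval ξ)⁻¹ *
      (D.K (n - 1 - i) (n - 1 - j)).eval ξ⁻¹ := by
    rw [A_apply, eval_nodePoly, eval_revNodePoly _ hξ, Finset.card_univ, Fintype.card_fin, mul_inv,
      mul_inv_cancel_left₀ (pow_ne_zero _ hξ)]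
  have hij : i = j ↔ n - 1 - (j : ℕ) = n - 1 - (i : ℕ) := by rw [Fin.ext_iff]; omega
  have hl : n - 1 - (i : ℕ) < n := by omega
  have hs : n - 1 - (j : ℕ) < n := by omega
  rw [hA, N, Matrix.of_apply, hκ i, hκ j, regPart]
  simp only [hij]
  generalize n - 1 - (i : ℕ) = l at *
  generalize n - 1 - (j : ℕ) = s at *
  have e0 : κ₀ + (l : ℤ) * ((m : ℤ) - 2) - (κ₀ + (s : ℤ) * ((m : ℤ) - 2)) - 1 =
    ((l : ℤ) - s) * ((m : ℤ) - 2) - 1 := by ring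
  rw [e0]
  set P := (revNodePoly Finset.univ a).eval ξ
  by_cases h1 : s ≤ l
  · rw [if_pos h1, D.G_spec l hl s h1 ξ hξ]
    have e1 : ξ ^ (((l : ℤ) - s) * ((m : ℤ) - 2) - 1) * (ξ ^ m *
        ξ ^ (-(((m : ℤ) - 2) * (1 + (l : ℤ) - s)))) = ξ := by
      rw [← zpow_natCast ξ m, ← zpow_add₀ hξ, ← zpow_add₀ hξ]
      rw [show ((l : ℤ) - s) * ((m : ℤ) - 2) - 1 + (m + -(((m : ℤ) - 2) * (1 + (l : ℤ) - s))) = 1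
        by ring, zpow_one]
    by_cases h2 : s = l
    · subst h2
      have e2 : ξ ^ (((s : ℤ) - s) * ((m : ℤ) - 2) - 1) * (ξ ^ m * ξ⁻¹ ^ (m - 1)) = 1 := by
        obtain ⟨m', rfl⟩ : ∃ m', m = m' + 1 := ⟨m - 1, by omega⟩
        rw [sub_self, zero_mul, zero_sub, zpow_neg_one, pow_succ, add_tsub_cancel_right, inv_pow]
        field_simp
      simp only [if_true]
      field_simp at e1 e2 ⊢
      push_cast
      linear_combination (κ₀ + s * ((m : ℂ) - 2)) * e2 + Polynomial.eval ξ (D.G s s) * e1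
    · simp only [if_neg h2]
      field_simp
      linear_combination Polynomial.eval ξ (D.G l s) * e1
  · have h3 : s ≠ l := by rintro rfl; exact h1 le_rfl
    simp only [if_neg h1, if_neg h3]
    by_cases h2 : s = l + 1
    · subst h2
      rw [if_pos rfl, D.K_super l hs]
      have e1 : ξ ^ (((l : ℤ) - (l + 1 : ℕ)) * ((m : ℤ) - 2) - 1) * ξ ^ m = ξ := by
        rw [← zpow_natCast ξ m, ← zpow_add₀ hξ]
        rw [show ((l : ℤ) - (l + 1 : ℕ)) * ((m : ℤ) - 2) - 1 + m = 1 by push_cast; ring, zpow_one]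
      simp only [Polynomial.eval_C]
      linear_combination P⁻¹ * D.β l * e1
    · rw [if_neg h2, D.K_zero l s (by omega)]
      simp

lemma nonResonant_zero : NonResonant (0 : Matrix (Fin n) (Fin n) ℂ) := by
  rcases Nat.eq_zero_or_pos n with rfl | hn
  · intro s hs
    rw [spectrum.of_subsingleton] at hs
    exact hs.elim
  · have : NeZero n := ⟨hn.ne'⟩
    intro s hs t ht d hd
    rw [spectrum.zero_eq, Set.mem_singleton_iff] at hs ht
    rw [hs, ht, sub_zero] at hd
    exact_mod_cast hd.symm

/-- A fundamental solution at infinity. -/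
lemma exists_solution_infinity (hm : 0 < m) {κ : Fin n → ℤ}
    (hκ : ∀ i : Fin n, κ i = κ₀ + (n - 1 - i : ℕ) * ((m : ℤ) - 2)) :
    ∃ R > 0, (∀ k, ‖a k‖ ≤ R) ∧ ∃ W : ℂ → Matrix (Fin n) (Fin n) ℂ,
      (∀ ξ ∈ ball (0 : ℂ) R⁻¹, (W ξ).det ≠ 0 ∧ AnalyticAt ℂ W ξ) ∧
      ∀ ζ : ℂ, Real.log R < ζ.re →
        (Matrix.diagonal (fun i => exp ζ ^ κ i) * W (exp ζ)⁻¹).det ≠ 0 ∧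
        SolvesSystemAt (fun ξ => exp ξ • D.A (exp ξ))
          (fun ξ => Matrix.diagonal (fun i => exp ξ ^ κ i) * W (exp ξ)⁻¹) ζ := by
  obtain ⟨ε, hε, W, hW, hWd⟩ := exists_local_solution (D.analyticAt_N κ)
    (by rw [N_zero]; exact nonResonant_zero)
  rw [N_zero] at hWd
  obtain ⟨R, hR, hRε, hRa⟩ : ∃ R > 0, R⁻¹ ≤ ε ∧ ∀ k, ‖a k‖ ≤ R := by
    have h1 : ∀ᶠ R : ℝ in atTop, ∀ k, ‖a k‖ ≤ R := eventually_all.2 fun k => eventually_ge_atTop _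
    obtain ⟨R, h1, h2⟩ := (h1.and (eventually_ge_atTop ε⁻¹)).exists
    exact ⟨R, (inv_pos.2 hε).trans_le h2, inv_le_of_inv_le₀ hε h2, h1⟩
  refine ⟨R, hR, hRa, W, fun ξ hξ => hW ξ (ball_subset_ball hRε hξ), fun ζ hζ => ?_⟩
  have hnorm : R < ‖exp ζ‖ := by rwa [Complex.norm_exp, ← Real.log_lt_iff_lt_exp hR]
  set z := exp ζ with hz
  have hz0 : z ≠ 0 := exp_ne_zero ζ
  have hzb : z⁻¹ ∈ ball (0 : ℂ) R⁻¹ := by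
    rw [mem_ball_zero_iff, norm_inv]
    exact inv_strictAnti₀ hR hnorm
  have hP : (revNodePoly Finset.univ a).eval z⁻¹ ≠ 0 := by
    rw [eval_revNodePoly _ (inv_ne_zero hz0), inv_inv]
    refine mul_ne_zero (pow_ne_zero _ (inv_ne_zero hz0)) (Finset.prod_ne_zero_iff.2 fun k _ => ?_)
    rw [sub_ne_zero]
    intro h
    exact absurd (hRa k) (not_le.2 (h ▸ hnorm))
  refine ⟨?_, fun i j => ?_⟩
  · rw [Matrix.det_mul, Matrix.det_diagonal]
    exact mul_ne_zero (Finset.prod_ne_zero_iff.2 fun i _ => zpow_ne_zero _ hz0)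
      (hW _ (ball_subset_ball hRε hzb)).1
  · obtain ⟨W', hW', hWeq⟩ := hWd _ (ball_subset_ball hRε hzb)
    have h1 := hasDerivAt_matrix_iff.1 hW' i j
    have h2 : HasDerivAt (fun ξ => exp ξ ^ κ i) (κ i * z ^ κ i) ζ := by
      have := (hasDerivAt_zpow (κ i) z (Or.inl hz0)).comp ζ (Complex.hasDerivAt_exp ζ)
      convert! this using 1
      rw [zpow_sub_one₀ hz0, ← hz]
      field_simp
    have h3 : HasDerivAt (fun ξ => (exp ξ)⁻¹) (-z⁻¹) ζ := by
      have := (Complex.hasDerivAt_exp ζ).fun_inv hz0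
      convert! this using 1
      rw [← hz]
      field_simp
    have h4 : HasDerivAt (fun ξ => W (exp ξ)⁻¹ i j) (W' i j * -z⁻¹) ζ :=
      HasDerivAt.comp (h₂ := fun w => W w i j) ζ h1 h3
    simp only [Matrix.diagonal_mul]
    convert! h2.mul h4 using 1
    have h5 := congrFun (congrFun hWeq i) j
    simp only [Matrix.smul_apply, mul_zero, sub_zero, smul_eq_mul, Matrix.mul_apply] at h5
    rw [Matrix.mul_apply]
    simp only [Matrix.smul_apply, smul_eq_mul, Matrix.diagonal_mul]
    rw [show W' i j * -z⁻¹ = -(z⁻¹ * W' i j) by ring, h5]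
    have h6 : ∀ l, D.N κ z⁻¹ i l * W z⁻¹ l j = (if i = l then κ i * W z⁻¹ l j else 0) -
        (z ^ κ i)⁻¹ * (z * D.A z i l * (z ^ κ l * W z⁻¹ l j)) := by
      intro l
      rw [D.N_eq hm hκ (inv_ne_zero hz0) hP, inv_inv]
      have : z⁻¹ ^ (κ i - κ l - 1) = (z ^ κ i)⁻¹ * z * z ^ κ l := by
        rw [inv_zpow', show -(κ i - κ l - 1) = -κ i + 1 + κ l by ring, zpow_add₀ hz0,
          zpow_add_one₀ hz0, zpow_neg]
      rw [this]
      split_ifs <;> ring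
    simp only [h6, Finset.sum_sub_distrib, Finset.sum_ite_eq, Finset.mem_univ, if_true,
      ← Finset.mul_sum]
    have := zpow_ne_zero (κ i) hz0
    field_simp
    ring

lemma apparentAtInfinity (hm : 0 < m) {κ : Fin n → ℤ}
    (hκ : ∀ i : Fin n, κ i = κ₀ + (n - 1 - i : ℕ) * ((m : ℤ) - 2)) :
    ApparentAtInfinity a D.A := by
  obtain ⟨R, hR, hRa, W, hW, hWs⟩ := D.exists_solution_infinity hm hκ
  refine ⟨R, hR, hRa, fun Y hY ζ hζ => ?_⟩
  obtain ⟨C, hC⟩ := exists_eq_mul_of_solves (D := {ζ : ℂ | Real.log R < ζ.re})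
    (isOpen_lt continuous_const continuous_re) (convex_halfSpace_re_gt _).isPreconnected
    (fun ζ hζ => hWs ζ hζ) (fun ζ hζ => (hY ζ hζ).2)
  rw [hC ζ hζ, hC _ (by simpa using hζ)]
  -- The fundamental solution depends on `ζ` only through `exp ζ`.
  simp only [Complex.exp_periodic ζ]

lemma formAtInfinity (hm : 0 < m) {κ : Fin n → ℤ}
    (hκ : ∀ i : Fin n, κ i = κ₀ + (n - 1 - i : ℕ) * ((m : ℤ) - 2)) :
    FormAtInfinity a D.A κ := by
  obtain ⟨R, hR, hRa, W, hW, hWs⟩ := D.exists_solution_infinity hm hκ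
  refine ⟨R, hR, hRa, fun Y hY => ?_⟩
  have hnorm : ∀ ζ : ℂ, Real.log R < ζ.re → R < ‖exp ζ‖ := fun ζ hζ => by
    rwa [Complex.norm_exp, ← Real.log_lt_iff_lt_exp hR]
  obtain ⟨C, hC⟩ := exists_eq_mul_of_solves (D := {ζ : ℂ | Real.log R < ζ.re})
    (Y := fun ζ => Y (exp ζ))
    (isOpen_lt continuous_const continuous_re) (convex_halfSpace_re_gt _).isPreconnected
    (fun ζ hζ => hWs ζ hζ) (fun ζ hζ => by
      have := (solvesSystemAt_iff.1 (hY _ (hnorm ζ hζ)).2).scomp ζ (Complex.hasDerivAt_exp ζ)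
      rw [solvesSystemAt_iff, smul_mul_assoc]
      exact this)
  have hCdet : C.det ≠ 0 := by
    obtain ⟨ζ, hζ⟩ : ∃ ζ : ℂ, Real.log R < ζ.re :=
      ⟨((Real.log R + 1 : ℝ) : ℂ), by rw [ofReal_re]; linarith⟩
    have h1 := (hY _ (hnorm ζ hζ)).1
    rw [hC ζ hζ, Matrix.det_mul] at h1
    exact right_ne_zero_of_mul h1
  refine ⟨W, Matrix.GeneralLinearGroup.mkOfDetNeZero C hCdet,
    fun ξ hξ => ⟨(hW ξ hξ).1, analyticAt_matrix_iff.1 (hW ξ hξ).2⟩, fun z hz => ?_⟩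
  have hz0 : z ≠ 0 := norm_pos_iff.1 (hR.trans hz)
  have := hC (log z) (by
    rw [Set.mem_ofPred_eq, log_re]
    exact Real.log_lt_log hR hz)
  simp only [exp_log hz0] at this
  exact this

end Infinity

end HessData

end StdForm

end

section

open Complex Metric Filter Topology

namespace StdForm

/-! ### Entire functions of polynomial growth -/

section Growth

open Polynomial

/-- Passing to `(f(z) - f(0)) / z` lowers the growth by one degree. For `k = 0` the function tends
to zero at infinity and vanishes by Liouville's theorem. -/
lemma exists_polynomial_of_growth_nat {f g : ℂ → ℂ} (hf : Differentiable ℂ f)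
    (hg : ContinuousAt g 0) (k : ℕ) (h : ∀ᶠ ξ in 𝓝[≠] (0 : ℂ), f ξ⁻¹ = ξ ^ (1 - (k : ℤ)) * g ξ) :
    ∃ p : ℂ[X], p.degree < k ∧ ∀ z, f z = p.eval z := by
  induction k generalizing f g with
  | zero =>
    refine ⟨0, by simp, fun z => ?_⟩
    rw [eval_zero]
    refine hf.apply_eq_of_tendsto_cocompact z ?_
    have h1 : Tendsto (fun ξ => f ξ⁻¹) (𝓝[≠] 0) (𝓝 0) := by
      have h2 : Tendsto (fun ξ => ξ * g ξ) (𝓝[≠] 0) (𝓝 0) := by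
        have : ContinuousAt (fun ξ => ξ * g ξ) 0 := continuousAt_id.mul hg
        simpa using this.tendsto.mono_left (nhdsWithin_le_nhds (s := {0}ᶜ))
      refine h2.congr' ?_
      filter_upwards [h] with ξ hξ
      rw [hξ]; simp
    rw [← Metric.cobounded_eq_cocompact]
    have h3 := h1.comp (tendsto_inv₀_cobounded' (α := ℂ))
    refine h3.congr fun z => ?_
    simp
  | succ k ih =>
    have hd : Differentiable ℂ (dslope f 0) := by
      rw [← differentiableOn_univ]
      exact (Complex.differentiableOn_dslope Filter.univ_mem).2 hf.differentiableOn
    obtain ⟨p, hp, hfp⟩ := ih (g := fun ξ => g ξ - ξ ^ k * f 0) hd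
      (hg.sub (by fun_prop)) (by
        filter_upwards [h, self_mem_nhdsWithin] with ξ hξ hξ0
        have hξ0' : ξ ≠ 0 := hξ0
        rw [dslope_of_ne _ (inv_ne_zero hξ0'), slope_def_field, hξ, sub_zero, div_inv_eq_mul,
          show (1 : ℤ) - ((k + 1 : ℕ) : ℤ) = -k by push_cast; ring, zpow_sub₀ hξ0', zpow_neg,
          zpow_natCast, zpow_one]
        field_simp)
    refine ⟨C (f 0) + X * p, ?_, fun z => ?_⟩
    · refine (degree_add_le _ _).trans_lt (max_lt ?_ ?_)
      · exact degree_C_le.trans_lt (by exact_mod_cast Nat.succ_pos k)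
      · rcases eq_or_ne p 0 with rfl | hp0
        · simp
        · rw [degree_mul, degree_X, degree_eq_natDegree hp0, add_comm]
          rw [degree_eq_natDegree hp0] at hp
          have : p.natDegree < k := by exact_mod_cast hp
          exact_mod_cast Nat.succ_lt_succ this
    · have := sub_smul_dslope f 0 z
      rw [hfp, sub_zero, smul_eq_mul] at this
      rw [eval_add, eval_C, eval_mul, eval_X, this]
      ring

/-- An entire function with at most a pole at infinity is a polynomial. -/
lemma exists_polynomial_of_growth {f g : ℂ → ℂ} (hf : Differentiable ℂ f) (hg : ContinuousAt g 0)
    {d : ℤ} (h : ∀ᶠ ξ in 𝓝[≠] (0 : ℂ), f ξ⁻¹ = ξ ^ (-d) * g ξ) :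
    ∃ p : ℂ[X], DegLE d p ∧ ∀ z, f z = p.eval z := by
  rcases lt_or_ge d 0 with hd | hd
  · obtain ⟨e, rfl⟩ : ∃ e : ℕ, d = -(e + 1) := ⟨(-d - 1).toNat, by omega⟩
    obtain ⟨p, hp, hfp⟩ := exists_polynomial_of_growth_nat (g := fun ξ => ξ ^ e * g ξ) hf
      (ContinuousAt.mul (by fun_prop) hg) 0 (by
        filter_upwards [h, self_mem_nhdsWithin] with ξ hξ hξ0
        rw [hξ, neg_neg, zpow_add_one₀ hξ0]
        simp only [zpow_natCast, Nat.cast_zero, sub_zero, zpow_one]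
        ring)
    refine ⟨p, Or.inl ?_, hfp⟩
    rw [← degree_eq_bot]
    by_contra h0
    rw [degree_eq_natDegree fun h => h0 (degree_eq_bot.2 h)] at hp
    exact absurd (by exact_mod_cast hp) (Nat.not_lt_zero p.natDegree)
  · lift d to ℕ using hd
    obtain ⟨p, hp, hfp⟩ := exists_polynomial_of_growth_nat hf hg (d + 1) (by
      filter_upwards [h] with ξ hξ
      rw [hξ]
      congr 2
      push_cast
      ring)
    refine ⟨p, ?_, hfp⟩
    rcases eq_or_ne p 0 with h0 | h0
    · exact Or.inl h0
    · rw [degree_eq_natDegree h0] at hp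
      have : p.natDegree < d + 1 := by exact_mod_cast hp
      exact Or.inr (by exact_mod_cast Nat.lt_succ_iff.1 this)

lemma DegLE.exists_reverse {d : ℤ} {p : ℂ[X]} (hp : DegLE d p) :
    ∃ G : ℂ[X], ∀ ξ : ℂ, ξ ≠ 0 → p.eval ξ⁻¹ = ξ ^ (-d) * G.eval ξ := by
  rcases hp with rfl | hp
  · exact ⟨0, fun ξ _ => by simp⟩
  · lift d to ℕ using (Int.natCast_nonneg _).trans hp
    refine ⟨∑ i ∈ Finset.range (d + 1), C (p.coeff i) * X ^ (d - i), fun ξ hξ => ?_⟩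
    rw [eval_eq_sum_range' (Nat.lt_succ_of_le (by exact_mod_cast hp)), eval_finsetSum,
        Finset.mul_sum]
    refine Finset.sum_congr rfl fun i hi => ?_
    obtain ⟨e, rfl⟩ : ∃ e, d = i + e := ⟨d - i, by have := Finset.mem_range.1 hi; omega⟩
    simp only [eval_mul, eval_C, eval_pow, eval_X, add_tsub_cancel_left, zpow_neg, zpow_natCast,
        inv_pow]
    field_simp
    ring

end Growth

/-! ### Hessenberg data from matrix entries and back -/

section Construction

open Polynomial

variable {m : ℕ} {a : Fin m → ℂ} {n : ℕ}

/-- The Hessenberg data with given polynomials on and below the diagonal. -/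
noncomputable def HessData.ofEntries (a : Fin m → ℂ) (n : ℕ) (κ₀ : ℤ) (β : ℕ → ℂ)
    (hβ : ∀ l, β l ≠ 0)
    (p : ℕ → ℕ → ℂ[X]) (hp : ∀ l < n, ∀ s ≤ l, DegLE (((m : ℤ) - 2) * (1 + l - s)) (p l s)) :
    HessData a n κ₀ where
  β := β
  β_ne := hβ
  K l s := if s ≤ l then (if s = l then C ((κ₀ + l * ((m : ℤ) - 2) : ℤ) : ℂ) * X ^ (m - 1) else 0)
    + p l s else if s = l + 1 then C (β l) else 0
  K_zero l s h := by rw [if_neg (by omega), if_neg (by omega)]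
  K_super l _ := by rw [if_neg (by omega), if_pos rfl]
  G l s := if h : l < n ∧ s ≤ l then (hp l h.1 s h.2).exists_reverse.choose else 0
  G_spec l hl s hs ξ hξ := by
    rw [dif_pos ⟨hl, hs⟩, if_pos hs, eval_add,
      (hp l hl s hs).exists_reverse.choose_spec ξ hξ]
    congr 1
    split_ifs <;> simp

/-- The prescribed differences telescope from the last index upwards. -/
lemma index_eq (hn : 0 < n) {κ : Fin n → ℤ}
    (hκm : ∀ i j : Fin n, (j : ℕ) = (i : ℕ) + 1 → κ i - κ j = (m : ℤ) - 2) (i : Fin n) :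
    κ i = κ ⟨n - 1, Nat.sub_lt hn Nat.one_pos⟩ + (n - 1 - i : ℕ) * ((m : ℤ) - 2) := by
  obtain ⟨i, hi⟩ := i
  obtain ⟨d, hd⟩ : ∃ d, d = n - 1 - i := ⟨_, rfl⟩
  induction d generalizing i with
  | zero =>
    have : i = n - 1 := by omega
    subst this
    simp
  | succ d ih =>
    have h1 := ih (i + 1) (by omega) (by omega)
    have h2 := hκm ⟨i, hi⟩ ⟨i + 1, by omega⟩ rfl
    simp only at h1 ⊢
    rw [← hd]
    rw [show n - 1 - (i + 1) = d by omega] at h1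
    push_cast
    linarith

lemma HessData.hasHessenbergForm_ofEntries {κ₀ : ℤ} {κ : Fin n → ℤ}
    (hκ : ∀ i : Fin n, κ i = κ₀ + (n - 1 - i : ℕ) * ((m : ℤ) - 2)) {β : ℕ → ℂ} (hβ : ∀ l, β l ≠ 0)
    {p : ℕ → ℕ → ℂ[X]} (hp : ∀ l < n, ∀ s ≤ l, DegLE (((m : ℤ) - 2) * (1 + l - s)) (p l s)) :
    HasHessenbergForm a κ (HessData.ofEntries a n κ₀ β hβ p hp).A := by
  -- The place `(j + 1, j)` becomes `(l, l + 1)` with `l = n - 2 - j` when rows and columns are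
  -- counted from the end.
  refine ⟨fun j => β (n - 2 - j), fun i j => p (n - 1 - i) (n - 1 - j), fun j _ => hβ _,
    fun i j hij => ?_, fun z _ i j => ?_⟩
  · have hi := i.2
    have hj := j.2
    have hij' : (i : ℕ) ≤ j := hij
    convert! hp (n - 1 - i) (by omega) (n - 1 - j) (by omega) using 2
    omega
  · have hi := i.2
    have hj := j.2
    rw [HessData.A, Matrix.of_apply]
    congr 1
    simp only [ofEntries, Fin.ext_iff, Fin.lt_def]
    rcases lt_trichotomy (i : ℕ) j with h | h | h
    · simp [show n - 1 - (j : ℕ) ≤ n - 1 - i by omega, show n - 1 - (j : ℕ) ≠ n - 1 - i by omega,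
        h, h.ne]
    · simp [h, hκ]
    · simp only [if_neg (show ¬ n - 1 - (j : ℕ) ≤ n - 1 - i by omega), if_neg h.ne', if_neg
        h.not_gt,
        show n - 1 - (j : ℕ) = n - 1 - i + 1 ↔ (i : ℕ) = j + 1 by omega]
      split_ifs with h'
      · rw [eval_C]
        congr 1
        omega
      · rw [eval_zero]

lemma HasHessenbergForm.exists_hessData (hn : 0 < n) {κ : Fin n → ℤ} {κ₀ : ℤ}
    (hκ : ∀ i : Fin n, κ i = κ₀ + (n - 1 - i : ℕ) * ((m : ℤ) - 2))
    {A : ℂ → Matrix (Fin n) (Fin n) ℂ} (hA : HasHessenbergForm a κ A) :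
    ∃ D : HessData a n κ₀, ∀ z, (∀ k, z ≠ a k) → A z = D.A z := by
  obtain ⟨α, p, hα, hp, hA⟩ := hA
  have hp' : ∀ l < n, ∀ s ≤ l, DegLE (((m : ℤ) - 2) * (1 + l - s))
      (p ⟨n - 1 - l, by omega⟩ ⟨n - 1 - s, by omega⟩) := fun l hl s hs => by
    convert! hp ⟨n - 1 - l, _⟩ ⟨n - 1 - s, _⟩ (Fin.mk_le_mk.2 (by omega)) using 2
    dsimp only
    push_cast [show l ≤ n - 1 by omega, show s ≤ n - 1 by omega]
    ring
  -- Beyond the subdiagonal any nonzero value serves; `1` only normalises the last operator of the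
  -- chain.
  have hβ : ∀ l, (if h : l + 1 < n then α ⟨n - 2 - l, by omega⟩ else 1) ≠ 0 := fun l => by
    split_ifs with h
    · exact hα _ (by dsimp only; omega)
    · exact one_ne_zero
  refine ⟨HessData.ofEntries a n κ₀ _ hβ (fun l s => p ⟨n - 1 - l, by omega⟩ ⟨n - 1 - s, by omega⟩)
      hp', fun z hz => ?_⟩
  · ext i j
    have hi := i.2
    have hj := j.2
    have e : ∀ i : Fin n, (⟨n - 1 - (n - 1 - i), by omega⟩ : Fin n) = i := fun i =>
      Fin.ext (by have := i.2; dsimp only; omega)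
    rw [hA z hz, HessData.A, Matrix.of_apply]
    congr 1
    simp only [HessData.ofEntries, Fin.ext_iff, Fin.lt_def, e]
    rcases lt_trichotomy (i : ℕ) j with h | h | h
    · simp [show n - 1 - (j : ℕ) ≤ n - 1 - i by omega, show n - 1 - (j : ℕ) ≠ n - 1 - i by omega,
        h, h.ne]
    · simp [h, hκ]
    · simp only [if_neg (show ¬ n - 1 - (j : ℕ) ≤ n - 1 - i by omega), if_neg h.ne', if_neg
        h.not_gt,
        show n - 1 - (j : ℕ) = n - 1 - i + 1 ↔ (i : ℕ) = j + 1 by omega]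
      split_ifs with h' h''
      · rw [eval_C]
        congr 1
        exact Fin.ext (by dsimp only; omega)
      · omega
      · rw [eval_zero]

lemma HessData.analyticAt_A {κ₀ : ℤ} (D : HessData a n κ₀) {z : ℂ} (hz : ∀ k, z ≠ a k)
    (i j : Fin n) :
    AnalyticAt ℂ (fun w => D.A w i j) z := by
  simp only [HessData.A_apply]
  exact ((AnalyticAt.aeval_polynomial (f := id) analyticAt_id _).inv (eval_nodePoly_ne hz)).mul
    (AnalyticAt.aeval_polynomial (f := id) analyticAt_id _)

end Construction

end StdForm

end

section

open Complex Metric Filter Topology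

namespace StdForm

/-! ### Comparing the sheets of a function on the covering -/

section Sheets

variable {m : ℕ} {a : Fin m → ℂ} {x₀ : PSphere a} {α : Type*} {f : Cover a x₀ → α}

/-- The straight path between two points of a convex set without singularities. -/
lemma exists_path_of_convex {B : Set ℂ} (hB : Convex ℝ B) (hBa : ∀ u ∈ B, ∀ k, u ≠ a k)
    {z w : PPlane a} (hz : z.1 ∈ B) (hw : w.1 ∈ B) :
    ∃ c : Path z.toSphere w.toSphere, ∀ t, ∃ u ∈ B, (c t).1 = ((u : ℂ) : OnePoint ℂ) := by
  set p := convexPath hB ⟨z.1, hz⟩ ⟨w.1, hw⟩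
  have hφ : Continuous fun u : B => (⟨u.1, hBa u.1 u.2⟩ : PPlane a) :=
    continuous_subtype_val.subtype_mk _
  exact ⟨p.map (continuous_toSphere.comp hφ), fun t => ⟨(p t).1, (p t).2, rfl⟩⟩

lemma IsSheetOf.mono {x : Cover a x₀} {r r' : ℝ} {F : ℂ → α} (h : IsSheetOf f x r F) (hr : r' ≤ r) :
    IsSheetOf f x r' F := fun w c hc =>
  h w c fun t => (hc t).imp fun _ hu => ⟨ball_subset_ball hr hu.1, hu.2⟩

lemma IsSheetOf.apply_self {x : Cover a x₀} {r : ℝ} {F : ℂ → α} (h : IsSheetOf f x r F)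
    (hr : 0 < r) :
    f x = F x.proj := by
  have := h x.1 (Path.refl _) fun _ => ⟨x.proj, mem_ball_self hr, rfl⟩
  rw [Path.Homotopic.Quotient.mk_refl, Path.Homotopic.Quotient.trans_refl] at this
  exact this

lemma mem_ball_of_path {x : Cover a x₀} {r : ℝ} {w : PPlane a} {c : Path x.1.toSphere w.toSphere}
    (hc : ∀ t, ∃ u ∈ ball x.proj r, (c t).1 = ((u : ℂ) : OnePoint ℂ)) : w.1 ∈ ball x.proj r := by
  obtain ⟨u, hu, hu'⟩ := hc 1
  rw [c.target] at hu'
  rwa [show w.1 = u from OnePoint.coe_injective hu']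

lemma IsSheetOf.restrict {x : Cover a x₀} {r r' : ℝ} {F : ℂ → α} (h : IsSheetOf f x r F)
    {w : PPlane a} {c : Path x.1.toSphere w.toSphere}
    (hc : ∀ t, ∃ u ∈ ball x.proj r, (c t).1 = ((u : ℂ) : OnePoint ℂ))
    (hr' : ball w.1 r' ⊆ ball x.proj r) :
    IsSheetOf f ⟨w, x.2.trans (Path.Homotopic.Quotient.mk c)⟩ r' F := by
  intro w' d hd
  have := h w' (c.trans d) fun t => by
    have ht : (c.trans d) t ∈ Set.range c ∪ Set.range d := by
      rw [← Path.trans_range]; exact ⟨t, rfl⟩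
    rcases ht with ⟨s, hs⟩ | ⟨s, hs⟩
    · rw [← hs]; exact hc s
    · rw [← hs]; exact (hd s).imp fun _ hu => ⟨hr' hu.1, hu.2⟩
  rw [Path.Homotopic.Quotient.mk_trans, ← Path.Homotopic.Quotient.trans_assoc] at this
  exact this

lemma eventually_ne_nodes (z : PPlane a) : ∀ᶠ u in 𝓝 z.1, ∀ k, u ≠ a k :=
  eventually_all.2 fun k => isOpen_ne.mem_nhds (z.2 k)

lemma exists_ball_ne_nodes (z : PPlane a) : ∃ δ > 0, ∀ u ∈ ball z.1 δ, ∀ k, u ≠ a k :=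
  Metric.eventually_nhds_iff_ball.1 (eventually_ne_nodes z)

/-- In a small disc free of nodes every point is reached from the centre by a segment, and both
functions give the value of `f` at the end of it. -/
lemma IsSheetOf.eventuallyEq {x : Cover a x₀} {r r' : ℝ} {F F' : ℂ → α} (h : IsSheetOf f x r F)
    (h' : IsSheetOf f x r' F') (hr : 0 < r) (hr' : 0 < r') : F =ᶠ[𝓝 x.proj] F' := by
  obtain ⟨δ, hδ, hδa⟩ := exists_ball_ne_nodes x.1
  have hρ : 0 < min δ (min r r') := lt_min hδ (lt_min hr hr')
  filter_upwards [ball_mem_nhds x.proj hρ] with u hu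
  have hsub := fun v (hv : v ∈ ball x.proj (min δ (min r r'))) k =>
    hδa v (ball_subset_ball (min_le_left _ _) hv) k
  obtain ⟨c, hc⟩ := exists_path_of_convex (z := x.1) (w := ⟨u, hsub u hu⟩)
    (convex_ball x.proj (min δ (min r r'))) hsub (mem_ball_self hρ) hu
  rw [← (h.mono ((min_le_right _ _).trans (min_le_left _ _))) _ c hc,
    ← (h'.mono ((min_le_right _ _).trans (min_le_right _ _))) _ c hc]

/-- Deck transformations put a loop in front and sheets append a path at the end; the two operations
commute by associativity. -/
lemma IsSheetOf.deck {x : Cover a x₀} {r : ℝ} {F : ℂ → α} (ℓ : Path.Homotopic.Quotient x₀ x₀)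
    (h : IsSheetOf f (deck ℓ x) r F) : IsSheetOf (fun x => f (StdForm.deck ℓ x)) x r F := by
  intro w c hc
  have := h w c hc
  simp only [StdForm.deck] at this ⊢
  rw [← Path.Homotopic.Quotient.trans_assoc]
  exact this

lemma IsSheetOf.comp {β : Type*} {x : Cover a x₀} {r : ℝ} {F : ℂ → α} (h : IsSheetOf f x r F)
    (g : ℂ → α → β) : IsSheetOf (fun x => g x.proj (f x)) x r (fun w => g w (F w)) := fun w c hc =>
  congrArg (g w.1) (h w c hc)

end Sheets

end StdForm

end

section

open Complex Metric Filter Topology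
open scoped Matrix.Norms.Operator

namespace StdForm

/-! ### From the system to the scalar equation -/

section SystemToScalar

variable {m : ℕ} {a : Fin m → ℂ} {x₀ : PSphere a} {n : ℕ} {κ₀ : ℤ}

/-- The small circle starts at a finite point, to which the path `c` leads. Such a point is needed
to test linear independence. -/
lemma GoesOnceAround.nonempty_cover {k : Fin m} {ℓ : Path.Homotopic.Quotient x₀ x₀}
    (hℓ : GoesOnceAround a x₀ k ℓ) : Nonempty (Cover a x₀) := by
  obtain ⟨r, -, -, b, c, d, hd, -⟩ := hℓ
  obtain ⟨z, hz⟩ : ∃ z : PPlane a, z.toSphere = b := by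
    have h0 := hd 0
    rw [Path.source] at h0
    exact ⟨⟨_, fun k h => b.2 k (by rw [h0, h])⟩, Subtype.ext h0.symm⟩
  subst hz
  exact ⟨⟨z, Path.Homotopic.Quotient.mk c⟩⟩

lemma IsSystemSolution.exists_sheet {A A' : ℂ → Matrix (Fin n) (Fin n) ℂ}
    {Y : Cover a x₀ → Matrix (Fin n) (Fin n) ℂ} (hY : IsSystemSolution a x₀ A Y)
    (hA : ∀ z, (∀ k, z ≠ a k) → A z = A' z) (x : Cover a x₀) :
    ∃ r > 0, (∀ w ∈ ball x.proj r, ∀ k, w ≠ a k) ∧ ∃ F : ℂ → Matrix (Fin n) (Fin n) ℂ,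
      (∀ w ∈ ball x.proj r, SolvesSystemAt A' F w) ∧ IsSheetOf Y x r F := by
  obtain ⟨-, r, hr, F, hF, hs⟩ := hY x
  obtain ⟨δ, hδ, hδa⟩ := exists_ball_ne_nodes x.1
  have h1 : ∀ w ∈ ball x.proj (min r δ), ∀ k, w ≠ a k := fun w hw =>
    hδa w (ball_subset_ball (min_le_right _ _) hw)
  refine ⟨min r δ, lt_min hr hδ, h1, F, fun w hw => ?_, hs.mono (min_le_left _ _)⟩
  have h2 := hF w (ball_subset_ball (min_le_left _ _) hw)
  rw [solvesSystemAt_iff, hA w (h1 w hw)] at h2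
  exact solvesSystemAt_iff.2 h2

variable (D : HessData a n κ₀)

lemma HessData.eventually_V_of_solves {k₀ : Fin m} (hn : 0 < n) {z : ℂ} {r : ℝ}
    (hr : ∀ w ∈ ball z r, ∀ k, w ≠ a k) {F : ℂ → Matrix (Fin n) (Fin n) ℂ}
    (hF : ∀ w ∈ ball z r, SolvesSystemAt D.A F w) {w : ℂ} (hw : w ∈ ball z r) (b : Fin n → ℂ)
    {l : ℕ} (hl : l ≤ n) :
    ∀ᶠ u in 𝓝 w, D.V k₀ l (fun v => (gauge a k₀ κ₀ v)⁻¹ *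
        ∑ j, b j * F v ⟨n - 1, Nat.sub_lt hn one_pos⟩ j) u =
      if h : l < n then (gauge a k₀ κ₀ u)⁻¹ * ∑ j, b j * F u ⟨n - 1 - l, by omega⟩ j else 0 := by
  refine D.V_of_hasDerivAt (u := fun i v => ∑ j, b j * F v i j) (hr w hw) hn ?_ hl
  filter_upwards [isOpen_ball.mem_nhds hw] with v hv i
  have h1 : HasDerivAt (fun v => ∑ j, b j * F v i j) (∑ j, b j * (D.A v * F v) i j) v :=
    HasDerivAt.fun_sum fun j _ => (hF v hv i j).const_mul (b j)
  convert! h1 using 1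
  simp only [Matrix.mul_apply, Finset.mul_sum]
  rw [Finset.sum_comm]
  exact Finset.sum_congr rfl fun _ _ => Finset.sum_congr rfl fun _ _ => by ring

/-- The last row of a solution of the system gives solutions of the scalar equation. -/
lemma HessData.scalarMonodromy (hn : 0 < n) (k₀ : Fin m) {ℓ : Fin m → Path.Homotopic.Quotient x₀ x₀}
    {A : ℂ → Matrix (Fin n) (Fin n) ℂ} (hA : ∀ z, (∀ k, z ≠ a k) → A z = D.A z)
    {M : Fin m → Matrix (Fin n) (Fin n) ℂ} (hne : Nonempty (Cover a x₀))
    (h : SystemMonodromy a x₀ ℓ A M) : ScalarMonodromy a x₀ ℓ (D.q k₀) M := by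
  obtain ⟨Y, hY, χ, hχ, C, hC⟩ := h
  set last : Fin n := ⟨n - 1, Nat.sub_lt hn one_pos⟩
  have hgan : ∀ w, (∀ k, w ≠ a k) → AnalyticAt ℂ (fun v => (gauge a k₀ κ₀ v)⁻¹) w := fun w hw => by
    refine AnalyticAt.inv ?_ (gauge_ne hw)
    refine AnalyticAt.fun_zpow (by fun_prop) (sub_ne_zero.2 (hw k₀))
  refine ⟨fun j x => (gauge a k₀ κ₀ x.proj)⁻¹ * Y x last j, fun j x => ?_, ?_, χ, fun k x j => ?_,
    C, hC⟩
  · obtain ⟨r, hr, hra, F, hF, hs⟩ := hY.exists_sheet hA x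
    refine ⟨r, hr, fun w => (gauge a k₀ κ₀ w)⁻¹ * F w last j, fun w hw => ?_,
      hs.comp fun w y => (gauge a k₀ κ₀ w)⁻¹ * y last j⟩
    have hFan : AnalyticAt ℂ (fun w => F w last j) w := by
      have : DifferentiableOn ℂ (fun w => F w last j) (ball x.proj r) := fun w hw =>
        (hF w hw last j).differentiableAt.differentiableWithinAt
      exact this.analyticAt (isOpen_ball.mem_nhds hw)
    have han := (hgan w (hra w hw)).fun_mul hFan
    refine ⟨han, ?_⟩
    have h1 := (D.eventually_V_of_solves (k₀ := k₀) hn hra hF hw (Pi.single j 1)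
        le_rfl).self_of_nhds
    simp only [Pi.single_apply, ite_mul, one_mul, zero_mul, Finset.sum_ite_eq', Finset.mem_univ,
      if_true, lt_irrefl, dite_false] at h1
    rw [D.V_eq_scalarOp k₀ (hra w hw) han] at h1
    exact (mul_eq_zero.1 h1).resolve_left (D.eval_jetCoeff_ne k₀ (hra w hw))
  -- If a combination of the last row vanishes, then so do all operators of the chain applied to it,
  -- which are the other rows up to the gauge factor. Hence `b` lies in the kernel of the invertible
  -- matrix `Y x`.
  · rw [Fintype.linearIndependent_iff]
    intro b hb
    obtain ⟨x⟩ := hne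
    obtain ⟨r, hr, hra, F, hF, hs⟩ := hY.exists_sheet hA x
    have hx := mem_ball_self (x := x.proj) hr
    have hzero : (fun v => (gauge a k₀ κ₀ v)⁻¹ * ∑ j, b j * F v last j) =ᶠ[𝓝 x.proj]
        -- The zero function is written as an empty sum so that `jetOp_sum` shows that the chain
        -- vanishes on it.
        fun v => ∑ j ∈ (∅ : Finset (Fin n)), b j * F v last j := by
      have h1 : IsSheetOf (fun _ : Cover a x₀ => (0 : ℂ)) x r (fun _ => 0) := fun _ _ _ => rfl
      have h2 : IsSheetOf (fun _ : Cover a x₀ => (0 : ℂ)) x r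
          (fun v => (gauge a k₀ κ₀ v)⁻¹ * ∑ j, b j * F v last j) := by
        have h3 := hs.comp fun w y => (gauge a k₀ κ₀ w)⁻¹ * ∑ j, b j * y last j
        convert! h3 using 2 with x
        have h4 := congrFun hb x
        simp only [Finset.sum_apply, Pi.smul_apply, smul_eq_mul, Pi.zero_apply] at h4
        rw [← h4, Finset.mul_sum]
        exact Finset.sum_congr rfl fun _ _ => by ring
      filter_upwards [h2.eventuallyEq h1 hr hr] with v hv
      rw [hv, Finset.sum_empty]
    have hvec : Matrix.mulVec (Y x) b = 0 := by
      funext i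
      have h1 := (D.eventually_V_of_solves (k₀ := k₀) hn hra hF hx b
        (l := n - 1 - i) (by omega)).self_of_nhds
      have h0 : D.V k₀ (n - 1 - i) (fun v => (gauge a k₀ κ₀ v)⁻¹ * ∑ j, b j * F v last j) x.proj =
          0 :=
        (jetOp_congr hzero _).self_of_nhds.trans
          ((jetOp_sum D.F (D.c k₀) ∅ b (by simp) _).trans Finset.sum_empty)
      rw [dif_pos (by omega)] at h1
      replace h1 := h0.symm.trans h1
      have h2 := (mul_eq_zero.1 h1.symm).resolve_left (inv_ne_zero (gauge_ne (hra _ hx)))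
      have h3 : (⟨n - 1 - (n - 1 - i), by omega⟩ : Fin n) = i := Fin.ext (by dsimp only; omega)
      rw [h3] at h2
      rw [hs.apply_self hr, Matrix.mulVec, dotProduct, Pi.zero_apply, ← h2]
      exact Finset.sum_congr rfl fun _ _ => mul_comm _ _
    exact congrFun (Matrix.eq_zero_of_mulVec_eq_zero (hY x).1 hvec)
  · dsimp only
    rw [hχ k x, Matrix.mul_apply, Finset.mul_sum]
    exact Finset.sum_congr rfl fun i _ => (mul_assoc _ _ _).symm

/-- Only points of a punctured disc without further nodes enter the condition, so the values of `A`
at the nodes are irrelevant. -/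
lemma LocalForm.congr {A A' : ℂ → Matrix (Fin n) (Fin n) ℂ} (hA : ∀ z, (∀ k, z ≠ a k) → A z = A' z)
    {k : Fin m} {E : Matrix (Fin n) (Fin n) ℂ} (h : LocalForm a A k E) : LocalForm a A' k E := by
  obtain ⟨ε, hε, hεa, h⟩ := h
  refine ⟨ε, hε, hεa, fun Y hY => h Y fun ζ hζ => ⟨(hY ζ hζ).1, ?_⟩⟩
  have h1 : ζ ∈ loopDomain a k := fun j hj => by
    rw [← Complex.norm_exp]
    exact ((norm_exp_lt_iff hε).2 hζ).trans_le (hεa j hj)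
  have h2 := (hY ζ hζ).2
  rw [solvesSystemAt_iff] at h2 ⊢
  rwa [hA _ (add_exp_ne h1)]

lemma roots_charpoly_of_conj {R E X : Matrix (Fin n) (Fin n) ℂ} (hX : IsUnit X) (h : R * X = X * E)
    :
    R.charpoly = E.charpoly := by
  obtain ⟨X, rfl⟩ := hX
  have : R = X.1 * E * X⁻¹.1 := by
    rw [← h, mul_assoc, Units.mul_inv, mul_one]
  rw [this, Matrix.coe_units_inv]
  exact Matrix.charpoly_units_conj X E

/-- A system of standard form in Hessenberg form gives a Fuchsian equation. -/
lemma exists_scalar_of_system (hm : 0 < m) (hn : 0 < n) (ha : Function.Injective a)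
    {ℓ : Fin m → Path.Homotopic.Quotient x₀ x₀} (hℓ : ∀ k, GoesOnceAround a x₀ k (ℓ k))
    {κ : Fin n → ℤ} (hκ : ∀ i : Fin n, κ i = κ₀ + (n - 1 - i : ℕ) * ((m : ℤ) - 2))
    (k₀ : Fin m) {M E : Fin m → Matrix (Fin n) (Fin n) ℂ} {A : ℂ → Matrix (Fin n) (Fin n) ℂ}
    (hA : HasHessenbergForm a κ A) (hmon : SystemMonodromy a x₀ ℓ A M)
    (hloc : ∀ k, LocalForm a A k (E k)) :
    ∃ q : Fin n → ℂ → ℂ, IsFuchsianEquation a q (fun k => (E k).charpoly.roots.map fun e =>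
      if k = k₀ then e - (κ₀ : ℂ) else e) ∧ ScalarMonodromy a x₀ ℓ q M := by
  obtain ⟨D, hD⟩ := hA.exists_hessData hn hκ
  refine ⟨D.q k₀, ⟨fun z hz j => D.analyticAt_q k₀ hz j, fun k => ?_, D.regularAtInfinity_q k₀⟩,
    D.scalarMonodromy hn k₀ hD (hℓ ⟨0, hm⟩).nonempty_cover hmon⟩
  obtain ⟨Y, hY, -⟩ := hmon
  obtain ⟨W, hW, -⟩ := hY.exists_pullback (hℓ k)
  obtain ⟨X, hX, hXE⟩ := D.residue_conj ha ((hloc k).congr hD) (W := W) fun ζ hζ => by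
    refine ⟨(hW ζ hζ).1, ?_⟩
    have h2 := (hW ζ hζ).2
    rw [solvesSystemAt_iff] at h2 ⊢
    rwa [← hD _ (add_exp_ne hζ)]
  have h := D.fuchsianAt_q ha k₀ k
  rwa [roots_charpoly_of_conj hX hXE] at h

end SystemToScalar

end StdForm

end

section

open Complex Metric Filter Topology
open scoped Matrix.Norms.Operator

namespace StdForm

/-! ### Expanding a scalar operator in the chain -/

section LowerTerm

open Polynomial

variable {n : ℕ}

/-- The values at `z` of a matrix of polynomials. -/
noncomputable def evalMatrix (n : ℕ) (p : ℕ → ℕ → ℂ[X]) (z : ℂ) : Matrix (Fin n) (Fin n) ℂ :=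
  Matrix.of fun l j => (p l j).eval z

lemma det_evalMatrix {p : ℕ → ℕ → ℂ[X]} (hp : ∀ i j, i < j → p i j = 0) (z : ℂ) :
    (evalMatrix n p z).det = ∏ l : Fin n, (p l l).eval z := by
  refine Matrix.det_of_isLowerTriangular _ fun i j hij => ?_
  rw [evalMatrix, Matrix.of_apply, hp i j hij, eval_zero]

lemma analyticAt_vecMul_inv {S : ℂ → Matrix (Fin n) (Fin n) ℂ} {w : ℂ → Fin n → ℂ} {z : ℂ}
    (hS : ∀ i j, AnalyticAt ℂ (fun u => S u i j) z) (hw : ∀ j, AnalyticAt ℂ (fun u => w u j) z)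
    (hdet : (S z).det ≠ 0) (l : Fin n) :
    AnalyticAt ℂ (fun u => Matrix.vecMul (w u) (S u)⁻¹ l) z := by
  have h1 : AnalyticAt ℂ (fun u => (S u)⁻¹) z := by
    simp only [Matrix.nonsing_inv_eq_ringInverse]
    obtain ⟨U, hU⟩ := (Matrix.isUnit_iff_isUnit_det _).2 hdet.isUnit
    refine AnalyticAt.fun_comp (g := Ring.inverse) ?_ (analyticAt_matrix_iff.2 hS)
    rw [← hU]
    exact analyticAt_inverse U
  simp only [Matrix.vecMul, dotProduct]
  exact Finset.analyticAt_fun_sum _ fun j _ => (hw j).mul (analyticAt_matrix_iff.1 h1 j l)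

variable (F : ℕ → ℂ[X]) (c : ℕ → ℕ → ℂ[X])

/-- The coefficients of the operators `jetOp F c l`, `l < n`, in the difference of `jetOp F c n` and
a multiple of a scalar operator. -/
noncomputable def lowerTerm (q : Fin n → ℂ → ℂ) (z : ℂ) : Fin n → ℂ :=
  Matrix.vecMul (fun j : Fin n => (jetCoeff F c n j).eval z - (jetCoeff F c n n).eval z * q j.rev z)
    (evalMatrix n (jetCoeff F c) z)⁻¹

lemma det_jetCoeff {z : ℂ} (hF : ∀ l < n, (F l).eval z ≠ 0) :
    (evalMatrix n (jetCoeff F c) z).det ≠ 0 := by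
  rw [det_evalMatrix fun i j h => jetCoeff_eq_zero F c h]
  refine Finset.prod_ne_zero_iff.2 fun l _ => ?_
  rw [jetCoeff_diag, eval_prod]
  exact Finset.prod_ne_zero_iff.2 fun i hi => hF i ((Finset.mem_range.1 hi).trans l.2)

/-- The operators of order below `n` arise from the derivatives by the invertible triangular matrix
of the coefficients. After the leading terms cancel, the remainder is a row vector times the
derivatives, and the inverse matrix rewrites it in terms of the chain. -/
lemma jetOp_sub_lowerTerm (q : Fin n → ℂ → ℂ) {z : ℂ} (hF : ∀ l < n, (F l).eval z ≠ 0)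
    {y : ℂ → ℂ} (hy : AnalyticAt ℂ y z) :
    jetOp F c n y z - ∑ l : Fin n, lowerTerm F c q z l * jetOp F c l y z =
      (jetCoeff F c n n).eval z * scalarOp q y z := by
  set T := evalMatrix n (jetCoeff F c) z
  set u : Fin n → ℂ := fun j => iteratedDeriv j y z
  have h1 : ∀ l : Fin n, jetOp F c l y z = T.mulVec u l := fun l => by
    rw [jetOp_eq_sum F c hy l.2, Matrix.mulVec, dotProduct,
      ← Fin.sum_univ_eq_sum_range (fun j => (jetCoeff F c l j).eval z * iteratedDeriv j y z)]
    rfl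
  have h2 : ∑ l : Fin n, lowerTerm F c q z l * jetOp F c l y z =
      ∑ j : Fin n, ((jetCoeff F c n j).eval z - (jetCoeff F c n n).eval z * q j.rev z) * u j := by
    simp only [h1]
    change lowerTerm F c q z ⬝ᵥ T.mulVec u = _
    rw [Matrix.dotProduct_mulVec, lowerTerm, Matrix.vecMul_vecMul,
      Matrix.nonsing_inv_mul _ (det_jetCoeff F c hF).isUnit, Matrix.vecMul_one]
    rfl
  have h3 : ∑ j : Fin n, q j z * iteratedDeriv (n - 1 - (j : ℕ)) y z =
      ∑ j : Fin n, q j.rev z * u j := by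
    rw [← Equiv.sum_comp Fin.revPerm]
    refine Finset.sum_congr rfl fun j _ => ?_
    have : n - 1 - ((Fin.revPerm j : Fin n) : ℕ) = j := by
      have := j.2
      rw [Fin.revPerm_apply, Fin.val_rev]
      omega
    rw [this]
    rfl
  rw [h2, jetOp_eq_sum F c hy (Nat.lt_succ_self n), Finset.sum_range_succ, scalarOp, h3,
    ← Fin.sum_univ_eq_sum_range (fun j => (jetCoeff F c n j).eval z * iteratedDeriv j y z)]
  simp only [sub_mul, Finset.sum_sub_distrib, mul_add, Finset.mul_sum, mul_assoc]
  simp only [u]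
  ring

lemma analyticAt_eval (p : ℂ[X]) (z : ℂ) : AnalyticAt ℂ (fun u => p.eval u) z :=
  AnalyticAt.aeval_polynomial (f := id) analyticAt_id p

lemma analyticAt_lowerTerm {q : Fin n → ℂ → ℂ} {z : ℂ} (hF : ∀ l < n, (F l).eval z ≠ 0)
    (hq : ∀ j, AnalyticAt ℂ (q j) z) (l : Fin n) :
    AnalyticAt ℂ (fun u => lowerTerm F c q u l) z :=
  analyticAt_vecMul_inv (fun _ _ => analyticAt_eval _ z)
    (fun _ => (analyticAt_eval _ z).sub ((analyticAt_eval _ z).mul (hq _))) (det_jetCoeff F c hF) l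

/-- The lower terms have no singularities at the Fuchsian singularities of the scalar operator. -/
lemma exists_analyticAt_lowerTerm {b : ℂ} {G : ℕ → ℂ[X]} (hF : ∀ l < n, F l = (X - C b) * G l)
    (hG : ∀ l < n, (G l).eval b ≠ 0) {q : Fin n → ℂ → ℂ} {s : Multiset ℂ} (hq : FuchsianAt q b s)
    (l : Fin n) :
    ∃ g : ℂ → ℂ, AnalyticAt ℂ g b ∧ (fun u => lowerTerm F c q u l) =ᶠ[𝓝[≠] b] g := by
  obtain ⟨r, hr, hqr, -⟩ := hq
  set S := localCoeff b G c
  refine ⟨fun u => Matrix.vecMul (fun j : Fin n => (S n j).eval u - (S n n).eval u * r j.rev u)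
    (evalMatrix n S u)⁻¹ l, analyticAt_vecMul_inv (fun _ _ => analyticAt_eval _ b)
    (fun _ => (analyticAt_eval _ b).sub ((analyticAt_eval _ b).mul (hr _))) ?_ l, ?_⟩
  · change (evalMatrix n S b).det ≠ 0
    rw [det_evalMatrix fun i j h => localCoeff_eq_zero b G c h]
    refine Finset.prod_ne_zero_iff.2 fun l _ => ?_
    rw [localCoeff_diag, eval_prod]
    exact Finset.prod_ne_zero_iff.2 fun i hi => hG i ((Finset.mem_range.1 hi).trans l.2)
  · filter_upwards [eventually_all.2 hqr, self_mem_nhdsWithin] with u hu hub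
    have hub' : u - b ≠ 0 := sub_ne_zero.2 hub
    set d : Fin n → ℂ := fun j => (u - b) ^ (j : ℕ) with hd
    have hT : ∀ i ≤ n, ∀ j, (jetCoeff F c i j).eval u = (u - b) ^ j * (S i j).eval u :=
      fun i hi j => by
        rw [jetCoeff_eq_localCoeff b G c hF hi]; simp [S]
    -- The matrix and the row vector both carry the factor `diag((u - b)^j)` on the right, the row
    -- vector by the Fuchs condition. It cancels in the product with the inverse, and the remaining
    -- matrix is invertible at `b` itself.
    have h1 : evalMatrix n (jetCoeff F c) u = evalMatrix n S u * Matrix.diagonal d := by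
      ext i j
      rw [Matrix.mul_diagonal, evalMatrix, evalMatrix, Matrix.of_apply, Matrix.of_apply,
        hT i i.2.le, mul_comm]
    have h2 : (fun j : Fin n => (jetCoeff F c n j).eval u - (jetCoeff F c n n).eval u * q j.rev u) =
        Matrix.vecMul (fun j : Fin n => (S n j).eval u - (S n n).eval u * r j.rev u)
          (Matrix.diagonal d) := by
      funext j
      have hj := j.2
      rw [Matrix.vecMul_diagonal, hT n le_rfl, hT n le_rfl, hu, Fin.val_rev]
      have : (u - b) ^ n = (u - b) ^ (j : ℕ) * (u - b) ^ (n - (j + 1) + 1) := by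
        rw [← pow_add]; congr 1; omega
      rw [this, hd]
      field_simp
    have h3 : IsUnit (Matrix.diagonal d).det := by
      rw [Matrix.det_diagonal]
      exact (Finset.prod_ne_zero_iff.2 fun _ _ => pow_ne_zero _ hub').isUnit
    simp only [lowerTerm]
    rw [h1, h2, Matrix.mul_inv_rev, Matrix.vecMul_vecMul, ← mul_assoc, Matrix.mul_nonsing_inv _ h3,
      one_mul]

/-- The limits over punctured neighbourhoods agree with every local analytic representative, so they
glue to an entire function. -/
lemma exists_entire_extension {f : ℂ → ℂ}
    (h : ∀ z₀, ∃ g, AnalyticAt ℂ g z₀ ∧ f =ᶠ[𝓝[≠] z₀] g) :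
    ∃ H : ℂ → ℂ, Differentiable ℂ H ∧ ∀ z, ContinuousAt f z → H z = f z := by
  refine ⟨fun z => limUnder (𝓝[≠] z) f, fun z₀ => ?_, fun z hz =>
    (hz.tendsto.mono_left nhdsWithin_le_nhds).limUnder_eq⟩
  obtain ⟨g, hg, hfg⟩ := h z₀
  have h1 : ∀ᶠ z in 𝓝 z₀, limUnder (𝓝[≠] z) f = g z := by
    have h2 := eventually_nhds_nhdsWithin.2 hfg
    have h3 : ∀ᶠ z in 𝓝[≠] z₀, limUnder (𝓝[≠] z) f = g z := by
      have h4 := eventually_eventually_nhdsWithin.2 hfg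
      filter_upwards [h4, nhdsWithin_le_nhds hg.eventually_continuousAt, self_mem_nhdsWithin]
        with z e1 e2 hz
      have hz' : 𝓝[{z₀}ᶜ] z = 𝓝 z := isOpen_ne.nhdsWithin_eq hz
      rw [hz'] at e1
      have e3 : f =ᶠ[𝓝[≠] z] g := nhdsWithin_le_nhds e1
      exact ((e2.tendsto.mono_left nhdsWithin_le_nhds).congr' e3.symm).limUnder_eq
    have h5 : limUnder (𝓝[≠] z₀) f = g z₀ :=
      ((hg.continuousAt.tendsto.mono_left nhdsWithin_le_nhds).congr' hfg.symm).limUnder_eq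
    rw [eventually_nhdsWithin_iff] at h3
    filter_upwards [h3] with z hz
    by_cases hzz : z = z₀
    · rw [hzz, h5]
    · exact hz hzz
  exact (hg.congr (h1.mono fun _ h => h.symm)).differentiableAt

/-- The values `r j b` that enter the indicial polynomial are the limits of `(z - b)^(j+1) q j z`.
-/
lemma FuchsianAt.unique {q q' : Fin n → ℂ → ℂ} {b : ℂ} {s s' : Multiset ℂ} (h : FuchsianAt q b s)
    (h' : FuchsianAt q' b s') (hq : ∀ᶠ z in 𝓝[≠] b, ∀ j, q j z = q' j z) : s = s' := by
  obtain ⟨r, hr, hqr, rfl⟩ := h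
  obtain ⟨r', hr', hqr', rfl⟩ := h'
  have : ∀ j, r j b = r' j b := fun j => by
    have h1 := (hr j).continuousAt.tendsto.mono_left (nhdsWithin_le_nhds (s := {b}ᶜ))
    have h2 := (hr' j).continuousAt.tendsto.mono_left (nhdsWithin_le_nhds (s := {b}ᶜ))
    refine tendsto_nhds_unique (h1.congr' ?_) h2
    filter_upwards [hq, hqr j, hqr' j, self_mem_nhdsWithin] with z e1 e2 e3 hz
    have hz' : (z - b) ^ ((j : ℕ) + 1) ≠ 0 := pow_ne_zero _ (sub_ne_zero.2 hz)
    have e4 := e2.symm.trans ((e1 j).trans e3)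
    exact (div_left_inj' hz').1 e4
  simp only [this]

variable {F c} in
lemma jetOp_congr_coeff {F' : ℕ → ℂ[X]} {c' : ℕ → ℕ → ℂ[X]} {i : ℕ} (hF : ∀ l < i, F l = F' l)
    (hc : ∀ l < i, ∀ s ≤ l, c l s = c' l s) (y : ℂ → ℂ) : jetOp F c i y = jetOp F' c' i y := by
  induction i using Nat.strong_induction_on with
  | _ i ih =>
    cases i with
    | zero => rw [jetOp_zero, jetOp_zero]
    | succ i =>
      have h : ∀ l ≤ i, jetOp F c l y = jetOp F' c' l y := fun l hl =>
        ih l (by omega) (fun _ _ => hF _ (by omega)) fun _ _ => hc _ (by omega)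
      funext z
      rw [jetOp_succ, jetOp_succ, hF i (by omega), h i le_rfl]
      congr 1
      refine Finset.sum_congr rfl fun l hl => ?_
      have := Finset.mem_range.1 hl
      rw [hc i (by omega) l (by omega), h l (by omega)]

end LowerTerm

namespace HessData

open Polynomial

variable {m : ℕ} {a : Fin m → ℂ} {n : ℕ} {κ₀ : ℤ} (D : HessData a n κ₀)

lemma eventually_ne_nodes_inv (a : Fin m → ℂ) :
    ∀ᶠ ξ in 𝓝 (0 : ℂ), (revNodePoly Finset.univ a).eval ξ ≠ 0 := by
  refine (revNodePoly Finset.univ a).continuous.continuousAt.eventually_ne ?_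
  simp [revNodePoly, eval_prod]

lemma inv_ne_node {ξ : ℂ} (hξ : ξ ≠ 0) (h : (revNodePoly Finset.univ a).eval ξ ≠ 0) (k : Fin m) :
    ξ⁻¹ ≠ a k := by
  intro hk
  refine h ?_
  rw [eval_revNodePoly _ hξ, Finset.prod_eq_zero (Finset.mem_univ k) (by rw [hk, sub_self]),
      mul_zero]

lemma eval_Fh_ne {ξ : ℂ} (h : (revNodePoly Finset.univ a).eval ξ ≠ 0) (l : ℕ) :
    (D.Fh l).eval ξ ≠ 0 := by
  rw [Fh, eval_mul, eval_C, eval_neg]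
  exact mul_ne_zero (inv_ne_zero (D.β_ne l)) (neg_ne_zero.2 h)

/-- Regularity only says that solving the equation at a point is preserved under `z = 1/ξ`, so the
coefficient is extracted by a test function. Prescribe its values under the operators `V s` to be
`1` for `s = l`, `0` for other `s < n`, and the lower term for `s = n`. Then the equation holds at
`1/ξ`, hence the transformed one holds at `ξ`, and `V_inv` compares the two expansions. -/
lemma lowerTerm_inv (k₀ : Fin m) {q : Fin n → ℂ → ℂ} (hq : RegularAtInfinity q) (l : Fin n) :
    ∃ g : ℂ → ℂ, ContinuousAt g 0 ∧ ∀ᶠ ξ in 𝓝[≠] (0 : ℂ), lowerTerm D.F (D.c k₀) q ξ⁻¹ l =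
      ξ ^ (-(((m : ℤ) - 2) * (n - l))) * g ξ := by
  obtain ⟨r, hr, qh, hqh, hqq⟩ := hq
  refine ⟨fun ξ => lowerTerm D.Fh (D.ch k₀) qh ξ l, (analyticAt_lowerTerm D.Fh (D.ch k₀)
    (fun l _ => D.eval_Fh_ne (by simp [revNodePoly, eval_prod]) l)
    (fun j => hqh j 0 (mem_ball_self hr)) l).continuousAt, ?_⟩
  filter_upwards [nhdsWithin_le_nhds (eventually_ne_nodes_inv a),
    nhdsWithin_le_nhds (ball_mem_nhds 0 hr), self_mem_nhdsWithin] with ξ hξP hξr hξ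
  have hξ0 : ξ ≠ 0 := hξ
  have hz := inv_ne_node hξ0 hξP
  obtain ⟨y, hy, hyV⟩ := exists_jetOp_eq D.F (D.c k₀) (z := ξ⁻¹) (n := n + 1)
    (fun s _ => D.eval_F_ne s hz)
    (fun s => if s = n then lowerTerm D.F (D.c k₀) q ξ⁻¹ l else if s = l then 1 else 0)
  have hyl : ∀ s : Fin n, jetOp D.F (D.c k₀) s y ξ⁻¹ = if s = l then 1 else 0 := fun s => by
    rw [hyV s (by omega), if_neg s.2.ne]
    simp only [Fin.ext_iff]
  have hyn := hyV n (Nat.lt_succ_self n)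
  rw [if_pos rfl] at hyn
  have h1 := jetOp_sub_lowerTerm D.F (D.c k₀) q (fun s _ => D.eval_F_ne s hz) (hy ξ⁻¹)
  simp only [hyl, hyn, mul_ite, mul_one, mul_zero, Finset.sum_ite_eq', Finset.mem_univ, if_true,
    sub_self] at h1
  have h2 := (mul_eq_zero.1 h1.symm).resolve_left (D.eval_jetCoeff_ne k₀ hz)
  have h3 := (hqq ξ hξr hξ0 y (hy _)).1 h2
  have hyi : AnalyticAt ℂ (fun w => y w⁻¹) ξ := (hy _).comp (analyticAt_inv hξ0)
  have h4 := jetOp_sub_lowerTerm D.Fh (D.ch k₀) qh (fun s _ => D.eval_Fh_ne hξP s) hyi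
  rw [h3, mul_zero, D.V_inv k₀ le_rfl hξ0 (hy _)] at h4
  have h5 : ∀ s : Fin n, jetOp D.Fh (D.ch k₀) s (fun w => y w⁻¹) ξ =
      if s = l then ξ ^ ((l : ℤ) * ((m : ℤ) - 2)) else 0 := fun s => by
    rw [D.V_inv k₀ s.2.le hξ0 (hy _), show D.V k₀ s y ξ⁻¹ = _ from hyl s]
    split_ifs with h
    · rw [h, mul_one]
    · rw [mul_zero]
  simp only [h5, hyn, mul_ite, mul_zero, Finset.sum_ite_eq', Finset.mem_univ, if_true] at h4
  have h6 : ξ ^ ((n : ℤ) * ((m : ℤ) - 2)) =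
      ξ ^ (((m : ℤ) - 2) * (n - l)) * ξ ^ ((l : ℤ) * ((m : ℤ) - 2)) := by
    rw [← zpow_add₀ hξ0]; congr 1; ring
  rw [h6] at h4
  have h7 := zpow_ne_zero ((l : ℤ) * ((m : ℤ) - 2)) hξ0
  have h8 := zpow_ne_zero (((m : ℤ) - 2) * (n - l)) hξ0
  rw [zpow_neg, eq_inv_mul_iff_mul_eq₀ h8]
  apply mul_right_cancel₀ h7
  linear_combination h4

/-- The Fuchs conditions remove the singularities at the nodes, and regularity at infinity bounds
the growth of the resulting entire function. -/
lemma exists_polynomial_lowerTerm (ha : Function.Injective a) (k₀ : Fin m) {q : Fin n → ℂ → ℂ}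
    {s : Fin m → Multiset ℂ} (hq : IsFuchsianEquation a q s) (l : Fin n) :
    ∃ p : ℂ[X], DegLE (((m : ℤ) - 2) * (n - l)) p ∧
      ∀ z, (∀ k, z ≠ a k) → lowerTerm D.F (D.c k₀) q z l = p.eval z := by
  have han : ∀ z, (∀ k, z ≠ a k) → AnalyticAt ℂ (fun u => lowerTerm D.F (D.c k₀) q u l) z :=
    fun z hz => analyticAt_lowerTerm _ _ (fun s _ => D.eval_F_ne s hz) (hq.analytic z hz) l
  obtain ⟨H, hH, hHf⟩ := exists_entire_extension (f := fun u => lowerTerm D.F (D.c k₀) q u l)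
    fun z => by
      by_cases hz : ∀ k, z ≠ a k
      · exact ⟨_, han z hz, EventuallyEq.rfl⟩
      · push Not at hz
        obtain ⟨k, rfl⟩ := hz
        refine exists_analyticAt_lowerTerm D.F (D.c k₀)
            (G := fun l => C (D.β l)⁻¹ * nodePolyErase a k)
          (fun l _ => by rw [F, nodePoly_eq k]; ring) (fun l _ => ?_) (hq.fuchsian k) l
        rw [eval_mul, eval_C]
        exact mul_ne_zero (inv_ne_zero (D.β_ne l)) (eval_nodePolyErase_self ha k)
  obtain ⟨g, hg, hgH⟩ := D.lowerTerm_inv k₀ hq.regular l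
  obtain ⟨p, hp, hHp⟩ := exists_polynomial_of_growth hH hg (d := ((m : ℤ) - 2) * (n - l)) (by
    filter_upwards [hgH, nhdsWithin_le_nhds (eventually_ne_nodes_inv a), self_mem_nhdsWithin]
      with ξ h1 h2 hξ
    rw [hHf _ (han _ (inv_ne_node hξ h2)).continuousAt, h1])
  exact ⟨p, hp, fun z hz => by rw [← hHp, hHf z (han z hz).continuousAt]⟩

end HessData

/-! ### A Hessenberg system for a given equation -/

section ScalarToHess

open Polynomial

variable {m : ℕ} {a : Fin m → ℂ} {n : ℕ} {κ₀ : ℤ}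

lemma eq_of_scalarOp_eq {q q' : Fin n → ℂ → ℂ} {z : ℂ}
    (h : ∀ y, AnalyticAt ℂ y z → scalarOp q y z = scalarOp q' y z) (j : Fin n) : q j z = q' j z :=
        by
  obtain ⟨y, hy, hyj⟩ := exists_jet z n fun i => if i = n - 1 - j then 1 else 0
  have h1 := h y (hy z)
  have h2 : ∀ i : Fin n, iteratedDeriv (n - 1 - (i : ℕ)) y z = if i = j then 1 else 0 := fun i => by
    have hi := i.2
    have hj := j.2
    rw [hyj _ (by omega)]
    simp only [Fin.ext_iff, show n - 1 - (i : ℕ) = n - 1 - j ↔ (i : ℕ) = j by omega]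
  simpa [scalarOp, h2] using h1

/-- A Fuchsian equation is the equation of the last component of a Hessenberg system. -/
lemma exists_hessData_of_scalar (hn : 0 < n) (ha : Function.Injective a) (k₀ : Fin m)
    {κ : Fin n → ℤ} (hκ : ∀ i : Fin n, κ i = κ₀ + (n - 1 - i : ℕ) * ((m : ℤ) - 2))
    {q : Fin n → ℂ → ℂ} {s : Fin m → Multiset ℂ} (hq : IsFuchsianEquation a q s) :
    ∃ D : HessData a n κ₀, HasHessenbergForm a κ D.A ∧
      ∀ z, (∀ k, z ≠ a k) → ∀ j, q j z = D.q k₀ j z := by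
  set D₀ := HessData.ofEntries a n κ₀ (fun _ => 1) (fun _ => one_ne_zero) (fun _ _ => 0)
    (fun _ _ _ _ => Or.inl rfl) with hD₀
  choose H hHdeg hH using D₀.exists_polynomial_lowerTerm ha k₀ hq
  -- The polynomials enter only the row `l = n - 1`, the first row of the matrix, as in a companion
  -- matrix. They change `V n` but none of the lower operators in which the equation was expanded.
  set p : ℕ → ℕ → ℂ[X] := fun l s => if h : l + 1 = n ∧ s < n then H ⟨s, h.2⟩ else 0 with hp
  have hpdeg : ∀ l < n, ∀ s ≤ l, DegLE (((m : ℤ) - 2) * (1 + l - s)) (p l s) := by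
    intro l hl s hs
    simp only [hp]
    split_ifs with h
    · convert! hHdeg ⟨s, h.2⟩ using 2
      dsimp only
      omega
    · exact Or.inl rfl
  set D := HessData.ofEntries a n κ₀ (fun _ => 1) (fun _ => one_ne_zero) p hpdeg with hD
  refine ⟨D, HessData.hasHessenbergForm_ofEntries hκ _ hpdeg, fun z hz => ?_⟩
  have hF : D.F = D₀.F := rfl
  have hc : ∀ l, ∀ s ≤ l, D.c k₀ l s = D₀.c k₀ l s - p l s := by
    intro l s hs
    simp only [HessData.c, hD, hD₀, HessData.ofEntries, if_pos hs]
    simp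
    ring
  have hV : ∀ l < n, ∀ y, D.V k₀ l y = D₀.V k₀ l y := fun l hl y =>
    jetOp_congr_coeff (fun _ _ => rfl) (fun i hi s hs => by
      rw [hc i s hs]
      simp only [hp]
      rw [dif_neg (by omega), sub_zero]) y
  refine eq_of_scalarOp_eq fun y hy => ?_
  have h1 := jetOp_sub_lowerTerm D₀.F (D₀.c k₀) q (fun l _ => D₀.eval_F_ne l hz) hy
  have h2 := D.V_eq_scalarOp k₀ hz hy
  have h3 : D.V k₀ n y z = D₀.V k₀ n y z - ∑ l : Fin n, lowerTerm D₀.F (D₀.c k₀) q z l * D₀.V k₀ l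
      y z := by
    obtain ⟨n', rfl⟩ : ∃ n', n = n' + 1 := ⟨n - 1, by omega⟩
    rw [HessData.V, HessData.V, jetOp_succ, jetOp_succ, hF]
    have e1 := hV n' (Nat.lt_succ_self _) y
    rw [HessData.V, HessData.V, hF] at e1
    rw [e1, Finset.sum_range, Finset.sum_range, add_sub_assoc, ← Finset.sum_sub_distrib]
    congr 1
    refine Finset.sum_congr rfl fun l _ => ?_
    have e2 := hV l l.2 y
    rw [HessData.V, HessData.V, hF] at e2
    rw [hc n' l (by omega), e2, hH _ z hz, eval_sub]
    simp only [hp, dif_pos (show n' + 1 = n' + 1 ∧ (l : ℕ) < n' + 1 from ⟨rfl, l.2⟩)]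
    ring
  have h4 : (jetCoeff D.F (D.c k₀) n n).eval z = (jetCoeff D₀.F (D₀.c k₀) n n).eval z := by
    rw [jetCoeff_diag, jetCoeff_diag, hF]
  rw [h3, h4] at h2
  exact mul_left_cancel₀ (D₀.eval_jetCoeff_ne k₀ hz) (h1.symm.trans h2)

end ScalarToHess

end StdForm

end

section

open Complex Metric Filter Topology

namespace StdForm

/-! ### From solutions of the equation to a fundamental matrix -/

section ScalarToSystem

variable {m : ℕ} {a : Fin m → ℂ} {x₀ : PSphere a} {n : ℕ} {κ₀ : ℤ} (D : HessData a n κ₀)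

lemma eventually_eq_zero_of_iteratedDeriv {y : ℂ → ℂ} {z : ℂ} (hy : AnalyticAt ℂ y z)
    (h : ∀ j, iteratedDeriv j y z = 0) : ∀ᶠ w in 𝓝 z, y w = 0 := by
  have h1 := hy.hasFPowerSeriesAt
  have h2 : (FormalMultilinearSeries.ofScalars ℂ fun j => iteratedDeriv j y z / (j.factorial : ℂ))
      = 0 := by
    ext j
    simp [h]
  rw [h2] at h1
  exact h1.eventually_eq_zero

/-- Uniqueness for the scalar equation: the chain is prolonged beyond `n` by plain differentiation,
so all its operators vanish on `y` at `z`. By triangularity all derivatives of `y` vanish there,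
hence so does its Taylor series. -/
lemma HessData.eventually_eq_zero_of_V {k₀ : Fin m} {y : ℂ → ℂ} {z : ℂ} (hz : ∀ k, z ≠ a k)
    (hy : AnalyticAt ℂ y z) (hV : ∀ᶠ w in 𝓝 z, D.V k₀ n y w = 0) (h0 : ∀ l < n, D.V k₀ l y z = 0) :
    ∀ᶠ w in 𝓝 z, y w = 0 := by
  set F : ℕ → Polynomial ℂ := fun l => if l < n then D.F l else 1 with hF
  set c : ℕ → ℕ → Polynomial ℂ := fun l s => if l < n then D.c k₀ l s else 0 with hc
  have h1 : ∀ l ≤ n, jetOp F c l y = D.V k₀ l y := fun l hl =>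
    jetOp_congr_coeff (fun i hi => if_pos (hi.trans_le hl))
        (fun i hi s _ => if_pos (hi.trans_le hl)) y
  have h2 : ∀ d, ∀ᶠ w in 𝓝 z, jetOp F c (n + d) y w = 0 := by
    intro d
    induction d with
    | zero => rw [add_zero, h1 n le_rfl]; exact hV
    | succ d ih =>
      filter_upwards [ih.eventually_nhds] with w hw
      have hw' : jetOp F c (n + d) y =ᶠ[𝓝 w] fun _ => 0 := hw
      rw [← add_assoc, jetOp_succ, hw'.deriv_eq, deriv_const, mul_zero, zero_add]
      refine Finset.sum_eq_zero fun s _ => ?_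
      simp [hc]
  have h3 : ∀ l, jetOp F c l y z = 0 := fun l => by
    rcases lt_or_ge l n with hl | hl
    · rw [h1 l hl.le, h0 l hl]
    · obtain ⟨d, rfl⟩ := Nat.exists_eq_add_of_le hl
      exact (h2 d).self_of_nhds
  refine eventually_eq_zero_of_iteratedDeriv hy fun j =>
    iteratedDeriv_eq_zero_of_jetOp F c hy (n := j + 1) (fun l _ => ?_) (fun l _ => h3 l) j
      (Nat.lt_succ_self j)
  simp only [hF]
  split_ifs
  · exact D.eval_F_ne l hz
  · simp

lemma exists_common_radius {ι : Type*} [Finite ι] {r : ι → ℝ} (hr : ∀ i, 0 < r i) :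
    ∃ ρ > 0, ∀ i, ρ ≤ r i := by
  have : ∀ᶠ ρ in 𝓝[>] (0 : ℝ), ∀ i, ρ ≤ r i := eventually_all.2 fun i => by
    filter_upwards [Ioo_mem_nhdsGT (hr i)] with ρ hρ using hρ.2.le
  obtain ⟨ρ, h1, h2⟩ := (this.and self_mem_nhdsWithin).exists
  exact ⟨ρ, h2, h1⟩

lemma HessData.exists_common_sheet {k₀ : Fin m} {q : Fin n → ℂ → ℂ}
    (hq : ∀ z, (∀ k, z ≠ a k) → ∀ j, q j z = D.q k₀ j z) {y : Fin n → Cover a x₀ → ℂ}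
    (hy : ∀ j, IsScalarSolution a x₀ q (y j)) (x : Cover a x₀) :
    ∃ r > 0, (∀ w ∈ ball x.proj r, ∀ k, w ≠ a k) ∧ ∃ F : Fin n → ℂ → ℂ, ∀ j,
      (∀ w ∈ ball x.proj r, AnalyticAt ℂ (F j) w ∧ D.V k₀ n (F j) w = 0) ∧ IsSheetOf (y j) x r
          (F j) := by
  choose r hr F hF hs using fun j => hy j x
  obtain ⟨ρ, hρ, hρr⟩ := exists_common_radius hr
  obtain ⟨δ, hδ, hδa⟩ := exists_ball_ne_nodes x.1
  have h1 : ∀ w ∈ ball x.proj (min ρ δ), ∀ k, w ≠ a k := fun w hw =>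
    hδa w (ball_subset_ball (min_le_right _ _) hw)
  refine ⟨min ρ δ, lt_min hρ hδ, h1, F, fun j => ⟨fun w hw => ?_,
    (hs j).mono ((min_le_left _ _).trans (hρr j))⟩⟩
  obtain ⟨h2, h3⟩ := hF j w (ball_subset_ball ((min_le_left _ _).trans (hρr j)) hw)
  refine ⟨h2, ?_⟩
  rw [D.V_eq_scalarOp k₀ (h1 w hw) h2]
  have : scalarOp (D.q k₀) (F j) w = scalarOp q (F j) w := by
    simp only [scalarOp, hq w (h1 w hw)]
  rw [this, h3, mul_zero]

lemma IsSheetOf.sum {y : Fin n → Cover a x₀ → ℂ} {x : Cover a x₀} {r : ℝ} {F : Fin n → ℂ → ℂ}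
    (h : ∀ j, IsSheetOf (y j) x r (F j)) (b : Fin n → ℂ) :
    IsSheetOf (fun x => ∑ j, b j * y j x) x r (fun w => ∑ j, b j * F j w) := fun w c hc =>
  Finset.sum_congr rfl fun j _ => congrArg (b j * ·) (h j w c hc)

/-- Independent solutions of the scalar equation give a solution of the system, with the same
monodromy. -/
lemma HessData.systemMonodromy {k₀ : Fin m} {q : Fin n → ℂ → ℂ}
    (hq : ∀ z, (∀ k, z ≠ a k) → ∀ j, q j z = D.q k₀ j z)
    {ℓ : Fin m → Path.Homotopic.Quotient x₀ x₀} {M : Fin m → Matrix (Fin n) (Fin n) ℂ}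
    (h : ScalarMonodromy a x₀ ℓ q M) : SystemMonodromy a x₀ ℓ D.A M := by
  obtain ⟨y, hy, hli, χ, hχ, C, hC⟩ := h
  choose r hr hra F hF using D.exists_common_sheet hq hy
  have hVan : ∀ x, ∀ j, ∀ w ∈ ball x.proj (r x), AnalyticAt ℂ (F x j) w := fun x j w hw =>
    ((hF x j).1 w hw).1
  refine ⟨fun x => Matrix.of fun i j => gauge a k₀ κ₀ x.proj * D.V k₀ (n - 1 - i) (F x j) x.proj,
    fun x => ⟨?_, r x, hr x, fun w => Matrix.of fun i j =>
      gauge a k₀ κ₀ w * D.V k₀ (n - 1 - i) (F x j) w, fun w hw i j => ?_, fun w c hc => ?_⟩,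
    χ, fun k x => ?_, C, hC⟩
  -- A vector in the kernel gives a combination of the solutions on which the whole chain vanishes
  -- at one point. It is zero near that point, hence on the whole covering by the identity theorem,
  -- against linear independence.
  · intro hdet
    obtain ⟨v, hv, hv0⟩ := Matrix.exists_mulVec_eq_zero_iff.2 hdet
    have hx := mem_ball_self (x := x.proj) (hr x)
    have hf : AnalyticAt ℂ (fun w => ∑ j, v j * F x j w) x.proj :=
      Finset.analyticAt_fun_sum _ fun j _ => analyticAt_const.mul (hVan x j _ hx)
    have hsum : ∀ l, ∀ w ∈ ball x.proj (r x), D.V k₀ l (fun w => ∑ j, v j * F x j w) w =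
        ∑ j, v j * D.V k₀ l (F x j) w := fun l w hw =>
      jetOp_sum D.F (D.c k₀) Finset.univ v (fun j _ => hVan x j w hw) l
    have h1 : ∀ᶠ w in 𝓝 x.proj, ∑ j, v j * F x j w = 0 := by
      refine D.eventually_eq_zero_of_V (k₀ := k₀) (hra x _ hx) hf ?_ fun l hl => ?_
      · filter_upwards [ball_mem_nhds x.proj (hr x)] with w hw
        rw [hsum n w hw]
        exact Finset.sum_eq_zero fun j _ => by rw [((hF x j).1 w hw).2, mul_zero]
      · rw [hsum l _ hx]
        have h2 := congrFun hv0 ⟨n - 1 - l, by omega⟩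
        simp only [Matrix.mulVec, dotProduct, Matrix.of_apply, Pi.zero_apply] at h2
        rw [show n - 1 - (n - 1 - l) = l by omega] at h2
        apply mul_left_cancel₀ (gauge_ne (κ₀ := κ₀) (hra x _ hx) (k₀ := k₀))
        rw [mul_zero, ← h2, Finset.mul_sum]
        exact Finset.sum_congr rfl fun j _ => by ring
    obtain ⟨ρ, hρ, hρ0⟩ := Metric.eventually_nhds_iff_ball.1 h1
    have h3 : (fun x => ∑ j, v j * y j x) = 0 := by
      refine eq_zero_of_sheet (fun x => ⟨r x, hr x, fun w => ∑ j, v j * F x j w, fun w hw => ?_,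
        IsSheetOf.sum (fun j => (hF x j).2) v⟩) (x := x) (lt_min (hr x) hρ)
        ((IsSheetOf.sum (fun j => (hF x j).2) v).mono (min_le_left _ _)) fun w hw =>
          hρ0 w (ball_subset_ball (min_le_right _ _) hw)
      exact Finset.analyticAt_fun_sum _ fun j _ => analyticAt_const.mul (hVan x j w hw)
    refine hv (funext fun j => Fintype.linearIndependent_iff.1 hli v ?_ j)
    rw [← h3]
    funext x
    simp
  · have := D.hasDerivAt_of_V (κ₀ := κ₀) (hra x w hw) (hVan x j w hw) ((hF x j).1 w hw).2 i
    convert! this using 1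
  · ext i j
    simp only [Matrix.of_apply]
    have hw := mem_ball_of_path hc
    obtain ⟨ρ, hρ, hsub⟩ := Metric.isOpen_iff.1 isOpen_ball _ hw
    -- The matrix was defined with a separately chosen sheet at every point; near a common point
    -- these choices agree, and the operators depend only on the germ.
    have h1 := ((hF x j).2.restrict hc hsub).eventuallyEq (hF _ j).2 hρ (hr _)
    exact congrArg (gauge a k₀ κ₀ w.1 * ·) (jetOp_congr h1.symm _).self_of_nhds
  · ext i j
    have h1 : IsSheetOf (y j) x (r (deck (ℓ k) x)) (fun w => ∑ i, χ k i j * F (deck (ℓ k) x) i w)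
        := by
      have h2 := IsSheetOf.sum (fun i => (hF (deck (ℓ k) x) i).2.deck) (fun i => χ k i j)
      convert! h2 using 1
      funext x
      rw [hχ k x j]
      exact Finset.sum_congr rfl fun _ _ => mul_comm _ _
    have h3 := (hF x j).2.eventuallyEq h1 (hr _) (hr _)
    have h4 := (jetOp_congr (F := D.F) (c := D.c k₀) h3 (n - 1 - i)).self_of_nhds
    rw [jetOp_sum D.F (D.c k₀) Finset.univ (fun i => χ k i j) (z := x.proj) (fun i _ =>
      hVan (deck (ℓ k) x) i _ (mem_ball_self (hr _)))] at h4
    rw [Matrix.mul_apply]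
    simp only [Matrix.of_apply]
    rw [HessData.V, h4, Finset.mul_sum]
    refine Finset.sum_congr rfl fun s _ => ?_
    change _ = gauge a k₀ κ₀ x.proj * _ * _
    rw [mul_comm (χ k s j), mul_assoc]
    rfl

end ScalarToSystem

end StdForm

end

section

open Complex Metric Filter Topology
open scoped Matrix.Norms.Operator

namespace StdForm

/-! ### The standard form of the constructed system -/

section ScalarToStandardForm

variable {m : ℕ} {a : Fin m → ℂ} {x₀ : PSphere a} {n : ℕ} {κ₀ : ℤ} (D : HessData a n κ₀)

/-- The monodromy around a singular point in terms of the local exponent matrix. -/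
lemma LocalForm.exists_conj {A : ℂ → Matrix (Fin n) (Fin n) ℂ} {k : Fin m}
    {R : Matrix (Fin n) (Fin n) ℂ} (h : LocalForm a A k R) {W : ℂ → Matrix (Fin n) (Fin n) ℂ}
    {χ : Matrix (Fin n) (Fin n) ℂ} (hW : ∀ ζ ∈ loopDomain a k, (W ζ).det ≠ 0 ∧
      SolvesSystemAt (fun ξ => exp ξ • A (a k + exp ξ)) W ζ)
    (hχ : ∀ ζ ∈ loopDomain a k, W ζ = W (ζ + 2 * Real.pi * I) * χ) :
    ∃ C : GL (Fin n) ℂ, (C : Matrix (Fin n) (Fin n) ℂ) * χ =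
      NormedSpace.exp ((-(2 * Real.pi * I) : ℂ) • R) * C := by
  obtain ⟨ε, hε, hεa, hY⟩ := h
  have hmem : ∀ ζ : ℂ, ζ.re < Real.log ε → ζ ∈ loopDomain a k := fun ζ hζ j hj => by
    rw [← Complex.norm_exp]
    exact ((norm_exp_lt_iff hε).2 hζ).trans_le (hεa j hj)
  obtain ⟨Z, C, hZ, hWZ⟩ := hY W fun ζ hζ => hW ζ (hmem ζ hζ)
  obtain ⟨ζ, hζ⟩ : ∃ ζ : ℂ, ζ.re < Real.log ε :=
    ⟨((Real.log ε - 1 : ℝ) : ℂ), by rw [ofReal_re]; linarith⟩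
  refine ⟨C, ?_⟩
  have h1 := hχ ζ (hmem ζ hζ)
  rw [hWZ ζ hζ, hWZ _ (by simpa using hζ), Complex.exp_periodic, mul_assoc, mul_assoc, mul_assoc]
    at h1
  have hZu : IsUnit (Z (a k + exp ζ)) := (Matrix.isUnit_iff_isUnit_det _).2 (hZ _ (by
    rw [mem_ball, dist_eq_norm, add_sub_cancel_left]
    exact (norm_exp_lt_iff hε).2 hζ)).1.isUnit
  have h2 := hZu.mul_left_cancel h1
  have hc : ∀ s t : ℂ, NormedSpace.exp (s • R) * NormedSpace.exp (t • R) =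
      NormedSpace.exp ((s + t) • R) := fun s t => by
    rw [add_smul, Matrix.exp_add_of_commute _ _ (((Commute.refl R).smul_left s).smul_right t)]
  have h3 : NormedSpace.exp (ζ • R) * (NormedSpace.exp ((-(2 * Real.pi * I) : ℂ) • R) * C) =
      NormedSpace.exp (ζ • R) * (C * χ) := by
    have h4 := congrArg (NormedSpace.exp ((-(2 * Real.pi * I) : ℂ) • R) * ·) h2
    simp only [← mul_assoc, hc] at h4 ⊢
    rw [add_comm ζ, h4]
    congr 4
    ring
  exact ((Matrix.isUnit_exp _).mul_left_cancel h3).symm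

/-- The exponents are determined by the equation, and the shift by `κ₀` is injective on multisets,
so it can be undone. -/
lemma HessData.roots_residue (ha : Function.Injective a) {k₀ : Fin m} {q : Fin n → ℂ → ℂ}
    (hqD : ∀ z, (∀ k, z ≠ a k) → ∀ j, q j z = D.q k₀ j z) {k : Fin m} {s : Multiset ℂ}
    (hq : FuchsianAt q (a k) (s.map fun e : ℂ => if k = k₀ then e - (κ₀ : ℂ) else e)) :
    (D.residue k).charpoly.roots = s := by
  have h1 := hq.unique (D.fuchsianAt_q ha k₀ k) (by
    have : ∀ᶠ z in 𝓝[≠] a k, ∀ j, z ≠ a j := eventually_all.2 fun j => by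
      by_cases hj : j = k
      · rw [hj]; exact self_mem_nhdsWithin
      · exact nhdsWithin_le_nhds (isOpen_ne.mem_nhds fun h => hj (ha h).symm)
    filter_upwards [this] with z hz using hqD z hz)
  refine (Multiset.map_injective (fun e e' h => ?_) h1).symm
  split_ifs at h
  · exact sub_left_injective h
  · exact h

lemma mem_spectrum_iff_mem_roots (R : Matrix (Fin n) (Fin n) ℂ) (s : ℂ) :
    s ∈ spectrum ℂ R ↔ s ∈ R.charpoly.roots := by
  rw [Polynomial.mem_roots (Matrix.charpoly_monic R).ne_zero,
    Matrix.mem_spectrum_iff_isRoot_charpoly]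

/-- A Fuchsian equation gives a system of standard form in Hessenberg form. -/
lemma exists_system_of_scalar (hm : 0 < m) (hn : 0 < n) (ha : Function.Injective a)
    {ℓ : Fin m → Path.Homotopic.Quotient x₀ x₀} (hℓ : ∀ k, GoesOnceAround a x₀ k (ℓ k))
    {κ : Fin n → ℤ} (hκa : Antitone κ)
    (hκ : ∀ i : Fin n, κ i = κ₀ + (n - 1 - i : ℕ) * ((m : ℤ) - 2))
    (k₀ : Fin m) {M E : Fin m → Matrix (Fin n) (Fin n) ℂ} (hME : Admissible M E)
    {q : Fin n → ℂ → ℂ} (hq : IsFuchsianEquation a q (fun k => (E k).charpoly.roots.map fun e =>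
      if k = k₀ then e - (κ₀ : ℂ) else e)) (hmon : ScalarMonodromy a x₀ ℓ q M) :
    ∃ A : ℂ → Matrix (Fin n) (Fin n) ℂ, HasHessenbergForm a κ A ∧ IsStandardForm a x₀ ℓ A M E κ :=
        by
  obtain ⟨D, hDA, hqD⟩ := exists_hessData_of_scalar hn ha k₀ hκ hq
  have hsys := D.systemMonodromy hqD hmon
  refine ⟨D.A, hDA, hME, hκa, fun z hz i j => D.analyticAt_A hz i j, D.apparentAtInfinity hm hκ,
      hsys,
    fun k => ?_, D.formAtInfinity hm hκ⟩
  have hspec : spectrum ℂ (D.residue k) = spectrum ℂ (E k) := by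
    ext s
    rw [mem_spectrum_iff_mem_roots, mem_spectrum_iff_mem_roots,
      D.roots_residue ha hqD (hq.fuchsian k)]
  have hR : NonResonant (D.residue k) := by
    rw [NonResonant, hspec]
    exact hME.nonResonant k
  obtain ⟨Y, hY, χ, hχ, C, hC⟩ := hsys
  obtain ⟨W, hW, hWχ⟩ := hY.exists_pullback (hℓ k)
  -- The local form is first used with the residue itself as exponent matrix, which makes the
  -- monodromy `χ k` conjugate to the exponential of `-2πi` times the residue.
  obtain ⟨C', hC'⟩ := (D.localForm ha hR isUnit_one
      (mul_one _ |>.trans (one_mul _).symm)).exists_conj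
    hW (hWχ _ (hχ k))
  obtain ⟨c, hc⟩ := hME.similar k
  have hχM : χ k * C = C * M k := by
    rw [hC k, mul_assoc, ← mul_assoc (C : Matrix (Fin n) (Fin n) ℂ), Units.mul_inv, one_mul]
  have hMc : M k * (c⁻¹ : (Matrix (Fin n) (Fin n) ℂ)ˣ) =
      (c⁻¹ : (Matrix (Fin n) (Fin n) ℂ)ˣ) * NormedSpace.exp ((-(2 * Real.pi * I) : ℂ) • E k) := by
    rw [Units.mul_inv_eq_iff_eq_mul, mul_assoc, ← hc.eq, ← mul_assoc, Units.inv_mul, one_mul]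
  -- The three factors lead from the exponential of the residue to `χ k`, on to `M k` and finally to
  -- the exponential of `E k`. By `intertwining_of_exp` their product conjugates the residue to `E
  -- k` itself.
  refine D.localForm ha hR (X := C' * C * (c⁻¹ : (Matrix (Fin n) (Fin n) ℂ)ˣ))
    ((C'.isUnit.mul C.isUnit).mul (Units.isUnit _)) (intertwining_of_exp ?_ ?_)
  · rw [hspec]
    exact hME.nonResonant k
  · calc _ = (NormedSpace.exp ((-(2 * Real.pi * I) : ℂ) • D.residue k) * C') * C *
          (c⁻¹ : (Matrix (Fin n) (Fin n) ℂ)ˣ) := by simp only [mul_assoc]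
      _ = C' * (χ k * C) * (c⁻¹ : (Matrix (Fin n) (Fin n) ℂ)ˣ) := by rw [← hC']; simp only
          [mul_assoc]
      _ = C' * C * (M k * (c⁻¹ : (Matrix (Fin n) (Fin n) ℂ)ˣ)) := by rw [hχM]; simp only [mul_assoc]
      _ = _ := by rw [hMc]; simp only [mul_assoc]

end ScalarToStandardForm

end StdForm

end

theorem theorem5p4 (m n : ℕ) (hm : 0 < m) (hn : 0 < n)
    (a : Fin m → ℂ) (ha : Function.Injective a)
    (x₀ : StdForm.PSphere a) (ℓ : Fin m → Path.Homotopic.Quotient x₀ x₀)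
    (hℓ : StdForm.IsStandardGenerators a x₀ ℓ)
    (κ : Fin n → ℤ) (hκ : Antitone κ)
    (hκm : ∀ i j : Fin n, (j : ℕ) = (i : ℕ) + 1 → κ i - κ j = (m : ℤ) - 2)
    (M E : Fin m → Matrix (Fin n) (Fin n) ℂ) (hME : StdForm.Admissible M E) :
    (∃ A : ℂ → Matrix (Fin n) (Fin n) ℂ,
        StdForm.HasHessenbergForm a κ A ∧ StdForm.IsStandardForm a x₀ ℓ A M E κ) ↔
      ∃ q : Fin n → ℂ → ℂ,
        StdForm.IsFuchsianEquation a q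
          (fun k => (E k).charpoly.roots.map fun e =>
            if (k : ℕ) + 1 = m then e - (κ ⟨n - 1, Nat.sub_lt hn Nat.one_pos⟩ : ℂ) else e) ∧
        StdForm.ScalarMonodromy a x₀ ℓ q M := by
  set k₀ : Fin m := ⟨m - 1, Nat.sub_lt hm Nat.one_pos⟩ with hk₀
  have hk : ∀ k : Fin m, (k : ℕ) + 1 = m ↔ k = k₀ := fun k => by
    rw [hk₀, Fin.ext_iff]
    dsimp only
    omega
  have hκ' := StdForm.index_eq hn hκm
  simp only [hk]
  constructor
  · rintro ⟨A, hA, hS⟩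
    exact StdForm.exists_scalar_of_system hm hn ha hℓ.around hκ' k₀ hA hS.monodromy hS.localForm
  · rintro ⟨q, hq, hmon⟩
    exact StdForm.exists_system_of_scalar hm hn ha hℓ.around hκ hκ' k₀ hME hq hmon
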